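/- Fix the standard list $\Phi_0,\Phi_1,\dots$ of all Turing functionals, a computable pairing $\langle\cdot,\cdot\rangle$ on $\mathbb N$ and a computable numbering of $\mathbb Q$; write $X'=\{e:\Phi_e^X(e)\downarrow\}$. For real $x$ let $L_x=\{q\in\mathbb Q:q<x\}$ and $R_x=\{q\in\mathbb Q:q>x\}$, viewed as sets of natural numbers. A presentation of an ordinal $\alpha$ with $0<\alpha<\omega_1$ is a linear order $\mathcal A=(D,\prec)$ isomorphic to $(\alpha,\in)$ whose domain $D\subseteq\mathbb N$ is coinfinite and whose least element is the number $0$. It is $S$-decidable if $S$ computes the complete (elementary) diagram of $\mathcal A$; then automatically $\alpha<\omega_1^S$. For $k\in D$ let $\mathcal B_k$ be the restriction of $\prec$ to $\{i\in D:i\prec k\}$. For $C\subseteq\mathbb N$ the $\mathcal A$-jump $C^{(\mathcal A)}$ is defined recursively as the set of all $\langle k,n\rangle$ such that either $k\in D$ and $n\in C^{(\mathcal B_k)}$ (where $C^{(\mathcal B_0)}=C$, as $\mathcal B_0$ is empty), or $\mathcal A$ has a $\prec$-greatest element $j$, $k$ is the least number $>j$ outside $D$, and $n\in (C^{(\mathcal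 B_j)})'$. **Theorem.** There are computable functions $\psi,u:\mathbb Q\to\mathbb N$ such that, writing $\Psi_\epsilon=\Phi_{\psi(\epsilon)}$, the following holds for every rational $\epsilon>0$, every $S\subseteq\mathbb N$ and every $S$-decidable presentation $\mathcal A$ of any nonzero ordinal $\alpha<\omega_1^S$. Let $$\mathcal U_{\epsilon,S,\mathcal A}=\{x\in[0,1]:\Psi_\epsilon^{S^{(\mathcal A)}\oplus L_x\oplus R_x}\neq(S\oplus L_x\oplus R_x)^{(\mathcal A)}\},$$ where a set is identified with its characteristic function. Then: 1. $\mathcal U_{\epsilon,S,\mathcal A}$ has Lebesgue measure $<\epsilon$; 2. $\mathcal U_{\epsilon,S,\mathcal A}$ is, relative to $[0,1]$, an $S^{(\mathcal A)}$-effective union of rational open intervals, uniformly in $\epsilon,S,\alpha,\mathcal A$: it equals $[0,1]\cap\bigcup\{(p,q):\langle p,q\rangle\in\operatorname{dom}\Phi_{u(\epsilon)}^{S^{(\mathcal A)}}\}$; 3. $\Psi_\epsilon^{S^{(\mathcal A)}\oplus L_x\oplus R_x}$ is total for every $x\in\mathbb R$. -/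

import Mathlib

open Encodable

noncomputable section

namespace EffLusin

/-! ### Turing functionals and the jump -/

/-- The finite initial segment `X ↾ t` of (the characteristic function of) `X`. -/
def initSeg (X : Set ℕ) (t : ℕ) : List Bool :=
  open Classical in (List.range t).map fun i => decide (i ∈ X)

/-- `Φ_e^X(n)`, for the standard list `Φ_0, Φ_1, …` of all Turing functionals.  Program number `e`
receives a finite initial segment `X ↾ t` of the oracle together with the input `n`, and is run
for `u` steps.  All pairs `(t, u)` are tried in turn until a run halts; its output is the value,
and `Φ_e^X(n)` diverges if no run ever halts.  See `recursiveIn_iff` for the agreement with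
relative recursiveness. -/
def turingEval (e : ℕ) (X : Set ℕ) (n : ℕ) : Part ℕ :=
  Nat.rfindOpt fun s =>
    Nat.Partrec.Code.evaln s.unpair.2 (Denumerable.ofNat Nat.Partrec.Code e)
      (Nat.pair (encode (initSeg X s.unpair.1)) n)

/-- The characteristic function of a set of natural numbers. -/
def charFn (Y : Set ℕ) (n : ℕ) : ℕ := open Classical in if n ∈ Y then 1 else 0

/-- `Φ_e^X = Y`: the functional is total on `X` and is the characteristic function of `Y`. -/
def Computes (e : ℕ) (X Y : Set ℕ) : Prop :=
  ∀ n, turingEval e X n = Part.some (charFn Y n)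

/-- The Turing jump `X' = {e | Φ_e^X(e)↓}`. -/
def turingJump (X : Set ℕ) : Set ℕ := {e | (turingEval e X e).Dom}

/-- The join `X ⊕ Y`. -/
def join (X Y : Set ℕ) : Set ℕ := {n | (∃ a ∈ X, n = 2 * a) ∨ (∃ b ∈ Y, n = 2 * b + 1)}

/-! ### Agreement of `turingEval` with relative recursiveness -/

/-- Partial functions given by a monotone partial recursive function of finite initial
segments of the oracle -/
def FiniteUse (X : Set ℕ) (f : ℕ →. ℕ) : Prop :=
  ∃ F : List Bool × ℕ →. ℕ, Partrec F ∧
    (∀ σ τ n v, σ <+: τ → v ∈ F (σ, n) → v ∈ F (τ, n)) ∧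
    ∀ n v, v ∈ f n ↔ ∃ t, v ∈ F (initSeg X t, n)

theorem initSeg_mono (X : Set ℕ) {s t : ℕ} (h : s ≤ t) : initSeg X s <+: initSeg X t := by
  obtain ⟨k, rfl⟩ := Nat.exists_eq_add_of_le h
  unfold initSeg
  rw [List.range_add, List.map_append]
  exact List.prefix_append _ _

theorem initSeg_getElem? (X : Set ℕ) (t n : ℕ) :
    (initSeg X t)[n]? = open Classical in if n < t then some (decide (n ∈ X)) else none := by
  unfold initSeg
  split_ifs with h <;> simp [h]

theorem initSeg_succ (X : Set ℕ) (t : ℕ) :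
    initSeg X (t + 1) = initSeg X t ++ [open Classical in decide (t ∈ X)] := by
  unfold initSeg
  rw [List.range_succ, List.map_append]; rfl

theorem FiniteUse.of_total {X : Set ℕ} {g : ℕ → ℕ} (hg : Computable g) :
    FiniteUse X (fun n => Part.some (g n)) :=
  ⟨fun p => Part.some (g p.2), (hg.comp Computable.snd).partrec, fun _ _ _ _ _ h => h,
    fun _ _ => ⟨fun h => ⟨0, h⟩, fun ⟨_, h⟩ => h⟩⟩

theorem FiniteUse.oracle (X : Set ℕ) : FiniteUse X (fun n => Part.some (charFn X n)) := by
  refine ⟨fun p => ((p.1[p.2]?).map fun b => cond b 1 0 : Option ℕ), ?_, ?_, ?_⟩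
  · refine Computable.ofOption ?_
    exact Computable.option_map (Computable.list_getElem?.comp Computable.fst Computable.snd)
      (Computable.cond Computable.snd (Computable.const 1) (Computable.const 0)).to₂
  · rintro σ τ n v ⟨ρ, rfl⟩ h
    simp only [Part.mem_ofOption, Option.mem_def, Option.map_eq_some_iff] at h ⊢
    obtain ⟨b, hb, rfl⟩ := h
    refine ⟨b, ?_, rfl⟩
    have := (List.getElem?_eq_some_iff.1 hb).1
    rw [List.getElem?_append_left this, hb]
  · intro n v
    simp only [Part.mem_ofOption, Option.mem_def, Option.map_eq_some_iff, initSeg_getElem?,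
      Part.mem_some_iff, charFn]
    constructor
    · rintro rfl
      refine ⟨n + 1, _, if_pos (Nat.lt_succ_self n), ?_⟩
      by_cases h : n ∈ X <;> simp [h]
    · rintro ⟨t, b, hb, rfl⟩
      split_ifs at hb with h1
      obtain rfl := Option.some.inj hb
      by_cases h : n ∈ X <;> simp [h]

theorem FiniteUse.comp {X : Set ℕ} {f h : ℕ →. ℕ} (hf : FiniteUse X f) (hh : FiniteUse X h) :
    FiniteUse X (fun n => h n >>= f) := by
  obtain ⟨F, F1, F2, F3⟩ := hf
  obtain ⟨H, H1, H2, H3⟩ := hh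
  refine ⟨fun p => (H p).bind fun v => F (p.1, v), ?_, ?_, ?_⟩
  · exact H1.bind (F1.comp (Computable.pair (Computable.fst.comp Computable.fst) Computable.snd)).to₂
  · intro σ τ n v hs h
    simp only [Part.mem_bind_iff] at h ⊢
    obtain ⟨a, h1, h2⟩ := h
    exact ⟨a, H2 _ _ _ _ hs h1, F2 _ _ _ _ hs h2⟩
  · intro n v
    refine Part.mem_bind_iff.trans ?_
    simp only [F3, H3, Part.mem_bind_iff]
    constructor
    · rintro ⟨a, ⟨s, h1⟩, t, h2⟩
      exact ⟨max s t, a, H2 _ _ _ _ (initSeg_mono X (le_max_left s t)) h1,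
        F2 _ _ _ _ (initSeg_mono X (le_max_right s t)) h2⟩
    · rintro ⟨t, a, h1, h2⟩; exact ⟨a, ⟨t, h1⟩, t, h2⟩

theorem FiniteUse.pair {X : Set ℕ} {f h : ℕ →. ℕ} (hf : FiniteUse X f) (hh : FiniteUse X h) :
    FiniteUse X (fun n => Nat.pair <$> f n <*> h n) := by
  obtain ⟨F, F1, F2, F3⟩ := hf
  obtain ⟨H, H1, H2, H3⟩ := hh
  refine ⟨fun p => (F p).bind fun a => (H p).map fun b => Nat.pair a b, ?_, ?_, ?_⟩
  · have hm : Partrec fun q : (List Bool × ℕ) × ℕ => (H q.1).map fun b => Nat.pair q.2 b :=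
      Partrec.map (H1.comp Computable.fst)
        (Primrec₂.natPair.to_comp.comp (Computable.snd.comp Computable.fst) Computable.snd).to₂
    exact F1.bind hm.to₂
  · intro σ τ n v hs h
    simp only [Part.mem_bind_iff, Part.mem_map_iff] at h ⊢
    obtain ⟨a, h1, b, h2, rfl⟩ := h
    exact ⟨a, F2 _ _ _ _ hs h1, b, H2 _ _ _ _ hs h2, rfl⟩
  · intro n v
    simp only [Seq.seq, Part.map_eq_map, Part.mem_bind_iff, Part.mem_map_iff, F3, H3]
    constructor
    · rintro ⟨_, ⟨a, ⟨s, h1⟩, rfl⟩, b, ⟨t, h2⟩, rfl⟩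
      exact ⟨max s t, a, F2 _ _ _ _ (initSeg_mono X (le_max_left s t)) h1, b,
        H2 _ _ _ _ (initSeg_mono X (le_max_right s t)) h2, rfl⟩
    · rintro ⟨t, a, h1, b, h2, rfl⟩
      exact ⟨_, ⟨a, ⟨t, h1⟩, rfl⟩, b, ⟨t, h2⟩, rfl⟩

theorem FiniteUse.prec {X : Set ℕ} {f h : ℕ →. ℕ} (hf : FiniteUse X f) (hh : FiniteUse X h) :
    FiniteUse X (fun p => let (a, n) := Nat.unpair p
        n.rec (f a) fun y IH => do
          let i ← IH
          h (Nat.pair a (Nat.pair y i))) := by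
  obtain ⟨F, F1, F2, F3⟩ := hf
  obtain ⟨H, H1, H2, H3⟩ := hh
  refine ⟨fun p => Nat.rec (F (p.1, p.2.unpair.1)) (fun y IH => IH.bind fun i =>
    H (p.1, Nat.pair p.2.unpair.1 (Nat.pair y i))) p.2.unpair.2, ?_, ?_, ?_⟩
  · have hu : Computable fun p : List Bool × ℕ => p.2.unpair :=
      Computable.unpair.comp Computable.snd
    refine Partrec.nat_rec (Computable.snd.comp hu)
      (F1.comp (Computable.pair Computable.fst (Computable.fst.comp hu)))
      (h := fun p q => H (p.1, Nat.pair p.2.unpair.1 (Nat.pair q.1 q.2))) ?_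
    refine (H1.comp (Computable.pair (Computable.fst.comp Computable.fst)
      (Primrec₂.natPair.to_comp.comp (Computable.fst.comp (hu.comp Computable.fst))
        (Primrec₂.natPair.to_comp.comp (Computable.fst.comp Computable.snd)
          (Computable.snd.comp Computable.snd))))).to₂
  · intro σ τ n v hs
    simp only
    generalize n.unpair.2 = k
    induction k generalizing v with
    | zero => exact F2 _ _ _ _ hs
    | succ k ih =>
      simp only [Part.mem_bind_iff]
      rintro ⟨a, h1, h2⟩
      exact ⟨a, ih _ h1, H2 _ _ _ _ hs h2⟩
  · intro n v
    have mono : ∀ σ τ a k v, σ <+: τ →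
        v ∈ (Nat.rec (F (σ, a)) (fun y IH => IH.bind fun i =>
          H (σ, Nat.pair a (Nat.pair y i))) k : Part ℕ) →
        v ∈ (Nat.rec (F (τ, a)) (fun y IH => IH.bind fun i =>
          H (τ, Nat.pair a (Nat.pair y i))) k : Part ℕ) := by
      intro σ τ a k v hs
      induction k generalizing v with
      | zero => exact F2 _ _ _ _ hs
      | succ k ih =>
        simp only [Part.mem_bind_iff]
        rintro ⟨a, h1, h2⟩
        exact ⟨a, ih _ h1, H2 _ _ _ _ hs h2⟩
    simp only
    generalize n.unpair.2 = k
    generalize n.unpair.1 = a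
    induction k generalizing v with
    | zero => exact F3 _ _
    | succ k ih =>
      simp only [Part.bind_eq_bind, Part.mem_bind_iff] at ih ⊢
      constructor
      · rintro ⟨i, h1, h2⟩
        obtain ⟨s, h1⟩ := (ih i).1 h1
        obtain ⟨t, h2⟩ := (H3 _ _).1 h2
        exact ⟨max s t, i, mono _ _ _ _ _ (initSeg_mono X (le_max_left s t)) h1,
          H2 _ _ _ _ (initSeg_mono X (le_max_right s t)) h2⟩
      · rintro ⟨t, i, h1, h2⟩
        exact ⟨i, (ih i).2 ⟨t, h1⟩, (H3 _ _).2 ⟨t, h2⟩⟩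

theorem FiniteUse.rfind {X : Set ℕ} {f : ℕ →. ℕ} (hf : FiniteUse X f) :
    FiniteUse X (fun a => Nat.rfind fun n => (fun m => m = 0) <$> f (Nat.pair a n)) := by
  obtain ⟨F, F1, F2, F3⟩ := hf
  refine ⟨fun p => Nat.rfind fun n => (F (p.1, Nat.pair p.2 n)).map fun m => decide (m = 0),
    ?_, ?_, ?_⟩
  · have hd : Computable fun m : ℕ => decide (m = 0) :=
      (Primrec.eq.comp Primrec.id (Primrec.const 0)).decide.to_comp
    have hg : Partrec fun q : (List Bool × ℕ) × ℕ => F (q.1.1, Nat.pair q.1.2 q.2) :=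
      F1.comp (Computable.pair (Computable.fst.comp Computable.fst)
        (Primrec₂.natPair.to_comp.comp (Computable.snd.comp Computable.fst) Computable.snd))
    have hm : Partrec fun q : (List Bool × ℕ) × ℕ =>
        (F (q.1.1, Nat.pair q.1.2 q.2)).map fun m => decide (m = 0) :=
      Partrec.map hg (hd.comp Computable.snd).to₂
    exact Partrec.rfind hm.to₂
  · intro σ τ n v hs h
    obtain ⟨h0, h3⟩ := Nat.mem_rfind.1 h
    refine Nat.mem_rfind.2 ⟨?_, fun {m} hm => ?_⟩
    · obtain ⟨a, h1, h2⟩ := (Part.mem_map_iff _).1 h0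
      exact (Part.mem_map_iff _).2 ⟨a, F2 _ _ _ _ hs h1, h2⟩
    · obtain ⟨a, h1, h2⟩ := (Part.mem_map_iff _).1 (h3 hm)
      exact (Part.mem_map_iff _).2 ⟨a, F2 _ _ _ _ hs h1, h2⟩
  · intro n v
    constructor
    · intro h
      obtain ⟨h0, h3⟩ := Nat.mem_rfind.1 h
      obtain ⟨a, h1, h2⟩ := (Part.mem_map_iff _).1 h0
      obtain ⟨s, h1⟩ := (F3 _ _).1 h1
      have : ∀ m, ∃ t, m < v → ∃ a, a ∈ F (initSeg X t, Nat.pair n m) ∧ decide (a = 0) = false := by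
        intro m
        by_cases hm : m < v
        · obtain ⟨a, h4, h5⟩ := (Part.mem_map_iff _).1 (h3 hm)
          obtain ⟨t, h4⟩ := (F3 _ _).1 h4
          exact ⟨t, fun _ => ⟨a, h4, h5⟩⟩
        · exact ⟨0, fun h => absurd h hm⟩
      choose t ht using this
      refine ⟨max s ((Finset.range v).sup t), Nat.mem_rfind.2 ⟨(Part.mem_map_iff _).2 ⟨a,
        F2 _ _ _ _ (initSeg_mono X (le_max_left _ _)) h1, h2⟩, fun {m} hm => ?_⟩⟩
      obtain ⟨a, h4, h5⟩ := ht m hm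
      exact (Part.mem_map_iff _).2 ⟨a, F2 _ _ _ _ (initSeg_mono X ((Finset.le_sup
        (Finset.mem_range.2 hm)).trans (le_max_right _ _))) h4, h5⟩
    · rintro ⟨t, h⟩
      obtain ⟨h0, h3⟩ := Nat.mem_rfind.1 h
      refine Nat.mem_rfind.2 ⟨?_, fun {m} hm => ?_⟩
      · obtain ⟨a, h1, h2⟩ := (Part.mem_map_iff _).1 h0
        exact (Part.mem_map_iff _).2 ⟨a, (F3 _ _).2 ⟨t, h1⟩, h2⟩
      · obtain ⟨a, h1, h2⟩ := (Part.mem_map_iff _).1 (h3 hm)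
        exact (Part.mem_map_iff _).2 ⟨a, (F3 _ _).2 ⟨t, h1⟩, h2⟩

theorem FiniteUse.exists_index {X : Set ℕ} {f : ℕ →. ℕ} (hf : FiniteUse X f) :
    ∃ e, turingEval e X = f := by
  obtain ⟨F, F1, F2, F3⟩ := hf
  obtain ⟨c, hc⟩ := Nat.Partrec.Code.exists_code.1 F1
  have hc' : ∀ σ n v, v ∈ c.eval (Nat.pair (encode σ) n) ↔ v ∈ F (σ, n) := by
    intro σ n v
    have hp : decode (α := List Bool × ℕ) (Nat.pair (encode σ) n) = some (σ, n) :=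
      encodek (σ, n)
    rw [hc]
    change v ∈ (Part.ofOption (decode (α := List Bool × ℕ) (Nat.pair (encode σ) n))).bind
      (fun a => (F a).map encode) ↔ _
    rw [hp]
    simp
  refine ⟨encode c, funext fun n => ?_⟩
  have key : ∀ v, v ∈ turingEval (encode c) X n → v ∈ f n := by
    intro v hv
    obtain ⟨s, hs⟩ := Nat.rfindOpt_spec hv
    rw [Denumerable.ofNat_encode] at hs
    exact (F3 n v).2 ⟨_, (hc' _ _ _).1 (Nat.Partrec.Code.evaln_sound hs)⟩
  refine Part.ext fun v => ⟨key v, fun hv => ?_⟩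
  obtain ⟨t, ht⟩ := (F3 n v).1 hv
  obtain ⟨u, hu⟩ := Nat.Partrec.Code.evaln_complete.1 ((hc' _ _ _).2 ht)
  have hd : (turingEval (encode c) X n).Dom := by
    refine Nat.rfindOpt_dom.2 ⟨Nat.pair t u, v, ?_⟩
    rw [Denumerable.ofNat_encode, Nat.unpair_pair]
    exact hu
  have hg := Part.get_mem hd
  rwa [Part.mem_unique (key _ hg) hv] at hg

theorem computable_run (c : Nat.Partrec.Code) :
    Computable fun z : ℕ => encode (Nat.Partrec.Code.evaln z.unpair.1.unpair.2.unpair.2 c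
      (Nat.pair z.unpair.2 z.unpair.1.unpair.1)) := by
    have u1 : Computable fun z : ℕ => z.unpair.1.unpair :=
      Computable.unpair.comp (Computable.fst.comp Computable.unpair)
    have u2 : Computable fun z : ℕ => z.unpair.1.unpair.2.unpair.2 :=
      Computable.snd.comp (Computable.unpair.comp (Computable.snd.comp u1))
    have u3 : Computable fun z : ℕ => Nat.pair z.unpair.2 z.unpair.1.unpair.1 :=
      Primrec₂.natPair.to_comp.comp (Computable.snd.comp Computable.unpair)
        (Computable.fst.comp u1)
    have he : Computable fun a : (ℕ × Nat.Partrec.Code) × ℕ =>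
        Nat.Partrec.Code.evaln a.1.1 a.1.2 a.2 := Nat.Partrec.Code.primrec_evaln.to_comp
    have hp : Computable fun z : ℕ => ((z.unpair.1.unpair.2.unpair.2, c),
        Nat.pair z.unpair.2 z.unpair.1.unpair.1) := (u2.pair (Computable.const c)).pair u3
    have h := he.comp hp
    exact Computable.encode.comp h

theorem turingEval_recursiveIn (e : ℕ) (X : Set ℕ) :
    Nat.RecursiveIn {fun n => Part.some (charFn X n)} (turingEval e X) := by
  set O : Set (ℕ →. ℕ) := {fun n => Part.some (charFn X n)} with hO
  set T : (ℕ → ℕ) → Prop := fun f => Nat.RecursiveIn O fun n => Part.some (f n) with hT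
  have tcomp : ∀ {f g : ℕ → ℕ}, T f → T g → T fun n => f (g n) := fun hf hg =>
    (hf.comp hg).of_eq fun n => Part.bind_some _ _
  have tpair : ∀ {f g : ℕ → ℕ}, T f → T g → T fun n => Nat.pair (f n) (g n) := fun hf hg =>
    (hf.pair hg).of_eq fun n => by simp [Seq.seq]
  have tprim : ∀ {f : ℕ → ℕ}, Computable f → T f := fun hf =>
    (Partrec.nat_iff.1 hf.partrec).recursiveIn
  have toracle : T (charFn X) := .oracle _ rfl
  have tl : T fun n => n.unpair.1 := tprim (Computable.fst.comp Computable.unpair)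
  have tr : T fun n => n.unpair.2 := tprim (Computable.snd.comp Computable.unpair)
  have tid : T fun n => n := tprim Computable.id
  have hg : Computable fun m : ℕ => encode
      ((decode (α := List Bool) m.unpair.1).getD [] ++ [decide (m.unpair.2 = 1)]) := by
    refine Computable.encode.comp (Computable.list_concat.comp ?_ ?_)
    · exact Computable.option_getD (Computable.decode.comp (Computable.fst.comp Computable.unpair))
        (Computable.const [])
    · exact (Primrec.eq.comp (Primrec.snd.comp Primrec.unpair) (Primrec.const 1)).decide.to_comp
  have tseg : T fun t => encode (initSeg X t) := by
    have trec : ∀ {b : ℕ} {h : ℕ → ℕ}, T h → ∀ {p : ℕ → ℕ}, p 0 = b →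
        (∀ t, p (t + 1) = h (Nat.pair 0 (Nat.pair t (p t)))) → T p := by
      intro b h hh p hp0 hp1
      refine ((Nat.RecursiveIn.prec (tprim (Computable.const b)) hh).comp
        (tpair (tprim (Computable.const 0)) tid)).of_eq fun t => ?_
      refine (Part.bind_some _ _).trans ?_
      simp only [Nat.unpair_pair]
      induction t with
      | zero => subst hp0; rfl
      | succ t ih => rw [hp1]; simp only [ih]; exact Part.bind_some _ _
    refine trec (tcomp (tprim hg) (tpair (tcomp tr tr) (tcomp toracle (tcomp tl tr))))
      (b := encode ([] : List Bool)) rfl fun t => ?_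
    simp only [Nat.unpair_pair, encodek, Option.getD_some]
    rw [initSeg_succ]
    by_cases h : t ∈ X <;> simp [charFn, h]
  set c := Denumerable.ofNat Nat.Partrec.Code e with hc
  set k : ℕ → ℕ → Option ℕ := fun n s => Nat.Partrec.Code.evaln s.unpair.2 c
    (Nat.pair (encode (initSeg X s.unpair.1)) n) with hk
  have hk0 := computable_run c
  have tk : T fun m => encode (k m.unpair.1 m.unpair.2) := by
    have := tcomp (tprim hk0) (tpair tid (tcomp tseg (tcomp tl tr)))
    simpa only [Nat.unpair_pair] using this
  have tk1 : T fun m => 1 - encode (k m.unpair.1 m.unpair.2) :=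
    tcomp (tprim (Primrec.nat_sub.comp (Primrec.const 1) Primrec.id).to_comp) tk
  have tk2 : T fun m => encode (k m.unpair.1 m.unpair.2) - 1 :=
    tcomp (tprim (Primrec.nat_sub.comp Primrec.id (Primrec.const 1)).to_comp) tk
  refine (tk2.comp (tid.pair tk1.rfind)).of_eq fun n => Part.ext fun v => ?_
  change v ∈ Part.bind _ _ ↔ v ∈ Part.bind (Nat.rfind fun s => Part.some (k n s).isSome)
    (fun s => Part.ofOption (k n s))
  have hr : (Nat.rfind fun s => (fun m => decide (m = 0)) <$>
      (Part.some (1 - encode (k (Nat.pair n s).unpair.1 (Nat.pair n s).unpair.2)) : Part ℕ)) =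
      Nat.rfind fun s => Part.some (k n s).isSome := by
    congr 1
    funext s
    simp only [Nat.unpair_pair, Part.map_eq_map, Part.map_some]
    rcases k n s with _ | a <;> simp
  rw [hr]
  simp only [Seq.seq, Part.map_eq_map, Part.map_some, Part.bind_some, Part.mem_bind_iff,
    Part.mem_map_iff, Part.mem_some_iff, Part.mem_ofOption, Option.mem_def]
  constructor
  · rintro ⟨_, ⟨s, hs, rfl⟩, rfl⟩
    refine ⟨s, hs, ?_⟩
    have h1 := (Nat.mem_rfind.1 hs).1
    rw [Part.mem_some_iff] at h1
    obtain ⟨a, ha⟩ := Option.isSome_iff_exists.1 h1.symm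
    simp [ha]
  · rintro ⟨s, hs, h⟩
    exact ⟨_, ⟨s, hs, rfl⟩, by simp [h]⟩

/-- The functions computed by Turing functionals with oracle `X` are exactly the functions
recursive in `X`. -/
theorem recursiveIn_iff (X : Set ℕ) (f : ℕ →. ℕ) :
    Nat.RecursiveIn {fun n => Part.some (charFn X n)} f ↔ ∃ e, turingEval e X = f := by
  constructor
  · intro h
    apply FiniteUse.exists_index
    induction h with
    | zero => exact FiniteUse.of_total (Computable.const 0)
    | succ => exact FiniteUse.of_total Computable.succ
    | left => exact FiniteUse.of_total (Computable.fst.comp Computable.unpair)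
    | right => exact FiniteUse.of_total (Computable.snd.comp Computable.unpair)
    | oracle g hg => rw [Set.mem_singleton_iff.1 hg]; exact FiniteUse.oracle X
    | pair _ _ h1 h2 => exact h1.pair h2
    | comp _ _ h1 h2 => exact h1.comp h2
    | prec _ _ h1 h2 => exact h1.prec h2
    | rfind _ h1 => exact h1.rfind
  · rintro ⟨e, rfl⟩
    exact turingEval_recursiveIn e X

/-! ### Presentations of ordinals -/

/-- A presentation of a nonzero countable ordinal: a well-order `≺` of a coinfinite set
`D ⊆ ℕ` whose least element is the number `0`.  The presented ordinal is the order type of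
`(D, ≺)`; it is countable and nonzero, and every nonzero countable ordinal has presentations. -/
structure Presentation where
  /-- the domain `D` -/
  dom : Set ℕ
  /-- the strict order `≺`, a subset of `D × D` -/
  lt : ℕ → ℕ → Prop
  mem_of_lt : ∀ i k, lt i k → i ∈ dom ∧ k ∈ dom
  trans : ∀ i j k, lt i j → lt j k → lt i k
  trichotomy : ∀ i ∈ dom, ∀ k ∈ dom, lt i k ∨ i = k ∨ lt k i
  wf : WellFounded lt
  zero_mem : 0 ∈ dom
  zero_lt : ∀ k ∈ dom, k ≠ 0 → lt 0 k
  coinfinite : domᶜ.Infinite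

namespace Presentation

/-- The universe of the presentation, as a structure in the language of orders. -/
def Carrier (A : Presentation) : Type := {k : ℕ // k ∈ A.dom}

instance (A : Presentation) : LE A.Carrier := ⟨fun a b => a = b ∨ A.lt a.1 b.1⟩

instance (A : Presentation) : FirstOrder.Language.order.Structure A.Carrier :=
  FirstOrder.Language.orderStructure A.Carrier

/-- Gödel numbers of terms: the constant naming `k ∈ D`, or a bound variable. -/
def termCode (A : Presentation) {n : ℕ} :
    FirstOrder.Language.order.Term (A.Carrier ⊕ Fin n) → ℕ
  | .var (Sum.inl a) => 2 * a.1
  | .var (Sum.inr i) => 2 * i.1 + 1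
  | .func f _ => isEmptyElim f

/-- Gödel numbers of first-order formulas over the order with parameters from `D`. -/
def formulaCode (A : Presentation) :
    {n : ℕ} → FirstOrder.Language.order.BoundedFormula A.Carrier n → ℕ
  | _, .falsum => 0
  | _, .equal s t => 4 * Nat.pair (A.termCode s) (A.termCode t) + 1
  | _, .rel .le ts => 4 * Nat.pair (A.termCode (ts 0)) (A.termCode (ts 1)) + 2
  | _, .imp φ ψ => 4 * Nat.pair (A.formulaCode φ) (A.formulaCode ψ) + 3
  | _, .all φ => 4 * A.formulaCode φ + 4

/-- The complete (elementary) diagram: all first-order statements about elements of `D` that are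
true in `(D, ≺)`.  Each parameter in a formula is interpreted as itself. -/
def completeDiagram (A : Presentation) : Set ℕ :=
  {c | ∃ φ : FirstOrder.Language.order.Formula A.Carrier, φ.Realize id ∧ A.formulaCode φ = c}

/-- `S` computes the complete diagram. -/
def IsDecidableIn (A : Presentation) (S : Set ℕ) : Prop :=
  ∃ e, Computes e S A.completeDiagram

end Presentation

/-! ### The jump along a presentation -/

/-- For a nonempty domain `E` ordered by `lt`, and given the sets `col i = C^(B_i)`, `i ∈ E`, the
set whose `i`-th column is `col i` for `i ∈ E`, and whose `k`-th column is the Turing jump of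
`col j` if `E` has a greatest element `j` and `k` is the least number `> j` outside `E`; all
other columns are empty. -/
def assemble (E : Set ℕ) (lt : ℕ → ℕ → Prop) (col : ∀ i ∈ E, Set ℕ) : Set ℕ :=
  {p | (∃ i, ∃ h : i ∈ E, p.unpair.1 = i ∧ p.unpair.2 ∈ col i h) ∨
    (∃ j, ∃ h : j ∈ E, (∀ i ∈ E, i ≠ j → lt i j) ∧
      IsLeast {k | j < k ∧ k ∉ E} p.unpair.1 ∧ p.unpair.2 ∈ turingJump (col j h))}

theorem assemble_congr {E E' : Set ℕ} {lt lt' : ℕ → ℕ → Prop} {col : ∀ i ∈ E, Set ℕ}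
    {col' : ∀ i ∈ E', Set ℕ} (hE : ∀ i, i ∈ E ↔ i ∈ E')
    (hlt : ∀ i j, i ∈ E → j ∈ E → (lt i j ↔ lt' i j))
    (hcol : ∀ i h h', col i h = col' i h') : assemble E lt col = assemble E' lt' col' := by
  obtain rfl : E = E' := Set.ext hE
  obtain rfl : col = col' := funext fun i => funext fun h => hcol i h h
  ext p
  refine or_congr Iff.rfl (exists_congr fun j => exists_congr fun h => and_congr ?_ Iff.rfl)
  exact forall_congr' fun i => forall_congr' fun hi => imp_congr Iff.rfl (hlt i j hi h)

namespace Presentation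

/-- `C^(B_k)` for `k ∈ D`, where `B_k` is the initial segment `{i | i ≺ k}`, by recursion on `≺`;
here `B_0` is empty and `C^(∅) = C`. -/
def column (A : Presentation) (C : Set ℕ) : ℕ → Set ℕ :=
  A.wf.fix fun k ih => if k = 0 then C else assemble {i | A.lt i k} A.lt fun i hi => ih i hi

/-- The `A`-jump `C^(A)`. -/
def jump (A : Presentation) (C : Set ℕ) : Set ℕ :=
  assemble A.dom A.lt fun i _ => A.column C i

theorem column_zero (A : Presentation) (C : Set ℕ) : A.column C 0 = C := by
  rw [column, WellFounded.fix_eq, if_pos rfl]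

theorem column_of_ne_zero (A : Presentation) (C : Set ℕ) {k : ℕ} (hk : k ≠ 0) :
    A.column C k = assemble {i | A.lt i k} A.lt fun i _ => A.column C i := by
  rw [column, WellFounded.fix_eq, if_neg hk]

/-- The presentation `B_k`, for a nonzero `k ∈ D`. -/
def initial (A : Presentation) (k : ℕ) (hk : k ∈ A.dom) (h0 : k ≠ 0) : Presentation where
  dom := {i | A.lt i k}
  lt i j := A.lt i j ∧ A.lt j k
  mem_of_lt i j h := ⟨A.trans i j k h.1 h.2, h.2⟩
  trans i j l h h' := ⟨A.trans i j l h.1 h'.1, h'.2⟩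
  trichotomy i hi j hj := by
    rcases A.trichotomy i (A.mem_of_lt i k hi).1 j (A.mem_of_lt j k hj).1 with h | h | h
    · exact Or.inl ⟨h, hj⟩
    · exact Or.inr (Or.inl h)
    · exact Or.inr (Or.inr ⟨h, hi⟩)
  wf := Subrelation.wf (fun h => h.1) A.wf
  zero_mem := A.zero_lt k hk h0
  zero_lt i hi h := ⟨A.zero_lt i (A.mem_of_lt i k hi).1 h, hi⟩
  coinfinite := A.coinfinite.mono (Set.compl_subset_compl.2 fun i hi => (A.mem_of_lt i k hi).1)

theorem column_initial (A : Presentation) (C : Set ℕ) (k : ℕ) (hk : k ∈ A.dom) (h0 : k ≠ 0)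
    (i : ℕ) (hi : A.lt i k) : (A.initial k hk h0).column C i = A.column C i := by
  induction i using A.wf.induction with
  | h i ih =>
    by_cases hi0 : i = 0
    · subst hi0; rw [column_zero, column_zero]
    · rw [column_of_ne_zero _ _ hi0, column_of_ne_zero _ _ hi0]
      refine assemble_congr (fun l => ⟨fun h => h.1, fun h => ⟨h, hi⟩⟩)
        (fun l j _ hj => ⟨fun h => h.1, fun h => ⟨h, A.trans j i k hj.1 hi⟩⟩)
        (fun l _ hl => ih l hl (A.trans l i k hl hi))

/-- For nonzero `k ∈ D`, `column C k` is indeed the jump of `C` along the presentation `B_k`. -/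
theorem jump_initial (A : Presentation) (C : Set ℕ) (k : ℕ) (hk : k ∈ A.dom) (h0 : k ≠ 0) :
    (A.initial k hk h0).jump C = A.column C k := by
  rw [column_of_ne_zero _ _ h0]
  exact assemble_congr (fun _ => Iff.rfl) (fun l j _ hj => ⟨fun h => h.1, fun h => ⟨h, hj⟩⟩)
    (fun l _ hl => A.column_initial C k hk h0 l hl)

end Presentation

/-! ### Dedekind cuts, rational intervals and the error set -/

/-- A computable numbering of the rationals: the number coding the triple `(a, b, c)` names
`(a - b) / (c + 1)`. -/
def ratOfNat (m : ℕ) : ℚ :=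
  ((m.unpair.1.unpair.1 : ℚ) - (m.unpair.1.unpair.2 : ℚ)) / ((m.unpair.2 : ℚ) + 1)

/-- A function on the rationals is computable. -/
def RatComputable (f : ℚ → ℕ) : Prop := Computable fun m => f (ratOfNat m)

/-- The strict left cut `L_x`, through the numbering of `ℚ`. -/
def leftCut (x : ℝ) : Set ℕ := {m | (ratOfNat m : ℝ) < x}

/-- The strict right cut `R_x`, through the numbering of `ℚ`. -/
def rightCut (x : ℝ) : Set ℕ := {m | x < (ratOfNat m : ℝ)}

/-- The oracle `X ⊕ L_x ⊕ R_x`. -/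
def withCut (X : Set ℕ) (x : ℝ) : Set ℕ := join X (join (leftCut x) (rightCut x))

/-- The set of `x ∈ [0,1]` with `Φ_e^{S^(A) ⊕ L_x ⊕ R_x} ≠ (S ⊕ L_x ⊕ R_x)^(A)`. -/
def errorSet (e : ℕ) (S : Set ℕ) (A : Presentation) : Set ℝ :=
  {x | x ∈ Set.Icc (0 : ℝ) 1 ∧ ¬ Computes e (withCut (A.jump S) x) (A.jump (withCut S x))}

/-- The union of the rational open intervals `(p, q)` whose codes form the `e`-th set which is
computably enumerable in `X`, that is, the domain of `Φ_e^X`. -/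
def ceUnion (e : ℕ) (X : Set ℕ) : Set ℝ :=
  ⋃ c ∈ {c | (turingEval e X c).Dom},
    Set.Ioo (ratOfNat c.unpair.1 : ℝ) (ratOfNat c.unpair.2 : ℝ)

theorem ratOfNat_surjective : Function.Surjective ratOfNat := by
  intro q
  refine ⟨Nat.pair (Nat.pair q.num.toNat (-q.num).toNat) (q.den - 1), ?_⟩
  have h1 : ((q.num.toNat : ℚ) - ((-q.num).toNat : ℚ)) = (q.num : ℚ) := by
    exact_mod_cast congrArg (Int.cast : ℤ → ℚ) (Int.toNat_sub_toNat_neg q.num)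
  have h2 : ((q.den - 1 : ℕ) : ℚ) + 1 = (q.den : ℚ) := by
    exact_mod_cast congrArg (Nat.cast : ℕ → ℚ) (Nat.sub_add_cancel q.pos)
  simp only [ratOfNat, Nat.unpair_pair, h1, h2, Rat.num_div_den]

end EffLusin

end

/-! Write `Z(x)` for `S ⊕ L_x ⊕ R_x`. From `S^(A)` one computes, for each `n` and each accuracy `r`,
a finite union of half-open rational intervals ("cells") which agrees with `{x ∈ [0,1) | n ∈
Z(x)^(A)}` outside a small open set `exceptional r S A` that is the same for all `n`. A functional
that also holds the cuts of `x` then only has to check whether `x` lies in these cells.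

At the bottom, membership in `S` does not depend on `x`, and a cell decides the comparison of `x`
with the rational numbered `q` unless `x` is within `2^{-(r+q+4)}` of it. For a Turing jump, suppose
that sets `W(x)` are approximated by cells computed from `Y`. Up to exceptional points, the `x` for
which program `m` halts with oracle `W(x)` form an increasing union of finite unions of cells. Its
measure is at most 1, so some stage `s` is followed by a gain of at most `2^{-N}`. Whether `s` is
such a stage is one question to `Y'`, so `Y'` finds `s` (`exists_stageSearch_eq`), and stage `s` is
the approximation. The points missed lie in cells entering later. These are enumerated from `Y'` and
covered by open intervals of twice their length, in total at most `2 · 2^{-N}`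
(`volume_lateCover_le`). Limit levels only collect columns. With `N = r + i + m + 4`, where `i` is
the index of the column holding the jump, the errors sum to at most `8 · 2^{-(r+4)}`, however long
the ordinal is (`volume_exceptional_le`).

The program must not depend on `A`, so it reads the structure off its oracle. There is a number
`mark` which belongs to every Turing jump and to no jump along a presentation. It identifies the
additional column, and iterated queries about it decide which indices belong to the domain
(`present_jumpOn`). The recursion theorem then yields a program that classifies column `i` and
either performs the jump step or calls itself with that column as oracle. Its correctness is an
induction along `≺` (`approximates_column`).

The error set has to be equal to an effectively open set, not merely contained in one. The jump of
each column occurs in `S^(A)` at nesting depth at most two, so the exceptional set is enumerable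
from `S^(A)` (`ceUnion_enumIndex`). The functional errs deliberately as soon as it sees `x` in this
set (`errorSet_outputIndex`). It is total because the cells are computed without reference to `x`.
-/

noncomputable section

namespace EffLusin

/-! ### A calculus of partial recursive functionals -/

section Functional

variable {α β γ : Type*} [Primcodable α] [Primcodable β] [Primcodable γ]

/-- `f` is a partial recursive functional: uniformly in the oracle, its values are found by a
monotone partial recursive function of finite initial segments of the oracle. -/
def Functional (f : Set ℕ → α →. β) : Prop :=
  ∃ F : List Bool × α →. β, Partrec F ∧
    (∀ σ τ a v, σ <+: τ → v ∈ F (σ, a) → v ∈ F (τ, a)) ∧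
    ∀ X a v, v ∈ f X a ↔ ∃ t, v ∈ F (initSeg X t, a)

/-- A partial recursive functional which is total on every oracle. -/
abbrev TotalFunctional (f : Set ℕ → α → β) : Prop :=
  Functional fun X a => Part.some (f X a)

theorem Functional.of_eq {f g : Set ℕ → α →. β} (hf : Functional f) (h : ∀ X a, f X a = g X a) :
    Functional g := by
  obtain rfl : f = g := funext fun X => funext fun a => h X a
  exact hf

theorem Functional.of_partrec {f : α →. β} (hf : Partrec f) : Functional fun _ => f :=
  ⟨fun p => f p.2, hf.comp Computable.snd, fun _ _ _ _ _ h => h,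
    fun _ _ _ => ⟨fun h => ⟨0, h⟩, fun ⟨_, h⟩ => h⟩⟩

theorem TotalFunctional.of_computable {f : α → β} (hf : Computable f) :
    TotalFunctional fun _ => f :=
  Functional.of_partrec hf.partrec

theorem Functional.comp {f : Set ℕ → β →. γ} (hf : Functional f) {g : α → β}
    (hg : Computable g) : Functional fun X a => f X (g a) := by
  obtain ⟨F, F1, F2, F3⟩ := hf
  exact ⟨fun p => F (p.1, g p.2), F1.comp (Computable.fst.pair (hg.comp Computable.snd)),
    fun σ τ a v => F2 σ τ (g a) v, fun X a v => F3 X (g a) v⟩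

theorem Functional.bind {f : Set ℕ → α →. β} {g : Set ℕ → α × β →. γ} (hf : Functional f)
    (hg : Functional g) : Functional fun X a => (f X a).bind fun b => g X (a, b) := by
  obtain ⟨F, F1, F2, F3⟩ := hf
  obtain ⟨G, G1, G2, G3⟩ := hg
  refine ⟨fun p => (F p).bind fun b => G (p.1, (p.2, b)), F1.bind
    (g := fun p b => G (p.1, (p.2, b)))
    (G1.comp (g := fun q : (List Bool × α) × β => (q.1.1, (q.1.2, q.2))) ?_).to₂, ?_, ?_⟩
  · exact (Computable.fst.comp Computable.fst).pair
      ((Computable.snd.comp Computable.fst).pair Computable.snd)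
  · intro σ τ a v hs h
    simp only [Part.mem_bind_iff] at h ⊢
    obtain ⟨b, h1, h2⟩ := h
    exact ⟨b, F2 _ _ _ _ hs h1, G2 _ _ _ _ hs h2⟩
  · intro X a v
    simp only [Part.mem_bind_iff, F3, G3]
    constructor
    · rintro ⟨b, ⟨s, h1⟩, t, h2⟩
      exact ⟨max s t, b, F2 _ _ _ _ (initSeg_mono X (le_max_left s t)) h1,
        G2 _ _ _ _ (initSeg_mono X (le_max_right s t)) h2⟩
    · rintro ⟨t, b, h1, h2⟩
      exact ⟨b, ⟨t, h1⟩, t, h2⟩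

theorem Functional.bind_partrec {f : Set ℕ → α →. β} {g : α × β →. γ} (hf : Functional f)
    (hg : Partrec g) : Functional fun X a => (f X a).bind fun b => g (a, b) :=
  hf.bind (Functional.of_partrec hg)

theorem Functional.map {f : Set ℕ → α →. β} {g : α × β → γ} (hf : Functional f)
    (hg : Computable g) : Functional fun X a => (f X a).map fun b => g (a, b) :=
  (hf.bind (TotalFunctional.of_computable hg)).of_eq fun _ _ => Part.bind_some_eq_map _ _

theorem TotalFunctional.bind {f : Set ℕ → α → β} {g : Set ℕ → α × β →. γ}
    (hf : TotalFunctional f) (hg : Functional g) : Functional fun X a => g X (a, f X a) :=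
  (Functional.bind hf hg).of_eq fun _ _ => Part.bind_some _ _

theorem TotalFunctional.map {f : Set ℕ → α → β} {g : α × β → γ} (hf : TotalFunctional f)
    (hg : Computable g) : TotalFunctional fun X a => g (a, f X a) :=
  TotalFunctional.bind hf (TotalFunctional.of_computable hg)

theorem TotalFunctional.pair {f : Set ℕ → α → β} {g : Set ℕ → α → γ} (hf : TotalFunctional f)
    (hg : TotalFunctional g) : TotalFunctional fun X a => (f X a, g X a) :=
  TotalFunctional.bind hf (g := fun X p => Part.some (p.2, g X p.1))
    (TotalFunctional.map (f := fun X (p : α × β) => g X p.1) (g := fun p => (p.1.2, p.2))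
      (Functional.comp hg Computable.fst)
      ((Computable.snd.comp Computable.fst).pair Computable.snd))

theorem TotalFunctional.map₂ {δ : Type*} [Primcodable δ] {f : Set ℕ → α → β} {g : Set ℕ → α → γ}
    {h : β × γ → δ} (hf : TotalFunctional f) (hg : TotalFunctional g) (hh : Computable h) :
    TotalFunctional fun X a => h (f X a, g X a) :=
  TotalFunctional.map (g := fun p : α × (β × γ) => h p.2) (hf.pair hg) (hh.comp Computable.snd)

theorem TotalFunctional.and {f g : Set ℕ → α → Bool} (hf : TotalFunctional f)
    (hg : TotalFunctional g) : TotalFunctional fun X a => f X a && g X a :=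
  hf.map₂ (h := fun p => p.1 && p.2) hg
    (Primrec.and.to_comp.comp Computable.fst Computable.snd)

theorem TotalFunctional.or {f g : Set ℕ → α → Bool} (hf : TotalFunctional f)
    (hg : TotalFunctional g) : TotalFunctional fun X a => f X a || g X a :=
  hf.map₂ (h := fun p => p.1 || p.2) hg
    (Primrec.or.to_comp.comp Computable.fst Computable.snd)

theorem TotalFunctional.not {f : Set ℕ → α → Bool} (hf : TotalFunctional f) :
    TotalFunctional fun X a => !f X a :=
  TotalFunctional.map (g := fun p : α × Bool => !p.2) hf
    (Primrec.not.to_comp.comp Computable.snd)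

/-- Only the selected branch is run, so the other one may diverge. -/
theorem Functional.cond {c : Set ℕ → α → Bool} {f g : Set ℕ → α →. β} (hc : TotalFunctional c)
    (hf : Functional f) (hg : Functional g) :
    Functional fun X a => bif c X a then f X a else g X a := by
  refine TotalFunctional.bind hc (g := fun X p => bif p.2 then f X p.1 else g X p.1) ?_
  obtain ⟨F, F1, F2, F3⟩ := hf
  obtain ⟨G, G1, G2, G3⟩ := hg
  refine ⟨fun p => bif p.2.2 then F (p.1, p.2.1) else G (p.1, p.2.1), ?_, ?_, ?_⟩
  · have h : Computable fun p : List Bool × (α × Bool) => (p.1, p.2.1) :=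
      Computable.fst.pair (Computable.fst.comp Computable.snd)
    exact Partrec.cond (Computable.snd.comp Computable.snd) (F1.comp h) (G1.comp h)
  · rintro σ τ ⟨a, b⟩ v
    cases b
    · exact G2 σ τ a v
    · exact F2 σ τ a v
  · rintro X ⟨a, b⟩ v
    cases b
    · exact G3 X a v
    · exact F3 X a v

/-- The oracle, as a Boolean function. -/
def query (X : Set ℕ) (n : ℕ) : Bool := open Classical in decide (n ∈ X)

@[simp] theorem query_eq_true {X : Set ℕ} {n : ℕ} : query X n = true ↔ n ∈ X := by
  simp [query]

@[simp] theorem query_eq_false {X : Set ℕ} {n : ℕ} : query X n = false ↔ n ∉ X := by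
  simp [query]

theorem TotalFunctional.query : TotalFunctional query := by
  refine ⟨fun p => (p.1[p.2]? : Option Bool), ?_, ?_, ?_⟩
  · exact Computable.ofOption (Computable.list_getElem?.comp Computable.fst Computable.snd)
  · rintro σ τ n v ⟨ρ, rfl⟩ h
    simp only [Part.mem_ofOption, Option.mem_def] at h ⊢
    rw [List.getElem?_append_left (List.getElem?_eq_some_iff.1 h).1, h]
  · intro X n v
    simp only [Part.mem_ofOption, Option.mem_def, initSeg_getElem?, Part.mem_some_iff]
    constructor
    · rintro rfl
      exact ⟨n + 1, if_pos (Nat.lt_succ_self n)⟩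
    · rintro ⟨t, h⟩
      split_ifs at h
      exact (Option.some.inj h).symm

theorem TotalFunctional.query_comp {h : α → ℕ} (hh : Computable h) :
    TotalFunctional fun X a => EffLusin.query X (h a) :=
  Functional.comp TotalFunctional.query hh

/-- A successful search consults finitely many values, so the longest of the initial segments needed
for them suffices. -/
theorem Functional.rfind {p : Set ℕ → α × ℕ →. Bool} (hp : Functional p) :
    Functional fun X a => Nat.rfind fun n => p X (a, n) := by
  obtain ⟨F, F1, F2, F3⟩ := hp
  refine ⟨fun q => Nat.rfind fun n => F (q.1, (q.2, n)), ?_, ?_, ?_⟩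
  · exact Partrec.rfind (F1.comp ((Computable.fst.comp Computable.fst).pair
      ((Computable.snd.comp Computable.fst).pair Computable.snd))).to₂
  · intro σ τ a v hs h
    obtain ⟨h0, h3⟩ := Nat.mem_rfind.1 h
    exact Nat.mem_rfind.2 ⟨F2 _ _ _ _ hs h0, fun hm => F2 _ _ _ _ hs (h3 hm)⟩
  · intro X a v
    constructor
    · intro h
      obtain ⟨h0, h3⟩ := Nat.mem_rfind.1 h
      obtain ⟨s, h1⟩ := (F3 _ _ _).1 h0
      have : ∀ m, ∃ t, m < v → false ∈ F (initSeg X t, (a, m)) := by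
        intro m
        by_cases hm : m < v
        · obtain ⟨t, h4⟩ := (F3 _ _ _).1 (h3 hm)
          exact ⟨t, fun _ => h4⟩
        · exact ⟨0, fun h => absurd h hm⟩
      choose t ht using this
      refine ⟨max s ((Finset.range v).sup t), Nat.mem_rfind.2
        ⟨F2 _ _ _ _ (initSeg_mono X (le_max_left _ _)) h1, fun {m} hm => ?_⟩⟩
      exact F2 _ _ _ _ (initSeg_mono X ((Finset.le_sup
        (Finset.mem_range.2 hm)).trans (le_max_right _ _))) (ht m hm)
    · rintro ⟨t, h⟩
      obtain ⟨h0, h3⟩ := Nat.mem_rfind.1 h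
      exact Nat.mem_rfind.2 ⟨(F3 _ _ _).2 ⟨t, h0⟩, fun {m} hm => (F3 _ _ _).2 ⟨t, h3 hm⟩⟩

theorem Functional.rfindOpt {k : Set ℕ → α × ℕ → Option β} (hk : TotalFunctional k) :
    Functional fun X a => Nat.rfindOpt fun n => k X (a, n) := by
  have h1 : Functional fun X (a : α) => Nat.rfind fun n => Part.some (k X (a, n)).isSome :=
    Functional.rfind (TotalFunctional.map (g := fun p => p.2.isSome) hk
      (Primrec.option_isSome.to_comp.comp Computable.snd))
  exact h1.bind (g := fun X p => Part.ofOption (k X p)) ((Functional.bind_partrec hk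
    (g := fun p => Part.ofOption p.2) (Computable.ofOption Computable.snd)).of_eq
      fun _ _ => Part.bind_some _ _)

/-- The list `[f 0, …, f (t - 1)]`, defined if all its entries are. -/
def partList (f : ℕ →. β) : ℕ →. List β :=
  Nat.rec (Part.some []) fun i IH => IH.bind fun l => (f i).map fun b => l ++ [b]

theorem partList_eq_some {δ : Type*} {f : ℕ →. δ} {g : ℕ → δ} {t : ℕ}
    (h : ∀ i < t, f i = Part.some (g i)) :
    partList f t = Part.some ((List.range t).map g) := by
  induction t with
  | zero => rfl
  | succ t ih =>
    rw [partList]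
    change (partList f t).bind _ = _
    rw [ih fun i hi => h i (hi.trans (Nat.lt_succ_self t)), Part.bind_some,
      h t (Nat.lt_succ_self t), Part.map_some, List.range_succ, List.map_append]
    rfl

theorem partList_mono {δ : Type*} {f g : ℕ →. δ} (h : ∀ i v, v ∈ f i → v ∈ g i) (t : ℕ) (v : List δ)
    (hv : v ∈ partList f t) : v ∈ partList g t := by
  induction t generalizing v with
  | zero => exact hv
  | succ t ih =>
    change v ∈ (partList f t).bind _ at hv
    change v ∈ (partList g t).bind _
    simp only [Part.mem_bind_iff, Part.mem_map_iff] at hv ⊢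
    obtain ⟨l, hl, b, hb, rfl⟩ := hv
    exact ⟨l, ih l hl, b, h _ _ hb, rfl⟩

theorem Functional.list {f : Set ℕ → α × ℕ →. β} (hf : Functional f) :
    Functional fun X (p : α × ℕ) => partList (fun i => f X (p.1, i)) p.2 := by
  obtain ⟨F, F1, F2, F3⟩ := hf
  refine ⟨fun q => partList (fun i => F (q.1, (q.2.1, i))) q.2.2, ?_, ?_, ?_⟩
  · refine Partrec.nat_rec (Computable.snd.comp Computable.snd)
      (Computable.const []).partrec (h := fun q r => (F (q.1, (q.2.1, r.1))).map fun b =>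
        r.2 ++ [b]) ?_
    have h1 : Partrec fun z : (List Bool × (α × ℕ)) × (ℕ × List β) =>
        F (z.1.1, (z.1.2.1, z.2.1)) := F1.comp ((Computable.fst.comp Computable.fst).pair
          ((Computable.fst.comp (Computable.snd.comp Computable.fst)).pair
            (Computable.fst.comp Computable.snd)))
    exact (h1.map (Computable.list_concat.comp
      (Computable.snd.comp (Computable.snd.comp Computable.fst)) Computable.snd).to₂).to₂
  · intro σ τ p v hs
    exact partList_mono (fun i v => F2 _ _ _ v hs) _ _
  · rintro X ⟨a, t⟩ v
    constructor
    · simp only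
      induction t generalizing v with
      | zero => exact fun h => ⟨0, h⟩
      | succ t ih =>
        intro hv
        change v ∈ (partList _ t).bind _ at hv
        simp only [Part.mem_bind_iff, Part.mem_map_iff] at hv
        obtain ⟨l, hl, b, hb, rfl⟩ := hv
        obtain ⟨s, hs⟩ := ih l hl
        obtain ⟨u, hu⟩ := (F3 _ _ _).1 hb
        refine ⟨max s u, ?_⟩
        change _ ∈ (partList _ t).bind _
        simp only [Part.mem_bind_iff, Part.mem_map_iff]
        exact ⟨l, partList_mono (fun i v => F2 _ _ _ v (initSeg_mono X (le_max_left s u))) _ _ hs,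
          b, F2 _ _ _ _ (initSeg_mono X (le_max_right s u)) hu, rfl⟩
    · rintro ⟨s, h⟩
      exact partList_mono (fun i v hv => (F3 _ _ _).2 ⟨s, hv⟩) _ _ h

theorem TotalFunctional.list {f : Set ℕ → α × ℕ → β} (hf : TotalFunctional f) :
    TotalFunctional fun X (p : α × ℕ) => (List.range p.2).map fun i => f X (p.1, i) :=
  (Functional.list hf).of_eq fun _ _ => partList_eq_some fun _ _ => rfl

/-! ### Oracles given as preimages, indices of functionals and the recursion theorem. -/

/-- The preimage of a set under the `a`-th of a family of functions. -/
abbrev pullback (h : α × ℕ → ℕ) (X : Set ℕ) (a : α) : Set ℕ := {n | h (a, n) ∈ X}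

theorem TotalFunctional.initSeg_pullback {h : α × ℕ → ℕ} (hh : Computable h) :
    TotalFunctional fun X (p : α × ℕ) => initSeg (pullback h X p.1) p.2 :=
  TotalFunctional.list (f := fun X p => EffLusin.query X (h p)) (TotalFunctional.query_comp hh)

/-- One trial of the evaluation of a Turing functional. -/
def trial (e : ℕ) (σ : ℕ → List Bool) (n s : ℕ) : Option ℕ :=
  Nat.Partrec.Code.evaln s.unpair.2 (Denumerable.ofNat Nat.Partrec.Code e)
    (Nat.pair (encode (σ s.unpair.1)) n)

theorem TotalFunctional.trial_pullback {h : α × ℕ → ℕ} (hh : Computable h) {e n s : α → ℕ}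
    (he : Computable e) (hn : Computable n) (hs : Computable s) :
    TotalFunctional fun X a => trial (e a) (initSeg (pullback h X a)) (n a) (s a) := by
  have hu : Computable fun a => (s a).unpair := Computable.unpair.comp hs
  have h1 : TotalFunctional fun X a => initSeg (pullback h X a) (s a).unpair.1 :=
    Functional.comp (TotalFunctional.initSeg_pullback hh)
      (Computable.id.pair (Computable.fst.comp hu))
  refine TotalFunctional.map h1 (g := fun p => Nat.Partrec.Code.evaln (s p.1).unpair.2
    (Denumerable.ofNat Nat.Partrec.Code (e p.1)) (Nat.pair (encode p.2) (n p.1))) ?_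
  have hp : Computable fun p : α × List Bool => (((s p.1).unpair.2,
      Denumerable.ofNat Nat.Partrec.Code (e p.1)), Nat.pair (encode p.2) (n p.1)) :=
    ((Computable.snd.comp (hu.comp Computable.fst)).pair
      ((Computable.ofNat _).comp (he.comp Computable.fst))).pair
      (Primrec₂.natPair.to_comp.comp (Computable.encode.comp Computable.snd)
        (hn.comp Computable.fst))
  exact Nat.Partrec.Code.primrec_evaln.to_comp.comp hp

/-- Relativised evaluation: the program, the input, and the oracle as a preimage of the given
oracle, may all depend on parameters. -/
theorem Functional.turingEval {h : α × ℕ → ℕ} (hh : Computable h) {e n : α → ℕ}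
    (he : Computable e) (hn : Computable n) :
    Functional fun X a => turingEval (e a) (pullback h X a) (n a) :=
  Functional.rfindOpt (k := fun X p => trial (e p.1) (initSeg (pullback h X p.1)) (n p.1) p.2)
    (TotalFunctional.trial_pullback (α := α × ℕ) (h := fun p => h (p.1.1, p.2))
      (hh.comp ((Computable.fst.comp Computable.fst).pair Computable.snd))
      (he.comp Computable.fst) (hn.comp Computable.fst) Computable.snd)

/-- Programs computing parametrised partial recursive functionals are found effectively. -/
theorem Functional.exists_computable_index {f : Set ℕ → α × ℕ →. ℕ} (hf : Functional f) :
    ∃ g : α → ℕ, Computable g ∧ ∀ a X n, EffLusin.turingEval (g a) X n = f X (a, n) ∧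
      ∀ s v, trial (g a) (initSeg X) n s = some v → v ∈ f X (a, n) := by
  obtain ⟨F, F1, F2, F3⟩ := hf
  have hG : Partrec fun p : α × (List Bool × ℕ) => F (p.2.1, (p.1, p.2.2)) :=
    F1.comp ((Computable.fst.comp Computable.snd).pair
      (Computable.fst.pair (Computable.snd.comp Computable.snd)))
  obtain ⟨c, hc⟩ := Nat.Partrec.Code.exists_code.1 hG
  have hc' : ∀ a σ n v, v ∈ (c.curry (encode a)).eval (Nat.pair (encode σ) n) ↔
      v ∈ F (σ, (a, n)) := by
    intro a σ n v
    have hp : decode (α := α × (List Bool × ℕ)) (Nat.pair (encode a) (Nat.pair (encode σ) n)) =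
      some (a, (σ, n)) := encodek (a, (σ, n))
    rw [Nat.Partrec.Code.eval_curry, hc]
    change v ∈ (Part.ofOption (decode (α := α × (List Bool × ℕ))
      (Nat.pair (encode a) (Nat.pair (encode σ) n)))).bind
      (fun p => (F (p.2.1, (p.1, p.2.2))).map encode) ↔ _
    rw [hp]
    simp
  -- The s-m-n construction: the parameter is built into the program by currying. The clause on
  -- single trials says that every halting trial, not only the first, gives a correct value;
  -- dovetailed searches rely on it.
  refine ⟨fun a => encode (c.curry (encode a)), ?_, fun a X n => ?_⟩
  · exact Computable.encode.comp (Nat.Partrec.Code.primrec₂_curry.to_comp.comp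
      (Computable.const c) Computable.encode)
  have hs : ∀ s v, trial (encode (c.curry (encode a))) (initSeg X) n s = some v →
      v ∈ f X (a, n) := by
    intro s v hs
    rw [trial, Denumerable.ofNat_encode] at hs
    exact (F3 X (a, n) v).2 ⟨_, (hc' _ _ _ _).1 (Nat.Partrec.Code.evaln_sound hs)⟩
  have key : ∀ v, v ∈ EffLusin.turingEval (encode (c.curry (encode a))) X n →
      v ∈ f X (a, n) := fun v hv => (Nat.rfindOpt_spec hv).elim fun s h => hs s v h
  refine ⟨Part.ext fun v => ⟨key v, fun hv => ?_⟩, hs⟩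
  obtain ⟨t, ht⟩ := (F3 X (a, n) v).1 hv
  obtain ⟨u, hu⟩ := Nat.Partrec.Code.evaln_complete.1 ((hc' _ _ _ _).2 ht)
  have hd : (EffLusin.turingEval (encode (c.curry (encode a))) X n).Dom := by
    refine Nat.rfindOpt_dom.2 ⟨Nat.pair t u, v, ?_⟩
    rw [Denumerable.ofNat_encode, Nat.unpair_pair]
    exact hu
  have hg := Part.get_mem hd
  rwa [Part.mem_unique (key _ hg) hv] at hg

theorem Functional.exists_index {f : Set ℕ → ℕ →. ℕ} (hf : Functional f) :
    ∃ e, ∀ X n, EffLusin.turingEval e X n = f X n := by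
  obtain ⟨g, -, hg⟩ := Functional.exists_computable_index (f := fun X (p : Unit × ℕ) => f X p.2)
    (Functional.comp hf Computable.snd)
  exact ⟨g (), fun X n => (hg () X n).1⟩

/-- The recursion theorem for Turing functionals. -/
theorem Functional.exists_fixed_point {f : Set ℕ → ℕ × ℕ →. ℕ} (hf : Functional f) :
    ∃ e, ∀ X n, EffLusin.turingEval e X n = f X (e, n) := by
  have hu : Functional fun X (p : (ℕ × ℕ) × ℕ) =>
      EffLusin.turingEval p.1.1 (pullback Prod.snd X p) (Nat.pair p.1.2 p.2) :=
    Functional.turingEval Computable.snd (Computable.fst.comp Computable.fst)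
      (Primrec₂.natPair.to_comp.comp (Computable.snd.comp Computable.fst) Computable.snd)
  -- `s (a, b)` is an index of `n ↦ Φ_a^X(⟨b, n⟩)`. If `d` is an index of `⟨a, n⟩ ↦ f X (s (a, a),
  -- n)`, then the diagonal value `s (d, d)` is the fixed point.
  obtain ⟨s, hs, hs'⟩ := hu.exists_computable_index
  have hd : Functional fun X (n : ℕ) => f X (s (n.unpair.1, n.unpair.1), n.unpair.2) :=
    Functional.comp hf ((hs.comp ((Computable.fst.comp Computable.unpair).pair
      (Computable.fst.comp Computable.unpair))).pair (Computable.snd.comp Computable.unpair))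
  obtain ⟨d, hd'⟩ := hd.exists_index
  refine ⟨s (d, d), fun X n => ?_⟩
  rw [(hs' _ _ _).1]
  change EffLusin.turingEval d X (Nat.pair d n) = _
  rw [hd', Nat.unpair_pair]

/-- The range of a partial recursive functional is, uniformly in parameters, the domain of a
Turing functional. -/
theorem Functional.exists_computable_range {f : Set ℕ → α × ℕ →. ℕ} (hf : Functional f) :
    ∃ g : α → ℕ, Computable g ∧
      ∀ a X n, (EffLusin.turingEval (g a) X n).Dom ↔ ∃ w, n ∈ f X (a, w) := by
  obtain ⟨g, hg, hg'⟩ := hf.exists_computable_index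
  -- Dovetailing: `z` codes an input together with a trial, and the search stops when that trial
  -- outputs the given number.
  have h1 : Functional fun X (p : α × ℕ) => Nat.rfindOpt fun z =>
      bif decide (trial (g p.1) (initSeg X) z.unpair.1 z.unpair.2 = some p.2) then some 0
        else (none : Option ℕ) := by
    have hu : Computable fun p : (α × ℕ) × ℕ => p.2.unpair :=
      Computable.unpair.comp Computable.snd
    have ht := TotalFunctional.trial_pullback (α := (α × ℕ) × ℕ) (h := Prod.snd)
      Computable.snd (hg.comp (Computable.fst.comp Computable.fst)) (Computable.fst.comp hu)
      (Computable.snd.comp hu)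
    refine Functional.rfindOpt (k := fun X (p : (α × ℕ) × ℕ) =>
      bif decide (trial (g p.1.1) (initSeg X) p.2.unpair.1 p.2.unpair.2 = some p.1.2) then
        some 0 else none) (TotalFunctional.map ht (g := fun q : ((α × ℕ) × ℕ) × Option ℕ =>
        bif decide (q.2 = some q.1.1.2) then some 0 else none) ?_)
    exact Computable.cond ((Primrec.eq.decide.to_comp).comp Computable.snd
      (Computable.option_some.comp (Computable.snd.comp (Computable.fst.comp Computable.fst))))
      (Computable.const _) (Computable.const _)
  obtain ⟨e, he, he'⟩ := h1.exists_computable_index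
  refine ⟨e, he, fun a X n => ?_⟩
  rw [(he' _ _ _).1, Nat.rfindOpt_dom]
  constructor
  · rintro ⟨z, v, hv⟩
    have hz : trial (g a) (initSeg X) z.unpair.1 z.unpair.2 = some n := by
      by_contra hne
      simp [hne] at hv
    exact ⟨z.unpair.1, (hg' a X _).2 _ _ hz⟩
  · rintro ⟨w, hw⟩
    rw [← (hg' _ _ _).1] at hw
    obtain ⟨s, hs⟩ := Nat.rfindOpt_spec hw
    refine ⟨Nat.pair w s, 0, ?_⟩
    have : trial (g a) (initSeg X) w s = some n := hs
    simp [this]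

end Functional

/-! ### A number separating Turing jumps from jumps along presentations -/

section Mark

open Nat.Partrec (Code)

/-- Such a program already halts when it is given the empty initial segment of the oracle. -/
theorem mem_turingJump_of_total {c : Code} (h : ∀ n, (c.eval n).Dom) (X : Set ℕ) :
    encode c ∈ turingJump X := by
  obtain ⟨v, h1⟩ := Part.dom_iff_mem.1 (h (Nat.pair (encode (initSeg X 0)) (encode c)))
  obtain ⟨u, hu⟩ := Code.evaln_complete.1 h1
  refine Nat.rfindOpt_dom.2 ⟨Nat.pair 0 u, v, ?_⟩
  rw [Denumerable.ofNat_encode, Nat.unpair_pair]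
  exact hu

theorem notMem_turingJump_of_empty {c : Code} (h : ∀ n, ¬ (c.eval n).Dom) (X : Set ℕ) :
    encode c ∉ turingJump X := by
  intro hX
  obtain ⟨s, a, ha⟩ := Nat.rfindOpt_dom.1 hX
  rw [Denumerable.ofNat_encode] at ha
  exact h _ (Part.dom_iff_mem.2 ⟨a, Code.evaln_sound ha⟩)

theorem eval_rfind'_dom {c : Code} {n : ℕ} (h : (c.rfind'.eval n).Dom) :
    ∃ m, 0 ∈ c.eval m := by
  obtain ⟨v, hv⟩ := Part.dom_iff_mem.1 h
  obtain ⟨a, ha, -⟩ := (Part.mem_map_iff _).1 hv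
  obtain ⟨b, hb, hb'⟩ := (Part.mem_map_iff _).1 (Nat.rfind_spec ha)
  exact ⟨_, by simpa [of_decide_eq_true hb'] using hb⟩

/-- A nowhere defined program: it searches for a zero of the successor function. -/
def loopSucc : Code := .rfind' .succ

/-- A nowhere defined program. -/
def loopOuter : Code := .rfind' loopSucc

/-- A nowhere defined program whose number is paired from `152` and a nowhere defined program. -/
def loopPaired : Code := .rfind' (.prec loopSucc (.comp .left .left))

/-- A total program whose number is paired from `152` and the number of `loopPaired`. -/
def markCode : Code :=
  .prec (.prec (.prec .right .zero) (.comp .left .right)) (.prec .left .left)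

/-- A number which lies in the jump of every set but in no jump along a presentation. -/
def mark : ℕ := encode markCode

/-- Arithmetic of the numbering of programs: `loopOuter` has number 51, `loopPaired` has number
23307, and `⟨152, 51⟩ = 152² + 152 + 51 = 23307`. -/
theorem encode_loopPaired : encode loopPaired = Nat.pair 152 (encode loopOuter) := by
  change Code.encodeCode _ = Nat.pair 152 (Code.encodeCode _)
  simp [loopPaired, loopOuter, loopSucc, Code.encodeCode, Nat.pair]

/-- Here `⟨152, 23307⟩ = 23307² + 152`, and `markCode` is chosen to have this number. As an element
of a jump along a presentation, `mark` therefore refers to column 152 of column 152, at a number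
whose program never halts. -/
theorem mark_eq : mark = Nat.pair 152 (Nat.pair 152 (encode loopOuter)) := by
  rw [← encode_loopPaired]
  change Code.encodeCode _ = Nat.pair 152 (Code.encodeCode _)
  simp [markCode, loopPaired, loopSucc, Code.encodeCode, Nat.pair]

theorem loopSucc_empty (n : ℕ) : ¬ (loopSucc.eval n).Dom := by
  intro h
  obtain ⟨m, hm⟩ := eval_rfind'_dom h
  simp [Code.eval] at hm

theorem loopOuter_empty (n : ℕ) : ¬ (loopOuter.eval n).Dom := by
  intro h
  obtain ⟨m, hm⟩ := eval_rfind'_dom h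
  exact loopSucc_empty m (Part.dom_iff_mem.2 ⟨_, hm⟩)

/-- A primitive recursion evaluates its base case first, whatever the number of iterations. -/
theorem prec_dom {c d : Code} {n : ℕ} (h : ((c.prec d).eval n).Dom) :
    (c.eval n.unpair.1).Dom := by
  simp only [Code.eval, Nat.unpaired] at h
  generalize n.unpair.2 = k at h
  induction k with
  | zero => exact h
  | succ k ih => exact ih (Part.Dom.of_bind h)

theorem loopPaired_empty (n : ℕ) : ¬ (loopPaired.eval n).Dom := by
  intro h
  obtain ⟨m, hm⟩ := eval_rfind'_dom h
  exact loopSucc_empty _ (prec_dom (Part.dom_iff_mem.2 ⟨_, hm⟩))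

theorem prec_total {c d : Code} (hc : ∀ n, (c.eval n).Dom) (hd : ∀ n, (d.eval n).Dom) (n : ℕ) :
    ((c.prec d).eval n).Dom := by
  simp only [Code.eval, Nat.unpaired]
  generalize n.unpair.2 = k
  induction k with
  | zero => exact hc _
  | succ k ih => exact ⟨ih, hd _⟩

theorem markCode_total (n : ℕ) : (markCode.eval n).Dom := by
  refine prec_total (prec_total (prec_total ?_ ?_) ?_) (prec_total ?_ ?_) n <;> intro m
  · trivial
  · trivial
  · exact ⟨trivial, trivial⟩
  · trivial
  · trivial

theorem mark_mem_turingJump (X : Set ℕ) : mark ∈ turingJump X :=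
  mem_turingJump_of_total markCode_total X

end Mark

/-! ### Columns of jumps along presentations -/

/-- The `i`-th column of a set. -/
def col (Y : Set ℕ) (i : ℕ) : Set ℕ := {n | Nat.pair i n ∈ Y}

@[simp] theorem mem_col {Y : Set ℕ} {i n : ℕ} : n ∈ col Y i ↔ Nat.pair i n ∈ Y := Iff.rfl

namespace Presentation

variable (A : Presentation)

theorem lt_irrefl (i : ℕ) : ¬ A.lt i i := fun h => A.wf.irrefl.irrefl i h

/-- Nonempty initial segments of a presentation. -/
structure IsSegment (E : Set ℕ) : Prop where
  subset : E ⊆ A.dom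
  zero_mem : 0 ∈ E
  lower : ∀ i k, k ∈ E → A.lt i k → i ∈ E

theorem isSegment_dom : A.IsSegment A.dom :=
  ⟨subset_rfl, A.zero_mem, fun i k _ h => (A.mem_of_lt i k h).1⟩

theorem isSegment_below {k : ℕ} (hk : k ∈ A.dom) (h0 : k ≠ 0) : A.IsSegment {i | A.lt i k} :=
  ⟨fun i hi => (A.mem_of_lt i k hi).1, A.zero_lt k hk h0, fun i j hj h => A.trans i j k h hj⟩

/-- The jump along the restriction of a presentation to an initial segment. -/
def jumpOn (C E : Set ℕ) : Set ℕ := assemble E A.lt fun i _ => A.column C i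

theorem column_eq_jumpOn (C : Set ℕ) {k : ℕ} (h0 : k ≠ 0) :
    A.column C k = A.jumpOn C {i | A.lt i k} := A.column_of_ne_zero C h0

/-- The greatest element of a set. -/
def IsTop (E : Set ℕ) (j : ℕ) : Prop := j ∈ E ∧ ∀ i ∈ E, i ≠ j → A.lt i j

/-- The index of the additional column which holds the jump of the `j`-th column. -/
def succIndex (j : ℕ) : ℕ := sInf {k | j < k ∧ ¬ A.lt k j}

theorem succIndex_spec (j : ℕ) : j < A.succIndex j ∧ ¬ A.lt (A.succIndex j) j := by
  have : {k | j < k ∧ ¬ A.lt k j}.Nonempty := by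
    obtain ⟨k, hk, hj⟩ := A.coinfinite.exists_gt j
    exact ⟨k, hj, fun h => hk (A.mem_of_lt k j h).1⟩
  exact Nat.sInf_mem this

theorem succIndex_zero : A.succIndex 0 = 1 := by
  have h1 : (1 : ℕ) ∈ {k | 0 < k ∧ ¬ A.lt k 0} := by
    refine ⟨one_pos, fun h => A.lt_irrefl 1 (A.trans _ _ _ h ?_)⟩
    exact A.zero_lt 1 (A.mem_of_lt 1 0 h).1 one_ne_zero
  exact le_antisymm (Nat.sInf_le h1) (A.succIndex_spec 0).1

theorem succIndex_eq_one {j : ℕ} : A.succIndex j = 1 ↔ j = 0 := by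
  constructor
  · intro h
    have := (A.succIndex_spec j).1
    omega
  · rintro rfl
    exact A.succIndex_zero

variable {A} {C E : Set ℕ}

theorem IsTop.succIndex_notMem {j : ℕ} (h : A.IsTop E j) : A.succIndex j ∉ E := fun hE =>
  (A.succIndex_spec j).2 (h.2 _ hE (A.succIndex_spec j).1.ne')

theorem IsTop.eq {j j' : ℕ} (h : A.IsTop E j) (h' : A.IsTop E j') : j = j' := by
  by_contra hne
  exact A.lt_irrefl j (A.trans _ _ _ (h'.2 j h.1 hne) (h.2 j' h'.1 (Ne.symm hne)))

/-- For `k > j`, lying outside an initial segment with top `j` is the same as not preceding `j`. So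
the additional index depends on `j` alone, not on the segment. -/
theorem IsSegment.isLeast_iff (hE : A.IsSegment E) {j i : ℕ} (h : A.IsTop E j) :
    IsLeast {k | j < k ∧ k ∉ E} i ↔ i = A.succIndex j := by
  have hset : {k | j < k ∧ k ∉ E} = {k | j < k ∧ ¬ A.lt k j} := by
    ext k
    refine and_congr_right fun hk => not_congr ⟨fun hkE => h.2 k hkE hk.ne', hE.lower k j h.1⟩
  rw [hset]
  have h1 : IsLeast {k | j < k ∧ ¬ A.lt k j} (A.succIndex j) :=
    ⟨A.succIndex_spec j, fun k hk => Nat.sInf_le hk⟩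
  exact ⟨fun h' => h'.unique h1, fun h' => h' ▸ h1⟩

theorem IsSegment.pair_mem_jumpOn (hE : A.IsSegment E) {i n : ℕ} :
    Nat.pair i n ∈ A.jumpOn C E ↔ (i ∈ E ∧ n ∈ A.column C i) ∨
      ∃ j, A.IsTop E j ∧ i = A.succIndex j ∧ n ∈ turingJump (A.column C j) := by
  simp only [jumpOn, assemble, Set.mem_ofPred_eq, Nat.unpair_pair]
  constructor
  · rintro (⟨_, h, rfl, h'⟩ | ⟨j, h, h1, h2, h3⟩)
    · exact Or.inl ⟨h, h'⟩
    · exact Or.inr ⟨j, ⟨h, h1⟩, (hE.isLeast_iff ⟨h, h1⟩).1 h2, h3⟩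
  · rintro (⟨h, h'⟩ | ⟨j, h, h2, h3⟩)
    · exact Or.inl ⟨i, h, rfl, h'⟩
    · exact Or.inr ⟨j, h.1, h.2, (hE.isLeast_iff h).2 h2, h3⟩

theorem IsSegment.col_of_mem (hE : A.IsSegment E) {i : ℕ} (hi : i ∈ E) :
    col (A.jumpOn C E) i = A.column C i := by
  ext n
  rw [mem_col, hE.pair_mem_jumpOn]
  constructor
  · rintro (h | ⟨j, h, rfl, -⟩)
    · exact h.2
    · exact absurd hi h.succIndex_notMem
  · exact fun h => Or.inl ⟨hi, h⟩

theorem IsSegment.col_succIndex (hE : A.IsSegment E) {j : ℕ} (hj : A.IsTop E j) :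
    col (A.jumpOn C E) (A.succIndex j) = turingJump (A.column C j) := by
  ext n
  rw [mem_col, hE.pair_mem_jumpOn]
  constructor
  · rintro (h | ⟨j', h, -, h'⟩)
    · exact absurd h.1 hj.succIndex_notMem
    · exact hj.eq h ▸ h'
  · exact fun h => Or.inr ⟨j, hj, rfl, h⟩

theorem IsSegment.col_eq_empty (hE : A.IsSegment E) {i : ℕ} (hi : i ∉ E)
    (h : ∀ j, A.IsTop E j → i ≠ A.succIndex j) : col (A.jumpOn C E) i = ∅ := by
  ext n
  rw [mem_col, hE.pair_mem_jumpOn]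
  simp only [Set.mem_empty_iff_false, iff_false]
  rintro (h' | ⟨j, hj, h', -⟩)
  · exact hi h'.1
  · exact h j hj h'

/-- Unfolding `mark` as a pair, either column 152 is additional and `loopPaired` would have to halt,
or 152 is in the segment. In its column, index 152 in turn is either additional, and `loopOuter`
would have to halt, or satisfies `152 ≺ 152`. -/
theorem IsSegment.mark_notMem (hE : A.IsSegment E) : mark ∉ A.jumpOn C E := by
  have hP : ∀ X, Nat.pair 152 (encode loopOuter) ∉ turingJump X := fun X => by
    rw [← encode_loopPaired]
    exact notMem_turingJump_of_empty loopPaired_empty X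
  rw [mark_eq, hE.pair_mem_jumpOn]
  rintro (⟨h, h'⟩ | ⟨j, -, -, h⟩)
  · rw [A.column_eq_jumpOn C (by norm_num),
      (A.isSegment_below (hE.subset h) (by norm_num)).pair_mem_jumpOn] at h'
    rcases h' with ⟨h', -⟩ | ⟨j, -, -, h'⟩
    · exact A.lt_irrefl _ h'
    · exact notMem_turingJump_of_empty loopOuter_empty _ h'
  · exact hP _ h

theorem mark_notMem_column {k : ℕ} (hk : k ∈ A.dom) (h0 : k ≠ 0) : mark ∉ A.column C k := by
  rw [A.column_eq_jumpOn C h0]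
  exact (A.isSegment_below hk h0).mark_notMem

/-- The additional column is recognised by the number `mark`. -/
theorem IsSegment.pair_mark_mem (hE : A.IsSegment E) {i : ℕ} (hi : i ≠ 0) :
    Nat.pair i mark ∈ A.jumpOn C E ↔ ∃ j, A.IsTop E j ∧ i = A.succIndex j := by
  rw [hE.pair_mem_jumpOn]
  constructor
  · rintro (⟨h, h'⟩ | ⟨j, h1, h2, -⟩)
    -- Here `i ≠ 0` is essential: column `0` is `C` itself, which may contain `mark`.
    · exact absurd h' (mark_notMem_column (hE.subset h) hi)
    · exact ⟨j, h1, h2⟩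
  · rintro ⟨j, h1, h2⟩
    exact Or.inr ⟨j, h1, h2, mark_mem_turingJump _⟩

/-- The additional index exceeds the top, so it is `1` only for the top `0`, that is, for the
segment `{0}`. -/
theorem IsSegment.pair_one_mark_mem (hE : A.IsSegment E) :
    Nat.pair 1 mark ∈ A.jumpOn C E ↔ A.IsTop E 0 := by
  rw [hE.pair_mark_mem one_ne_zero]
  constructor
  · rintro ⟨j, h, h'⟩
    obtain rfl := A.succIndex_eq_one.1 h'.symm
    exact h
  · exact fun h => ⟨0, h, A.succIndex_zero.symm⟩

/-- The test by which the second element of a presentation is recognised. -/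
def SecondTest (Y : Set ℕ) (p : ℕ) : Prop :=
  p ≠ 0 ∧ Nat.pair p mark ∉ Y ∧ Nat.pair p (Nat.pair 1 mark) ∈ Y

theorem isTop_zero_iff {k : ℕ} (hk : k ∈ A.dom) (h0 : k ≠ 0) :
    A.IsTop {i | A.lt i k} 0 ↔ ∀ i, A.lt i k → i = 0 := by
  constructor
  · intro h i hi
    by_contra hne
    exact A.lt_irrefl 0 (A.trans _ _ _ (A.zero_lt i (A.mem_of_lt i k hi).1 hne) (h.2 i hi hne))
  · exact fun h => ⟨A.zero_lt k hk h0, fun i hi hne => absurd (h i hi) hne⟩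

/-- The second element is the one whose column is a jump along a one-element presentation, and index
`1` is additional exactly in such jumps. The negative clause rules out the additional column, a
Turing jump that might contain `⟨1, mark⟩` as a halting program. -/
theorem IsSegment.secondTest_iff (hE : A.IsSegment E) {p : ℕ} :
    SecondTest (A.jumpOn C E) p ↔ p ∈ E ∧ p ≠ 0 ∧ ∀ i, A.lt i p → i = 0 := by
  constructor
  · rintro ⟨h0, h1, h2⟩
    rcases hE.pair_mem_jumpOn.1 h2 with ⟨h, h'⟩ | ⟨j, hj, h, -⟩
    · refine ⟨h, h0, ?_⟩
      rw [A.column_eq_jumpOn C h0, (A.isSegment_below (hE.subset h) h0).pair_one_mark_mem] at h'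
      exact (isTop_zero_iff (hE.subset h) h0).1 h'
    · exact absurd ((hE.pair_mark_mem h0).2 ⟨j, hj, h⟩) h1
  · rintro ⟨h, h0, h'⟩
    refine ⟨h0, fun h1 => ?_, hE.pair_mem_jumpOn.2 (Or.inl ⟨h, ?_⟩)⟩
    · obtain ⟨j, hj, rfl⟩ := (hE.pair_mark_mem h0).1 h1
      exact hj.succIndex_notMem h
    · rw [A.column_eq_jumpOn C h0, (A.isSegment_below (hE.subset h) h0).pair_one_mark_mem]
      exact (isTop_zero_iff (hE.subset h) h0).2 h'

/-- Unless the segment is `{0}`, its `≺`-least nonzero element passes the test. -/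
theorem IsSegment.exists_secondTest (hE : A.IsSegment E)
    (h : Nat.pair 1 mark ∉ A.jumpOn C E) : ∃ p, SecondTest (A.jumpOn C E) p := by
  rw [hE.pair_one_mark_mem] at h
  have hne : {i | i ∈ E ∧ i ≠ 0}.Nonempty := by
    by_contra hem
    refine h ⟨hE.zero_mem, fun i hi hi0 => ?_⟩
    exact absurd ⟨i, hi, hi0⟩ hem
  refine ⟨A.wf.min _ hne, hE.secondTest_iff.2 ?_⟩
  have hm := A.wf.min_mem _ hne
  refine ⟨hm.1, hm.2, fun i hi => ?_⟩
  by_contra hi0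
  exact A.wf.not_lt_min {i | i ∈ E ∧ i ≠ 0} ⟨hE.lower _ _ hm.1 hi, hi0⟩ hi

/-- Membership in the domain is decided by the second element. -/
theorem IsSegment.mem_iff_of_secondTest (hE : A.IsSegment E) {p i : ℕ}
    (hp : SecondTest (A.jumpOn C E) p) (hi : i ≠ 0) (hm : Nat.pair i mark ∉ A.jumpOn C E) :
    i ∈ E ↔ Nat.pair i (Nat.pair 1 mark) ∈ A.jumpOn C E ∨
      Nat.pair i (Nat.pair p (Nat.pair 1 mark)) ∈ A.jumpOn C E := by
  obtain ⟨h1, h0, h2⟩ := hE.secondTest_iff.1 hp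
  -- A nonzero element is either the second one, `p`, and passes the first query, or it comes after
  -- `p`. In the latter case column `p` occurs inside its own column and shows `⟨1, mark⟩` there.
  constructor
  · intro h
    by_cases hip : i = p
    · subst hip
      exact Or.inl hp.2.2
    · right
      have hlt : A.lt p i := by
        rcases A.trichotomy p (hE.subset h1) i (hE.subset h) with h' | h' | h'
        · exact h'
        · exact absurd h'.symm hip
        · exact absurd (h2 i h') hi
      rw [hE.pair_mem_jumpOn]
      refine Or.inl ⟨h, ?_⟩
      rw [A.column_eq_jumpOn C hi, (A.isSegment_below (hE.subset h) hi).pair_mem_jumpOn]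
      refine Or.inl ⟨hlt, ?_⟩
      have := hE.pair_mem_jumpOn.1 hp.2.2
      rcases this with h' | ⟨j, hj, rfl, -⟩
      · exact h'.2
      · exact absurd h1 hj.succIndex_notMem
  · intro h
    have key : ∀ n, Nat.pair i n ∈ A.jumpOn C E → i ∈ E := by
      intro n hn
      rcases hE.pair_mem_jumpOn.1 hn with h' | ⟨j, hj, h', -⟩
      · exact h'.1
      · exact absurd ((hE.pair_mark_mem hi).2 ⟨j, hj, h'⟩) hm
    exact h.elim (key _) (key _)

end Presentation

/-! ### Finite unions of cells -/

section Cells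

open MeasureTheory

/-- A pair `(ℓ, L)` stands for the union of the intervals `[a / ℓ, (a + 1) / ℓ)`, `a ∈ L`. -/
abbrev Cells : Type := ℕ × List ℕ

/-- Membership of a nonnegative real in a union of cells. -/
def Cells.Mem (v : Cells) (x : ℝ) : Prop := ⌊x * v.1⌋₊ ∈ v.2

instance (v : Cells) (x : ℝ) : Decidable (v.Mem x) :=
  inferInstanceAs (Decidable (⌊x * v.1⌋₊ ∈ v.2))

/-- Whether the cell with index `a` of mesh `1 / M` lies in a union of cells. -/
def Cells.bit (v : Cells) (M a : ℕ) : Bool := decide (v.1 * a / M ∈ v.2)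

/-- Cells of mesh `1 / M` refine those of mesh `1 / l`, and integer arithmetic on the finer index
yields the coarser one. -/
theorem floor_mul_eq_div {x : ℝ} {l M : ℕ} (hM : 0 < M) (h : l ∣ M) :
    l * ⌊x * M⌋₊ / M = ⌊x * l⌋₊ := by
  obtain ⟨d, rfl⟩ := h
  have hl : 0 < l := Nat.pos_of_mul_pos_right hM
  have hd : 0 < d := Nat.pos_of_mul_pos_left hM
  rw [Nat.mul_div_mul_left _ _ hl, ← Nat.floor_div_natCast]
  congr 1
  push_cast
  field_simp

theorem Cells.bit_floor {v : Cells} {M : ℕ} {x : ℝ} (hM : 0 < M) (h : v.1 ∣ M) :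
    v.bit M ⌊x * M⌋₊ = true ↔ v.Mem x := by
  rw [Cells.bit, decide_eq_true_iff, floor_mul_eq_div hM h, Cells.Mem]

theorem floor_lt_of_lt_one {x : ℝ} (hx : x ∈ Set.Ico (0 : ℝ) 1) {M : ℕ} (hM : 0 < M) :
    ⌊x * M⌋₊ < M := by
  have hM' : (0 : ℝ) < M := Nat.cast_pos.2 hM
  rw [Nat.floor_lt (mul_nonneg hx.1 hM'.le)]
  nlinarith [hx.2]

/-- A union of cells as a subset of `[0, 1)`. -/
def Cells.toSet (v : Cells) : Set ℝ := {x | x ∈ Set.Ico (0 : ℝ) 1 ∧ v.Mem x}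

/-- The total length of a union of cells. -/
def Cells.weight (v : Cells) : ℝ := v.2.length / v.1

theorem mem_cell_iff {x : ℝ} {M a : ℕ} (hM : 0 < M) (ha : a < M) :
    x ∈ Set.Ico ((a : ℝ) / M) ((a + 1) / M) ↔ x ∈ Set.Ico (0 : ℝ) 1 ∧ ⌊x * M⌋₊ = a := by
  have hM' : (0 : ℝ) < M := Nat.cast_pos.2 hM
  have ha' : (a : ℝ) + 1 ≤ M := by exact_mod_cast ha
  simp only [Set.mem_Ico, div_le_iff₀ hM', lt_div_iff₀ hM']
  constructor
  · rintro ⟨h1, h2⟩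
    have h3 : 0 ≤ x * M := (Nat.cast_nonneg a).trans h1
    refine ⟨⟨nonneg_of_mul_nonneg_left h3 hM', ?_⟩, (Nat.floor_eq_iff h3).2 ⟨h1, h2⟩⟩
    nlinarith
  · rintro ⟨⟨h1, h2⟩, h3⟩
    exact (Nat.floor_eq_iff (mul_nonneg h1 hM'.le)).1 h3

theorem Cells.volume_toSet {v : Cells} (h0 : 0 < v.1) (h1 : v.2.Nodup)
    (h2 : ∀ a ∈ v.2, a < v.1) :
    MeasurableSet v.toSet ∧ volume v.toSet = ENNReal.ofReal v.weight := by
  have hset : v.toSet = ⋃ a ∈ v.2.toFinset, Set.Ico ((a : ℝ) / v.1) ((a + 1) / v.1) := by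
    ext x
    simp only [Set.mem_iUnion, List.mem_toFinset, exists_prop]
    constructor
    · rintro ⟨hx, h⟩
      exact ⟨_, h, (mem_cell_iff h0 (h2 _ h)).2 ⟨hx, rfl⟩⟩
    · rintro ⟨a, ha, h⟩
      obtain ⟨hx, rfl⟩ := (mem_cell_iff h0 (h2 a ha)).1 h
      exact ⟨hx, ha⟩
  have hM' : (0 : ℝ) < v.1 := Nat.cast_pos.2 h0
  refine ⟨hset ▸ Finset.measurableSet_biUnion _ fun _ _ => measurableSet_Ico, ?_⟩
  rw [hset, measure_biUnion_finset]
  · have : ∀ a : ℕ, volume (Set.Ico ((a : ℝ) / v.1) ((a + 1) / v.1)) =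
        ENNReal.ofReal (1 / v.1) := by
      intro a
      rw [Real.volume_Ico]
      congr 1
      ring
    simp only [this, Finset.sum_const, List.toFinset_card_of_nodup h1, nsmul_eq_mul]
    rw [Cells.weight, div_eq_mul_one_div (v.2.length : ℝ), ENNReal.ofReal_mul (Nat.cast_nonneg _),
      ENNReal.ofReal_natCast]
  · intro a ha b hb hne
    refine Set.disjoint_left.2 fun x hxa hxb => hne ?_
    rw [← ((mem_cell_iff h0 (h2 a (List.mem_toFinset.1 ha))).1 hxa).2,
      ← ((mem_cell_iff h0 (h2 b (List.mem_toFinset.1 hb))).1 hxb).2]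
  · exact fun _ _ => measurableSet_Ico

/-! ### Approximating the halting set -/

/-- A common refinement of the meshes of a list of unions of cells. -/
def mesh (vs : List Cells) : ℕ := (vs.map Prod.fst).prod

theorem mesh_pos {vs : List Cells} (h : ∀ v ∈ vs, 0 < v.1) : 0 < mesh vs :=
  List.prod_pos fun a ha => by
    obtain ⟨v, hv, rfl⟩ := List.mem_map.1 ha
    exact h v hv

theorem dvd_mesh {vs : List Cells} {v : Cells} (h : v ∈ vs) : v.1 ∣ mesh vs :=
  List.dvd_prod (List.mem_map_of_mem h)

/-- Whether program `m` halts on input `m` in one of the first trials, with the oracle given on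
the cell with index `a` by a list of unions of cells. -/
def haltsOn (vs : List Cells) (m a : ℕ) : Bool :=
  (List.range vs.length).any fun s =>
    (trial m (fun u => (vs.map fun v => v.bit (mesh vs) a).take u) m s).isSome

/-- The cells on which program `m` is seen to halt on input `m`. -/
def haltCells (vs : List Cells) (m : ℕ) : Cells :=
  (mesh vs, (List.range (mesh vs)).filter fun a => haltsOn vs m a)

/-- The cells of `w` which are not contained in `v`. -/
def newCells (v w : Cells) : Cells := (w.1, w.2.filter fun a => !v.bit w.1 a)

/-- The total length of `w` exceeds that of `v` by more than `2 ^ (-N)`. -/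
def exceeds (v w : Cells) (N : ℕ) : Bool :=
  decide (v.2.length * 2 ^ N * w.1 + v.1 * w.1 < w.2.length * 2 ^ N * v.1)

variable (f : ℕ → Cells) (m : ℕ)

/-- The oracle as it is seen at `x` through a sequence of unions of cells. -/
def bitsAt (x : ℝ) (u : ℕ) : List Bool :=
  (List.range u).map fun i => decide ((f i).Mem x)

/-- The stages of the approximation of the halting set. -/
def haltStage (t : ℕ) : Cells := haltCells ((List.range t).map f) m

variable {f m}

theorem haltStage_fst_pos (hf : ∀ i, 0 < (f i).1) (t : ℕ) : 0 < (haltStage f m t).1 :=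
  mesh_pos fun v hv => by
    obtain ⟨i, -, rfl⟩ := List.mem_map.1 hv
    exact hf i

/-- The mesh of stage `t` refines those of the first `t` unions of cells, so their answers are
constant on each of its cells. Trial `s < t` reads an initial segment of length `s.unpair.1 ≤ s`,
hence only these `t` answers. -/
theorem haltStage_mem (hf : ∀ i, 0 < (f i).1) {x : ℝ} (hx : x ∈ Set.Ico (0 : ℝ) 1) (t : ℕ) :
    (haltStage f m t).Mem x ↔ ∃ s < t, (trial m (bitsAt f x) m s).isSome := by
  have hM := haltStage_fst_pos (m := m) hf t
  have h1 : ((List.range t).map f).map (fun v => v.bit (mesh ((List.range t).map f))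
      ⌊x * (mesh ((List.range t).map f) : ℕ)⌋₊) = bitsAt f x t := by
    rw [List.map_map]
    refine List.map_congr_left fun i hi => ?_
    rw [Bool.eq_iff_iff, decide_eq_true_iff]
    exact Cells.bit_floor hM (dvd_mesh (List.mem_map_of_mem hi))
  have h2 : ⌊x * (haltStage f m t).1⌋₊ < (haltStage f m t).1 := floor_lt_of_lt_one hx hM
  rw [Cells.Mem, haltStage, haltCells, List.mem_filter, List.mem_range, haltsOn, h1]
  simp only [List.any_eq_true, List.mem_range, List.length_map, List.length_range]
  refine (and_iff_right h2).trans (exists_congr fun s => and_congr_right fun hs => ?_)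
  have h3 : (bitsAt f x t).take s.unpair.1 = bitsAt f x s.unpair.1 := by
    rw [bitsAt, ← List.map_take, List.take_range, min_eq_left, bitsAt]
    exact (Nat.unpair_left_le s).trans hs.le
  rw [trial, trial, h3]

theorem haltStage_mem_mono (hf : ∀ i, 0 < (f i).1) {x : ℝ} (hx : x ∈ Set.Ico (0 : ℝ) 1)
    {s t : ℕ} (hst : s ≤ t) (h : (haltStage f m s).Mem x) : (haltStage f m t).Mem x := by
  rw [haltStage_mem hf hx] at h ⊢
  obtain ⟨u, hu, h⟩ := h
  exact ⟨u, hu.trans_le hst, h⟩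

theorem exists_haltStage_mem_iff (hf : ∀ i, 0 < (f i).1) {x : ℝ}
    (hx : x ∈ Set.Ico (0 : ℝ) 1) {W : Set ℕ} (hW : ∀ i, (f i).Mem x ↔ i ∈ W) :
    (∃ t, (haltStage f m t).Mem x) ↔ m ∈ turingJump W := by
  have h1 : bitsAt f x = initSeg W := by
    funext u
    exact List.map_congr_left fun i _ => by simp [hW]
  simp only [haltStage_mem hf hx, h1]
  refine Iff.trans ?_ Nat.rfindOpt_dom.symm
  constructor
  · rintro ⟨t, s, -, h⟩
    exact ⟨s, Option.isSome_iff_exists.1 h⟩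
  · rintro ⟨s, h⟩
    exact ⟨s + 1, s, Nat.lt_succ_self s, Option.isSome_iff_exists.2 h⟩

theorem haltStage_nodup (t : ℕ) : (haltStage f m t).2.Nodup := List.nodup_range.filter _

theorem haltStage_lt (t a : ℕ) (h : a ∈ (haltStage f m t).2) : a < (haltStage f m t).1 :=
  List.mem_range.1 (List.mem_filter.1 h).1

theorem haltStage_fst_dvd (t : ℕ) : (haltStage f m t).1 ∣ (haltStage f m (t + 1)).1 := by
  simp [haltStage, haltCells, mesh, List.range_succ]

theorem newCells_toSet (hf : ∀ i, 0 < (f i).1) (t : ℕ) :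
    (newCells (haltStage f m t) (haltStage f m (t + 1))).toSet =
      (haltStage f m (t + 1)).toSet \ (haltStage f m t).toSet := by
  ext x
  simp only [Cells.toSet, Set.mem_ofPred_eq, Set.mem_sdiff, not_and]
  have : ∀ hx : x ∈ Set.Ico (0 : ℝ) 1,
      (newCells (haltStage f m t) (haltStage f m (t + 1))).Mem x ↔
        (haltStage f m (t + 1)).Mem x ∧ ¬ (haltStage f m t).Mem x := by
    intro hx
    rw [← Cells.bit_floor (haltStage_fst_pos hf (t + 1)) (haltStage_fst_dvd t), Cells.Mem,
      newCells, List.mem_filter, Cells.Mem]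
    simp
  constructor
  · rintro ⟨hx, h⟩
    exact ⟨⟨hx, ((this hx).1 h).1⟩, fun _ => ((this hx).1 h).2⟩
  · rintro ⟨⟨hx, h⟩, h'⟩
    exact ⟨hx, (this hx).2 ⟨h, h' hx⟩⟩

theorem weight_nonneg (v : Cells) : 0 ≤ v.weight := by
  unfold Cells.weight
  positivity

/-- Passing to Lebesgue measure turns the inclusion of consecutive stages into a difference of
weights, with no counting of cells of different meshes. -/
theorem newCells_weight (hf : ∀ i, 0 < (f i).1) (t : ℕ) :
    (newCells (haltStage f m t) (haltStage f m (t + 1))).weight =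
      (haltStage f m (t + 1)).weight - (haltStage f m t).weight := by
  obtain ⟨h1, h1'⟩ := Cells.volume_toSet (haltStage_fst_pos (m := m) hf t)
    (haltStage_nodup t) (haltStage_lt t)
  obtain ⟨h2, h2'⟩ := Cells.volume_toSet (haltStage_fst_pos (m := m) hf (t + 1))
    (haltStage_nodup (t + 1)) (haltStage_lt (t + 1))
  obtain ⟨-, h3⟩ := Cells.volume_toSet
    (v := newCells (haltStage f m t) (haltStage f m (t + 1)))
    (haltStage_fst_pos (m := m) hf (t + 1)) ((haltStage_nodup (t + 1)).filter _)
    (fun a ha => haltStage_lt _ a (List.mem_filter.1 ha).1)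
  have hsub : (haltStage f m t).toSet ⊆ (haltStage f m (t + 1)).toSet := fun x hx =>
    ⟨hx.1, haltStage_mem_mono hf hx.1 (Nat.le_succ t) hx.2⟩
  have h4 := measureReal_sdiff (μ := volume) hsub h1 (by rw [h2']; exact ENNReal.ofReal_ne_top)
  rw [← newCells_toSet hf] at h4
  simpa [Measure.real, h1', h2', h3, weight_nonneg] using h4

theorem haltStage_weight_le_one (hf : ∀ i, 0 < (f i).1) (t : ℕ) :
    (haltStage f m t).weight ≤ 1 := by
  have h0 : (0 : ℝ) < (haltStage f m t).1 := Nat.cast_pos.2 (haltStage_fst_pos hf t)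
  rw [Cells.weight, div_le_one h0, Nat.cast_le]
  exact (List.length_filter_le _ _).trans_eq List.length_range

theorem exceeds_iff {v w : Cells} (hv : 0 < v.1) (hw : 0 < w.1) (N : ℕ) :
    exceeds v w N = true ↔ v.weight + (1 / 2) ^ N < w.weight := by
  have hv' : (0 : ℝ) < v.1 := Nat.cast_pos.2 hv
  have hw' : (0 : ℝ) < w.1 := Nat.cast_pos.2 hw
  have h2 : (0 : ℝ) < 2 ^ N := by positivity
  rw [exceeds, decide_eq_true_iff, ← @Nat.cast_lt ℝ, Cells.weight, Cells.weight, one_div, inv_pow,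
    ← one_div, div_add_div _ _ hv'.ne' h2.ne', div_lt_div_iff₀ (by positivity) hw']
  push_cast
  rw [← sub_pos, iff_comm, ← sub_pos]
  ring_nf

/-! ### Final stages and the open cover of what is found later. -/

variable (f m) in
/-- From stage `s` on, the approximation of the halting set gains at most `2 ^ (-N)`. -/
def IsFinalStage (N s : ℕ) : Prop :=
  ∀ t, exceeds (haltStage f m s) (haltStage f m t) N = false

/-- Weights are bounded by 1, so any stage within `2^{-N}` of their supremum is final. -/
theorem exists_isFinalStage (hf : ∀ i, 0 < (f i).1) (N : ℕ) : ∃ s, IsFinalStage f m N s := by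
  have hb : BddAbove (Set.range fun t => (haltStage f m t).weight) :=
    ⟨1, by rintro _ ⟨t, rfl⟩; exact haltStage_weight_le_one hf t⟩
  have hlt : (⨆ t, (haltStage f m t).weight) - (1 / 2) ^ N < ⨆ t, (haltStage f m t).weight :=
    sub_lt_self _ (by positivity)
  obtain ⟨s, hs⟩ := exists_lt_of_lt_ciSup hlt
  refine ⟨s, fun t => ?_⟩
  rw [← Bool.not_eq_true, exceeds_iff (haltStage_fst_pos hf s) (haltStage_fst_pos hf t), not_lt]
  linarith [le_ciSup hb t]

variable (f m) in
/-- An open cover of the part of the halting set found after stage `s`. -/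
def lateCover (s : ℕ) : Set ℝ :=
  ⋃ u, ⋃ a ∈ (newCells (haltStage f m (s + u)) (haltStage f m (s + u + 1))).2,
    Set.Ioo (((a : ℝ) - 1) / (haltStage f m (s + u + 1)).1)
      ((a + 1) / (haltStage f m (s + u + 1)).1)

/-- A point that enters after stage `s` lies in a new cell of some later step. The covering interval
of that cell starts one cell earlier, so it also contains the left endpoint of the half-open cell.
-/
theorem haltStage_mem_of_notMem_lateCover (hf : ∀ i, 0 < (f i).1) {x : ℝ}
    (hx : x ∈ Set.Ico (0 : ℝ) 1) {s : ℕ} (hs : x ∉ lateCover f m s) :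
    (∃ t, (haltStage f m t).Mem x) ↔ (haltStage f m s).Mem x := by
  refine ⟨?_, fun h => ⟨s, h⟩⟩
  rintro ⟨t, ht⟩
  have key : ∀ u, (haltStage f m (s + u)).Mem x → (haltStage f m s).Mem x := by
    intro u
    induction u with
    | zero => exact id
    | succ u ih =>
      intro h
      by_cases h' : (haltStage f m (s + u)).Mem x
      · exact ih h'
      · exfalso
        apply hs
        have hn : x ∈ (newCells (haltStage f m (s + u)) (haltStage f m (s + u + 1))).toSet := by
          rw [newCells_toSet hf]
          exact ⟨⟨hx, h⟩, fun h'' => h' h''.2⟩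
        have hM := haltStage_fst_pos (m := m) hf (s + u + 1)
        have hc := (mem_cell_iff (x := x) hM (floor_lt_of_lt_one hx hM)).2 ⟨hx, rfl⟩
        refine Set.mem_iUnion.2 ⟨u, Set.mem_iUnion₂.2 ⟨_, hn.2, lt_of_lt_of_le ?_ hc.1, hc.2⟩⟩
        have hM' : (0 : ℝ) < (haltStage f m (s + u + 1)).1 := Nat.cast_pos.2 hM
        exact div_lt_div_of_pos_right (sub_one_lt _) hM'
  rcases le_total t s with h | h
  · exact haltStage_mem_mono hf hx h ht
  · obtain ⟨u, rfl⟩ := Nat.exists_eq_add_of_le h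
    exact key u ht

/-- Each interval is twice as long as its cell, and the weights of the new cells telescope to the
gain after stage `s`. -/
theorem volume_lateCover_le (hf : ∀ i, 0 < (f i).1) {N s : ℕ} (hs : IsFinalStage f m N s) :
    volume (lateCover f m s) ≤ ENNReal.ofReal (2 * (1 / 2) ^ N) := by
  set w : ℕ → ℝ := fun u => (haltStage f m (s + u)).weight with hw
  have h1 : ∀ u, volume (⋃ a ∈ (newCells (haltStage f m (s + u)) (haltStage f m (s + u + 1))).2,
      Set.Ioo (((a : ℝ) - 1) / (haltStage f m (s + u + 1)).1)
        ((a + 1) / (haltStage f m (s + u + 1)).1)) ≤ ENNReal.ofReal (2 * (w (u + 1) - w u)) := by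
    intro u
    have hn := newCells_weight (m := m) hf (s + u)
    set v := newCells (haltStage f m (s + u)) (haltStage f m (s + u + 1)) with hv
    have hv1 : v.1 = (haltStage f m (s + u + 1)).1 := rfl
    have hM : (0 : ℝ) < v.1 := Nat.cast_pos.2 (haltStage_fst_pos (m := m) hf (s + u + 1))
    rw [← hv1]
    have h2 : (⋃ a ∈ v.2, Set.Ioo (((a : ℝ) - 1) / v.1) ((a + 1) / v.1)) =
        ⋃ a ∈ v.2.toFinset, Set.Ioo (((a : ℝ) - 1) / v.1) ((a + 1) / v.1) := by simp
    rw [h2]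
    refine (measure_biUnion_finset_le _ _).trans ?_
    have h3 : ∀ a : ℕ, volume (Set.Ioo (((a : ℝ) - 1) / v.1) ((a + 1) / v.1)) =
        ENNReal.ofReal (2 / v.1) := by
      intro a
      rw [Real.volume_Ioo]
      congr 1
      ring
    simp only [h3, Finset.sum_const, nsmul_eq_mul]
    rw [← ENNReal.ofReal_natCast, ← ENNReal.ofReal_mul (Nat.cast_nonneg _)]
    apply ENNReal.ofReal_le_ofReal
    change _ ≤ 2 * ((haltStage f m (s + u + 1)).weight - (haltStage f m (s + u)).weight)
    rw [← hn, Cells.weight, mul_div_assoc', mul_comm (2 : ℝ), mul_div_assoc]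
    refine (mul_le_mul_of_nonneg_right (Nat.cast_le.2 (List.toFinset_card_le _)) ?_).trans_eq ?_
    · positivity
    · ring
  refine (measure_iUnion_le _).trans (ENNReal.tsum_le_of_sum_range_le fun n => ?_)
  refine (Finset.sum_le_sum fun u _ => h1 u).trans ?_
  have h0 : ∀ u, 0 ≤ 2 * (w (u + 1) - w u) := by
    intro u
    have hn := newCells_weight (m := m) hf (s + u)
    have := weight_nonneg (newCells (haltStage f m (s + u)) (haltStage f m (s + u + 1)))
    rw [hn] at this
    exact mul_nonneg zero_le_two this
  rw [← ENNReal.ofReal_sum_of_nonneg fun u _ => h0 u]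
  apply ENNReal.ofReal_le_ofReal
  rw [← Finset.mul_sum, Finset.sum_range_sub]
  have := hs (s + n)
  rw [← Bool.not_eq_true, exceeds_iff (haltStage_fst_pos hf s) (haltStage_fst_pos hf _),
    not_lt] at this
  change 2 * ((haltStage f m (s + n)).weight - (haltStage f m s).weight) ≤ _
  linarith

end Cells

/-! ### Computability of the operations on unions of cells -/

section CellsComputable

theorem primrec_two_pow : Primrec fun n : ℕ => 2 ^ n :=
  (Primrec.nat_rec₁ (f := fun _ m => m * 2) 1
    (Primrec.nat_mul.comp Primrec.snd (Primrec.const 2)).to₂).of_eq fun n => by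
      induction n with
      | zero => rfl
      | succ n ih => rw [pow_succ, ← ih]

theorem primrecRel_mem_list : PrimrecRel fun (a : ℕ) (L : List ℕ) => a ∈ L :=
  (PrimrecRel.exists_mem_list (R := fun (b a : ℕ) => b = a) Primrec.eq).swap.of_eq
    fun a L => by simp [Function.swap]

theorem primrec_bit : Primrec fun p : Cells × (ℕ × ℕ) => p.1.bit p.2.1 p.2.2 :=
  PrimrecPred.decide (primrecRel_mem_list.comp
    (Primrec.nat_div.comp (Primrec.nat_mul.comp (Primrec.fst.comp Primrec.fst)
      (Primrec.snd.comp Primrec.snd)) (Primrec.fst.comp Primrec.snd))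
    (Primrec.snd.comp Primrec.fst))

theorem primrec_mesh : Primrec mesh :=
  Primrec.list_foldr (f := fun vs : List Cells => vs.map Prod.fst) (g := fun _ => 1)
    (h := fun _ p => p.1 * p.2)
    (Primrec.list_map Primrec.id (Primrec.fst.comp Primrec.snd).to₂) (Primrec.const 1)
    (Primrec.nat_mul.comp (Primrec.fst.comp Primrec.snd) (Primrec.snd.comp Primrec.snd)).to₂

theorem primrec_trial_take : Primrec fun p : List Bool × (ℕ × ℕ) =>
    trial p.2.1 (fun u => p.1.take u) p.2.1 p.2.2 := by
  have hu : Primrec fun p : List Bool × (ℕ × ℕ) => p.2.2.unpair :=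
    Primrec.unpair.comp (Primrec.snd.comp Primrec.snd)
  have hm : Primrec fun p : List Bool × (ℕ × ℕ) => p.2.1 := Primrec.fst.comp Primrec.snd
  exact Nat.Partrec.Code.primrec_evaln.comp
    (((Primrec.snd.comp hu).pair ((Primrec.ofNat _).comp hm)).pair
      (Primrec₂.natPair.comp (Primrec.encode.comp
        (Primrec.list_take.comp (Primrec.fst.comp hu) Primrec.fst)) hm))

theorem primrec_haltsOn : Primrec fun p : (List Cells × ℕ) × ℕ => haltsOn p.1.1 p.1.2 p.2 := by
  have hbits : Primrec fun p : (List Cells × ℕ) × ℕ =>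
      p.1.1.map fun v => v.bit (mesh p.1.1) p.2 := by
    refine Primrec.list_map (Primrec.fst.comp Primrec.fst) (Primrec.to₂
      (f := fun z : ((List Cells × ℕ) × ℕ) × Cells => z.2.bit (mesh z.1.1.1) z.1.2) ?_)
    exact primrec_bit.comp (Primrec.snd.pair
      ((primrec_mesh.comp (Primrec.fst.comp (Primrec.fst.comp Primrec.fst))).pair
        (Primrec.snd.comp Primrec.fst)))
  have hR : PrimrecRel fun (s : ℕ) (p : (List Cells × ℕ) × ℕ) =>
      (trial p.1.2 (fun u => (p.1.1.map fun v => v.bit (mesh p.1.1) p.2).take u)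
        p.1.2 s).isSome = true := by
    refine PrimrecRel.comp Primrec.eq ?_ (Primrec.const true)
    refine Primrec.option_isSome.comp (primrec_trial_take.comp
      (f := fun p : List Bool × (ℕ × ℕ) => trial p.2.1 (fun u => p.1.take u) p.2.1 p.2.2)
      (g := fun q : ℕ × ((List Cells × ℕ) × ℕ) =>
        (q.2.1.1.map fun v => v.bit (mesh q.2.1.1) q.2.2, (q.2.1.2, q.1))) ?_)
    exact (hbits.comp Primrec.snd).pair
      ((Primrec.snd.comp (Primrec.fst.comp Primrec.snd)).pair Primrec.fst)
  have h2 := (hR.exists_mem_list).comp (f := fun p : (List Cells × ℕ) × ℕ =>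
    List.range p.1.1.length) (g := id)
    (Primrec.list_range.comp (Primrec.list_length.comp (Primrec.fst.comp Primrec.fst)))
    Primrec.id
  classical
  refine h2.decide.of_eq fun p => ?_
  rw [Bool.eq_iff_iff, decide_eq_true_iff, haltsOn, List.any_eq_true]
  rfl

theorem primrec_haltCells : Primrec fun p : List Cells × ℕ => haltCells p.1 p.2 := by
  have hR : PrimrecRel fun (a : ℕ) (p : List Cells × ℕ) => haltsOn p.1 p.2 a = true :=
    PrimrecRel.comp Primrec.eq (primrec_haltsOn.comp (Primrec.snd.pair Primrec.fst))
      (Primrec.const true)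
  have hm : Primrec fun p : List Cells × ℕ => mesh p.1 := primrec_mesh.comp Primrec.fst
  refine (hm.pair (hR.listFilter.comp (Primrec.list_range.comp hm) Primrec.id)).of_eq
    fun p => ?_
  simp [haltCells]

theorem primrec_newCells : Primrec fun p : Cells × Cells => newCells p.1 p.2 := by
  have hR : PrimrecRel fun (a : ℕ) (p : Cells × Cells) => (!p.1.bit p.2.1 a) = true :=
    PrimrecRel.comp Primrec.eq (Primrec.not.comp (primrec_bit.comp
      ((Primrec.fst.comp Primrec.snd).pair
        ((Primrec.fst.comp (Primrec.snd.comp Primrec.snd)).pair Primrec.fst))))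
      (Primrec.const true)
  refine ((Primrec.fst.comp Primrec.snd).pair
    (hR.listFilter.comp (Primrec.snd.comp Primrec.snd) Primrec.id)).of_eq fun p => ?_
  simp [newCells]

theorem primrec_exceeds : Primrec fun p : (Cells × Cells) × ℕ => exceeds p.1.1 p.1.2 p.2 := by
  have hl {f : (Cells × Cells) × ℕ → Cells} (hf : Primrec f) : Primrec fun p => (f p).2.length :=
    Primrec.list_length.comp (Primrec.snd.comp hf)
  have h1 : Primrec fun p : (Cells × Cells) × ℕ => p.1.1 := Primrec.fst.comp Primrec.fst
  have h2 : Primrec fun p : (Cells × Cells) × ℕ => p.1.2 := Primrec.snd.comp Primrec.fst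
  have hN : Primrec fun p : (Cells × Cells) × ℕ => 2 ^ p.2 := primrec_two_pow.comp Primrec.snd
  have hm {f g : (Cells × Cells) × ℕ → ℕ} (hf : Primrec f) (hg : Primrec g) :
    Primrec fun p => f p * g p := Primrec.nat_mul.comp hf hg
  exact PrimrecPred.decide (PrimrecRel.comp Primrec.nat_lt
    (Primrec.nat_add.comp (hm (hm (hl h1) hN) (Primrec.fst.comp h2))
      (hm (Primrec.fst.comp h1) (Primrec.fst.comp h2)))
    (hm (hm (hl h2) hN) (Primrec.fst.comp h1)))

/-- The natural number code of a rational `(a - b) / d`. -/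
def ratCode (a b d : ℕ) : ℕ := Nat.pair (Nat.pair a b) (d - 1)

theorem ratOfNat_ratCode {a b d : ℕ} (hd : 0 < d) :
    (ratOfNat (ratCode a b d) : ℝ) = ((a : ℝ) - b) / d := by
  have : ((d - 1 : ℕ) : ℚ) + 1 = d := by exact_mod_cast Nat.sub_add_cancel hd
  simp only [ratOfNat, ratCode, Nat.unpair_pair, this]
  push_cast
  rfl

theorem primrec_ratCode : Primrec fun p : ℕ × ℕ × ℕ => ratCode p.1 p.2.1 p.2.2 :=
  Primrec₂.natPair.comp
    (Primrec₂.natPair.comp Primrec.fst (Primrec.fst.comp Primrec.snd))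
    (Primrec.nat_sub.comp (Primrec.snd.comp Primrec.snd) (Primrec.const 1))

/-- The code of an open interval covering the cell with index `a` of mesh `1 / M`. -/
def cellInterval (M a : ℕ) : ℕ := Nat.pair (ratCode a 1 M) (ratCode (a + 1) 0 M)

theorem primrec_cellInterval : Primrec fun p : ℕ × ℕ => cellInterval p.1 p.2 :=
  Primrec₂.natPair.comp
    (primrec_ratCode.comp (Primrec.snd.pair ((Primrec.const 1).pair Primrec.fst)))
    (primrec_ratCode.comp ((Primrec.succ.comp Primrec.snd).pair
      ((Primrec.const 0).pair Primrec.fst)))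

/-- The open interval with code `c`. -/
def intervalOf (c : ℕ) : Set ℝ :=
  Set.Ioo (ratOfNat c.unpair.1 : ℝ) (ratOfNat c.unpair.2 : ℝ)

theorem intervalOf_cellInterval {M : ℕ} (hM : 0 < M) (a : ℕ) :
    intervalOf (cellInterval M a) = Set.Ioo (((a : ℝ) - 1) / M) ((a + 1) / M) := by
  simp [intervalOf, cellInterval, ratOfNat_ratCode hM]

/-! ### Approximating the cut -/

/-- The mesh used to compare reals with the rational numbered `q`. -/
def cutMesh (r q : ℕ) : ℕ := 2 ^ (r + q + 4)

theorem cutMesh_pos (r q : ℕ) : 0 < cutMesh r q := by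
  unfold cutMesh
  positivity

theorem primrec_cutMesh : Primrec fun p : ℕ × ℕ => cutMesh p.1 p.2 :=
  primrec_two_pow.comp (Primrec.nat_add.comp
    (Primrec.nat_add.comp Primrec.fst Primrec.snd) (Primrec.const 4))

/-- The cells to the right of the rational numbered `q`. -/
def cellsRight (r q : ℕ) : Cells :=
  (cutMesh r q, (List.range (cutMesh r q)).filter fun a =>
    q.unpair.1.unpair.1 * cutMesh r q < a * (q.unpair.2 + 1) + q.unpair.1.unpair.2 * cutMesh r q)

/-- The cells to the left of the rational numbered `q`. -/
def cellsLeft (r q : ℕ) : Cells :=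
  (cutMesh r q, (List.range (cutMesh r q)).filter fun a =>
    a * (q.unpair.2 + 1) + q.unpair.1.unpair.2 * cutMesh r q < q.unpair.1.unpair.1 * cutMesh r q)

/-- The code of the interval of radius `1 / cutMesh r q` around the rational numbered `q`. -/
def cutInterval (r q : ℕ) : ℕ :=
  Nat.pair
    (ratCode (q.unpair.1.unpair.1 * cutMesh r q)
      (q.unpair.1.unpair.2 * cutMesh r q + (q.unpair.2 + 1)) ((q.unpair.2 + 1) * cutMesh r q))
    (ratCode (q.unpair.1.unpair.1 * cutMesh r q + (q.unpair.2 + 1))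
      (q.unpair.1.unpair.2 * cutMesh r q) ((q.unpair.2 + 1) * cutMesh r q))

theorem primrec_cut_data :
    (Primrec fun q : ℕ => q.unpair.1.unpair.1) ∧ (Primrec fun q : ℕ => q.unpair.1.unpair.2) ∧
      Primrec fun q : ℕ => q.unpair.2 + 1 := by
  have h : Primrec fun q : ℕ => q.unpair.1.unpair :=
    Primrec.unpair.comp (Primrec.fst.comp Primrec.unpair)
  exact ⟨Primrec.fst.comp h, Primrec.snd.comp h,
    Primrec.succ.comp (Primrec.snd.comp Primrec.unpair)⟩

theorem primrec_cells_and_interval :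
    (Primrec fun p : ℕ × ℕ => cellsRight p.1 p.2) ∧ (Primrec fun p : ℕ × ℕ => cellsLeft p.1 p.2) ∧
      Primrec fun p : ℕ × ℕ => cutInterval p.1 p.2 := by
  obtain ⟨hA, hB, hC⟩ := primrec_cut_data
  have hM := primrec_cutMesh
  have hAM : Primrec fun p : ℕ × ℕ => p.2.unpair.1.unpair.1 * cutMesh p.1 p.2 :=
    Primrec.nat_mul.comp (hA.comp Primrec.snd) hM
  have hBM : Primrec fun p : ℕ × ℕ => p.2.unpair.1.unpair.2 * cutMesh p.1 p.2 :=
    Primrec.nat_mul.comp (hB.comp Primrec.snd) hM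
  have hC2 : Primrec fun p : ℕ × ℕ => p.2.unpair.2 + 1 := hC.comp Primrec.snd
  have hCM : Primrec fun p : ℕ × ℕ => (p.2.unpair.2 + 1) * cutMesh p.1 p.2 :=
    Primrec.nat_mul.comp hC2 hM
  have hside : Primrec fun z : ℕ × (ℕ × ℕ) =>
      z.1 * (z.2.2.unpair.2 + 1) + z.2.2.unpair.1.unpair.2 * cutMesh z.2.1 z.2.2 :=
    Primrec.nat_add.comp (Primrec.nat_mul.comp Primrec.fst (hC2.comp Primrec.snd))
      (hBM.comp Primrec.snd)
  have hR : PrimrecRel fun (a : ℕ) (p : ℕ × ℕ) => p.2.unpair.1.unpair.1 * cutMesh p.1 p.2 <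
      a * (p.2.unpair.2 + 1) + p.2.unpair.1.unpair.2 * cutMesh p.1 p.2 :=
    PrimrecRel.comp Primrec.nat_lt (hAM.comp Primrec.snd) hside
  have hL : PrimrecRel fun (a : ℕ) (p : ℕ × ℕ) =>
      a * (p.2.unpair.2 + 1) + p.2.unpair.1.unpair.2 * cutMesh p.1 p.2 <
        p.2.unpair.1.unpair.1 * cutMesh p.1 p.2 :=
    PrimrecRel.comp Primrec.nat_lt hside (hAM.comp Primrec.snd)
  refine ⟨hM.pair (hR.listFilter.comp (Primrec.list_range.comp hM) Primrec.id),
    hM.pair (hL.listFilter.comp (Primrec.list_range.comp hM) Primrec.id),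
    Primrec₂.natPair.comp (primrec_ratCode.comp (hAM.pair ((Primrec.nat_add.comp hBM hC2).pair
      hCM))) (primrec_ratCode.comp ((Primrec.nat_add.comp hAM hC2).pair (hBM.pair hCM)))⟩

theorem ratOfNat_real (q : ℕ) : (ratOfNat q : ℝ) =
    ((q.unpair.1.unpair.1 : ℝ) - q.unpair.1.unpair.2) / (q.unpair.2 + 1) := by
  simp [ratOfNat]

theorem intervalOf_cutInterval (r q : ℕ) : intervalOf (cutInterval r q) =
    Set.Ioo ((ratOfNat q : ℝ) - 1 / cutMesh r q) (ratOfNat q + 1 / cutMesh r q) := by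
  have hM : (0 : ℝ) < cutMesh r q := Nat.cast_pos.2 (cutMesh_pos r q)
  have hd : 0 < (q.unpair.2 + 1) * cutMesh r q := Nat.mul_pos (Nat.succ_pos _) (cutMesh_pos r q)
  have hC : (0 : ℝ) < (q.unpair.2 : ℝ) + 1 := by positivity
  rw [intervalOf, cutInterval, Nat.unpair_pair, ratOfNat_ratCode hd, ratOfNat_ratCode hd,
    ratOfNat_real]
  push_cast
  congr 1
  · field_simp
    ring
  · field_simp
    ring

theorem mem_filter_cell {x : ℝ} (hx : x ∈ Set.Ico (0 : ℝ) 1) {M : ℕ} (hM : 0 < M)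
    (P : ℕ → Bool) : Cells.Mem (M, (List.range M).filter P) x ↔ P ⌊x * M⌋₊ = true := by
  rw [Cells.Mem, List.mem_filter, List.mem_range]
  exact and_iff_right (floor_lt_of_lt_one hx hM)

/-- Let `M = cutMesh r q` and let `ρ` be the rational numbered `q`. Outside the interval, `x * M`
differs from `ρ * M` by at least 1, so rounding `x * M` down keeps the comparison correct. The
filters state this comparison with denominators cleared. -/
theorem cells_mem_iff {r q : ℕ} {x : ℝ} (hx : x ∈ Set.Ico (0 : ℝ) 1)
    (hq : x ∉ intervalOf (cutInterval r q)) :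
    ((cellsRight r q).Mem x ↔ (ratOfNat q : ℝ) < x) ∧
      ((cellsLeft r q).Mem x ↔ x < (ratOfNat q : ℝ)) := by
  have hM : (0 : ℝ) < cutMesh r q := Nat.cast_pos.2 (cutMesh_pos r q)
  have hC : (0 : ℝ) < (q.unpair.2 : ℝ) + 1 := by positivity
  rw [intervalOf_cutInterval, Set.mem_Ioo, not_and_or, not_lt, not_lt] at hq
  have hxM : 0 ≤ x * cutMesh r q := mul_nonneg hx.1 hM.le
  have h1 := Nat.floor_le hxM
  have h2 := Nat.lt_floor_add_one (x * cutMesh r q)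
  have h3 : (ratOfNat q : ℝ) * (q.unpair.2 + 1) =
      (q.unpair.1.unpair.1 : ℝ) - q.unpair.1.unpair.2 := by
    rw [ratOfNat_real]
    field_simp
  have h1M : (1 : ℝ) / cutMesh r q * cutMesh r q = 1 := by field_simp
  have hr : (cellsRight r q).Mem x ↔ (ratOfNat q : ℝ) * cutMesh r q < ⌊x * cutMesh r q⌋₊ := by
    rw [cellsRight, mem_filter_cell hx (cutMesh_pos r q), decide_eq_true_iff, ← @Nat.cast_lt ℝ]
    refine Iff.trans ?_ (mul_lt_mul_iff_left₀ hC)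
    push_cast
    rw [mul_right_comm, h3, sub_mul, sub_lt_iff_lt_add]
  have hl : (cellsLeft r q).Mem x ↔ (⌊x * cutMesh r q⌋₊ : ℝ) < (ratOfNat q : ℝ) * cutMesh r q := by
    rw [cellsLeft, mem_filter_cell hx (cutMesh_pos r q), decide_eq_true_iff, ← @Nat.cast_lt ℝ]
    refine Iff.trans ?_ (mul_lt_mul_iff_left₀ hC)
    push_cast
    rw [mul_right_comm (ratOfNat q : ℝ), h3, sub_mul, lt_sub_iff_add_lt]
  rw [hr, hl]
  rcases hq with hq | hq
  · have h4 : x < ratOfNat q := hq.trans_lt (sub_lt_self _ (by positivity))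
    have h5 : x * cutMesh r q < ratOfNat q * cutMesh r q := mul_lt_mul_of_pos_right h4 hM
    exact ⟨iff_of_false (by linarith) (by linarith), iff_of_true (by linarith) h4⟩
  · have h4 : (ratOfNat q : ℝ) < x := (lt_add_of_pos_right _ (by positivity)).trans_le hq
    have h5 : (ratOfNat q + 1 / cutMesh r q) * cutMesh r q ≤ x * cutMesh r q :=
      mul_le_mul_of_nonneg_right hq hM.le
    rw [add_mul, h1M] at h5
    exact ⟨iff_of_true (by linarith) h4, iff_of_false (by linarith) (by linarith)⟩

/-- The union of cells approximating `{x | n ∈ X ⊕ L_x ⊕ R_x}`. -/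
def baseCells (X : Set ℕ) (r n : ℕ) : Cells :=
  bif n.bodd then
    bif n.div2.bodd then cellsLeft r n.div2.div2 else cellsRight r n.div2.div2
  else bif query X n.div2 then (1, [0]) else (1, [])

theorem baseCells_functional :
    TotalFunctional fun X (p : ℕ × ℕ) => baseCells X p.1 p.2 := by
  obtain ⟨hR, hL, -⟩ := primrec_cells_and_interval
  have hd : Primrec fun p : ℕ × ℕ => p.2.div2 := Primrec.nat_div2.comp Primrec.snd
  have hq : Primrec fun z : (ℕ × ℕ) × Bool => (z.1.1, z.1.2.div2.div2) :=
    (Primrec.fst.comp Primrec.fst).pair (Primrec.nat_div2.comp (hd.comp Primrec.fst))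
  have hleft := hL.comp hq
  have hright := hR.comp hq
  have hb : Primrec fun z : (ℕ × ℕ) × Bool => z.1.2.bodd :=
    Primrec.nat_bodd.comp (Primrec.snd.comp Primrec.fst)
  have hb' : Primrec fun z : (ℕ × ℕ) × Bool => z.1.2.div2.bodd :=
    Primrec.nat_bodd.comp (hd.comp Primrec.fst)
  have hS : Primrec fun z : (ℕ × ℕ) × Bool => bif z.2 then ((1, [0]) : Cells) else (1, []) :=
    Primrec.cond Primrec.snd (Primrec.const _) (Primrec.const _)
  have hg := Primrec.cond hb (Primrec.cond hb' hleft hright) hS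
  have hquery : TotalFunctional fun X (p : ℕ × ℕ) => query X p.2.div2 :=
    TotalFunctional.query_comp hd.to_comp
  exact TotalFunctional.map hquery hg.to_comp

theorem baseCells_fst_pos (X : Set ℕ) (r n : ℕ) : 0 < (baseCells X r n).1 := by
  unfold baseCells
  cases n.bodd <;> cases n.div2.bodd <;> cases query X n.div2 <;>
    first | exact one_pos | exact cutMesh_pos _ _

theorem mem_join_even {X Y : Set ℕ} {a : ℕ} : 2 * a ∈ join X Y ↔ a ∈ X := by
  constructor
  · rintro (⟨b, hb, h⟩ | ⟨b, -, h⟩)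
    · obtain rfl : a = b := by omega
      exact hb
    · omega
  · exact fun h => Or.inl ⟨a, h, rfl⟩

theorem mem_join_odd {X Y : Set ℕ} {a : ℕ} : 2 * a + 1 ∈ join X Y ↔ a ∈ Y := by
  constructor
  · rintro (⟨b, -, h⟩ | ⟨b, hb, h⟩)
    · omega
    · obtain rfl : a = b := by omega
      exact hb
  · exact fun h => Or.inr ⟨a, h, rfl⟩

theorem baseCells_mem_iff {X : Set ℕ} {r n : ℕ} {x : ℝ} (hx : x ∈ Set.Ico (0 : ℝ) 1)
    (h : ∀ q, x ∉ intervalOf (cutInterval r q)) :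
    (baseCells X r n).Mem x ↔ n ∈ withCut X x := by
  have hn := Nat.bodd_add_div2 n
  have hn' := Nat.bodd_add_div2 n.div2
  have hq := cells_mem_iff hx (h n.div2.div2)
  have hfl : ⌊x⌋₊ = 0 := Nat.floor_eq_zero.2 hx.2
  unfold baseCells withCut
  cases hb : n.bodd
  · conv_rhs => rw [← hn, hb, Bool.toNat_false, zero_add, mem_join_even]
    cases hX : query X n.div2
    · simpa [Cells.Mem] using hX
    · simpa [Cells.Mem, hfl] using hX
  -- The left cut holds the rationals below `x`, so its half of the join is approximated by the
  -- cells to the right of the rational, and conversely.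
  · conv_rhs => rw [← hn, hb, Bool.toNat_true, add_comm, mem_join_odd]
    cases hb' : n.div2.bodd
    · conv_rhs => rw [← hn', hb', Bool.toNat_false, zero_add, mem_join_even]
      exact hq.1
    · conv_rhs => rw [← hn', hb', Bool.toNat_true, add_comm, mem_join_odd]
      exact hq.2

end CellsComputable

/-! ### Substitution of oracles -/

section Pullback

variable {α β : Type*} [Primcodable α] [Primcodable β]

/-- Replace the functional by an index computed from the parameter, with outputs encoded as numbers,
and run that program on the preimage oracle. This is how columns of the oracle, and a set known only
through its jump, come to serve as oracles. -/
theorem Functional.pullback {f : Set ℕ → α →. β} (hf : Functional f) {h : α × ℕ → ℕ}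
    (hh : Computable h) : Functional fun X a => f (pullback h X a) a := by
  have h1 : Functional fun X (p : α × ℕ) => (f X p.1).map encode :=
    (Functional.comp hf (Computable.fst (α := α) (β := ℕ))).map (g := fun p => encode p.2)
      (Computable.encode.comp Computable.snd)
  obtain ⟨g, hg, hg'⟩ := h1.exists_computable_index
  have h2 : Functional fun X a => EffLusin.turingEval (g a) (EffLusin.pullback h X a) 0 :=
    Functional.turingEval hh hg (Computable.const 0)
  have h3 := h2.bind_partrec (g := fun p => (Part.ofOption (decode (α := β) p.2)))
    (Computable.ofOption (Computable.decode.comp Computable.snd))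
  refine h3.of_eq fun X a => ?_
  simp only [(hg' _ _ _).1]
  ext v
  simp

end Pullback

/-! ### The approximation of a jump -/

section Program

/-- The union of cells coded by a natural number. -/
def cellsOfNat (v : ℕ) : Cells := (decode v).getD (1, [])

@[simp] theorem cellsOfNat_encode (v : Cells) : cellsOfNat (encode v) = v := by
  rw [cellsOfNat, encodek, Option.getD_some]

theorem computable_cellsOfNat : Computable cellsOfNat :=
  Computable.option_getD Computable.decode (Computable.const _)

/-- The union of cells which program `c` computes from `Z`. -/
def approx (c : ℕ) (Z : Set ℕ) (r b n : ℕ) : Part Cells :=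
  (turingEval c Z (Nat.pair r (Nat.pair b n))).map cellsOfNat

/-- A program, the accuracy, a flag and an index. -/
abbrev Params : Type := ℕ × ℕ × ℕ × ℕ

/-- The stages of the approximation of the halting set relative to the sets approximated by a
program. -/
def haltPart (Z : Set ℕ) (p : Params) (t : ℕ) : Part Cells :=
  (partList (approx p.1 Z p.2.1 p.2.2.1) t).map fun vs => haltCells vs p.2.2.2

theorem functional_haltPart :
    Functional fun Z (q : Params × ℕ) => haltPart Z q.1 q.2 := by
  have hn : Computable fun q : Params × ℕ =>
      Nat.pair q.1.2.1 (Nat.pair q.1.2.2.1 q.2) := by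
    have h2 : Computable fun q : Params × ℕ => q.1.2 := Computable.snd.comp Computable.fst
    exact Primrec₂.natPair.to_comp.comp (Computable.fst.comp h2)
      (Primrec₂.natPair.to_comp.comp (Computable.fst.comp (Computable.snd.comp h2))
        Computable.snd)
  have h1 : Functional fun Z (q : Params × ℕ) =>
      approx q.1.1 Z q.1.2.1 q.1.2.2.1 q.2 :=
    Functional.map (f := fun Z (q : Params × ℕ) => turingEval q.1.1 (pullback Prod.snd Z q)
      (Nat.pair q.1.2.1 (Nat.pair q.1.2.2.1 q.2))) (g := fun z => cellsOfNat z.2)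
      (Functional.turingEval Computable.snd (Computable.fst.comp Computable.fst) hn)
      (computable_cellsOfNat.comp Computable.snd)
  have hg : Computable fun z : (Params × ℕ) × List Cells => (z.2, z.1.1.2.2.2) :=
    Computable.snd.pair (Computable.snd.comp (Computable.snd.comp (Computable.snd.comp
      (Computable.fst.comp Computable.fst))))
  have h3 := primrec_haltCells.to_comp.comp hg
  exact Functional.map (Functional.list h1) h3

theorem haltPart_eq {Z : Set ℕ} {p : Params} {f : ℕ → Cells}
    (h : ∀ n, approx p.1 Z p.2.1 p.2.2.1 n = Part.some (f n)) (t : ℕ) :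
    haltPart Z p t = Part.some (haltStage f p.2.2.2 t) := by
  rw [haltPart, partList_eq_some fun i _ => h i, Part.map_some, haltStage]

/-- Compares two stages of the approximation of the halting set. -/
def gainTest (Z : Set ℕ) (p : Params) (s N t : ℕ) : Part Bool :=
  (haltPart Z p s).bind fun v => (haltPart Z p t).map fun w => exceeds v w N

/-- Searches for a stage which improves on stage `s` by more than `2 ^ (-N)`. -/
def gainSearch (Z : Set ℕ) (q : Params × ℕ × ℕ) : Part ℕ :=
  Nat.rfind fun t => gainTest Z q.1 q.2.1 q.2.2 t

theorem functional_gainSearch : Functional gainSearch := by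
  refine Functional.rfind (p := fun Z (z : (Params × ℕ × ℕ) × ℕ) =>
    gainTest Z z.1.1 z.1.2.1 z.1.2.2 z.2) ?_
  have c1 : Computable fun z : (Params × ℕ × ℕ) × ℕ => (z.1.1, z.1.2.1) :=
    (Computable.fst.comp Computable.fst).pair
      (Computable.fst.comp (Computable.snd.comp Computable.fst))
  have c2 : Computable fun z : ((Params × ℕ × ℕ) × ℕ) × Cells => (z.1.1.1, z.1.2) :=
    (Computable.fst.comp (Computable.fst.comp Computable.fst)).pair
      (Computable.snd.comp Computable.fst)
  have c3 : Computable fun y : (((Params × ℕ × ℕ) × ℕ) × Cells) × Cells =>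
      ((y.1.2, y.2), y.1.1.1.2.2) :=
    ((Computable.snd.comp Computable.fst).pair Computable.snd).pair
      (Computable.snd.comp (Computable.snd.comp (Computable.fst.comp
        (Computable.fst.comp Computable.fst))))
  have c4 := primrec_exceeds.to_comp.comp c3
  have h1 := functional_haltPart.comp c1
  have h2 := functional_haltPart.comp c2
  exact Functional.bind h1 (Functional.map h2 c4)

theorem exists_gainIndex : ∃ g : Params × ℕ × ℕ → ℕ, Computable g ∧
    ∀ q Z n, turingEval (g q) Z n = gainSearch Z q := by
  obtain ⟨g, hg, hg'⟩ := (functional_gainSearch.comp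
    (Computable.fst (α := Params × ℕ × ℕ) (β := ℕ))).exists_computable_index
  exact ⟨g, hg, fun q Z n => (hg' q Z n).1⟩

/-- The program which halts if some stage improves on stage `s` by more than `2 ^ (-N)`. -/
def gainIndex : Params × ℕ × ℕ → ℕ := exists_gainIndex.choose

theorem computable_gainIndex : Computable gainIndex := exists_gainIndex.choose_spec.1

/-- The program ignores its input, so it halts on its own number exactly if the search succeeds. One
query to the jump thus settles an existential question about all stages. -/
theorem gainIndex_mem_turingJump {q : Params × ℕ × ℕ} {Z : Set ℕ} {f : ℕ → Cells}
    (h : ∀ n, approx q.1.1 Z q.1.2.1 q.1.2.2.1 n = Part.some (f n)) :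
    gainIndex q ∈ turingJump Z ↔ ∃ t, exceeds (haltStage f q.1.2.2.2 q.2.1)
      (haltStage f q.1.2.2.2 t) q.2.2 = true := by
  have hg : turingEval (gainIndex q) Z (gainIndex q) = gainSearch Z q :=
    exists_gainIndex.choose_spec.2 q Z (gainIndex q)
  have ht : ∀ t, gainTest Z q.1 q.2.1 q.2.2 t = Part.some (exceeds (haltStage f q.1.2.2.2 q.2.1)
      (haltStage f q.1.2.2.2 t) q.2.2) := by
    intro t
    rw [gainTest, haltPart_eq h, haltPart_eq h, Part.bind_some, Part.map_some]
  change (turingEval (gainIndex q) Z (gainIndex q)).Dom ↔ _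
  rw [hg]
  refine Nat.rfind_dom.trans ?_
  simp only [ht, Part.mem_some_iff, Part.some_dom, implies_true, and_true]
  exact exists_congr fun t => eq_comm

/-- The reduction of `Z` to its jump does not depend on `Z`. It is needed because the program finds
only the jump in an additional column and must recompute stages from `Z`. -/
theorem exists_askIndex : ∃ g : ℕ → ℕ, Computable g ∧
    ∀ (Z : Set ℕ) n, g n ∈ turingJump Z ↔ n ∈ Z := by
  have h1 : Functional fun Z (p : ℕ × ℕ) =>
      bif query Z p.1 then Part.some 0 else (Part.none : Part ℕ) :=
    Functional.cond (TotalFunctional.query_comp Computable.fst)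
      (TotalFunctional.of_computable (Computable.const 0)) (Functional.of_partrec Partrec.none)
  obtain ⟨g, hg, hg'⟩ := h1.exists_computable_index
  refine ⟨g, hg, fun Z n => ?_⟩
  change (turingEval (g n) Z (g n)).Dom ↔ _
  rw [(hg' _ _ _).1]
  by_cases h : n ∈ Z
  · simp [query_eq_true.2 h, h]
  · simp [query_eq_false.2 h, h]

/-- The program which halts if the oracle contains `n`. -/
def askIndex : ℕ → ℕ := exists_askIndex.choose

theorem computable_askIndex : Computable askIndex := exists_askIndex.choose_spec.1

/-- The set whose Turing jump is given. -/
def unjump (J : Set ℕ) : Set ℕ := {n | askIndex n ∈ J}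

theorem unjump_turingJump (Z : Set ℕ) : unjump (turingJump Z) = Z :=
  Set.ext fun n => exists_askIndex.choose_spec.2 Z n

/-- A stage of the approximation of the halting set from which on it gains at most `2 ^ (-N)`,
found from the Turing jump. -/
def stageSearch (J : Set ℕ) (q : Params × ℕ) : Part ℕ :=
  Nat.rfind fun s => Part.some (!query J (gainIndex (q.1, (s, q.2))))

theorem functional_stageSearch : Functional stageSearch := by
  refine Functional.rfind (p := fun J (z : (Params × ℕ) × ℕ) =>
    Part.some (!query J (gainIndex (z.1.1, (z.2, z.1.2))))) ?_
  refine TotalFunctional.not (TotalFunctional.query_comp ?_)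
  exact computable_gainIndex.comp ((Computable.fst.comp Computable.fst).pair
    (Computable.snd.pair (Computable.snd.comp Computable.fst)))

/-- Finality of a stage is the negation of one halting question, hence decidable from the jump;
boundedness of measure makes the search end. -/
theorem exists_stageSearch_eq {p : Params} {N : ℕ} {Z : Set ℕ} {f : ℕ → Cells}
    (h : ∀ n, approx p.1 Z p.2.1 p.2.2.1 n = Part.some (f n)) (hf : ∀ n, 0 < (f n).1) :
    ∃ s, stageSearch (turingJump Z) (p, N) = Part.some s ∧ IsFinalStage f p.2.2.2 N s := by
  have key : ∀ s, (!query (turingJump Z) (gainIndex (p, (s, N)))) = true ↔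
      IsFinalStage f p.2.2.2 N s := by
    intro s
    rw [Bool.not_eq_true', query_eq_false, gainIndex_mem_turingJump h]
    simp [IsFinalStage]
  obtain ⟨s, hs⟩ := exists_isFinalStage (m := p.2.2.2) hf N
  have hd : (stageSearch (turingJump Z) (p, N)).Dom :=
    Nat.rfind_dom.2 ⟨s, Part.mem_some_iff.2 ((key s).2 hs).symm, fun _ => trivial⟩
  obtain ⟨u, hu⟩ := Part.dom_iff_mem.1 hd
  exact ⟨u, Part.eq_some_iff.2 hu, (key u).1 (Part.mem_some_iff.1 (Nat.rfind_spec hu)).symm⟩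

/-- The approximation of the halting set by one of its stages. -/
def jumpApprox (J : Set ℕ) (q : Params × ℕ) : Part Cells :=
  (stageSearch J q).bind fun s => haltPart (unjump J) q.1 s

theorem functional_haltPart_unjump :
    Functional fun J (q : Params × ℕ) => haltPart (unjump J) q.1 q.2 := by
  have h : Computable fun z : (Params × ℕ) × ℕ => askIndex z.2 :=
    computable_askIndex.comp Computable.snd
  have := Functional.pullback functional_haltPart h
  exact this

theorem functional_jumpApprox : Functional jumpApprox := by
  have c1 : Computable fun z : (Params × ℕ) × ℕ => (z.1.1, z.2) :=
    (Computable.fst.comp Computable.fst).pair Computable.snd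
  exact Functional.bind functional_stageSearch (functional_haltPart_unjump.comp c1)

/-- The code of the interval which covers the cell with index `y.2`, if this cell enters the
halting set `y.1` stages after the stage by which it is approximated. -/
def lateInterval (J : Set ℕ) (z : (Params × ℕ) × (ℕ × ℕ)) : Part ℕ :=
  (stageSearch J z.1).bind fun s => (haltPart (unjump J) z.1.1 (s + z.2.1)).bind fun v =>
    (haltPart (unjump J) z.1.1 (s + z.2.1 + 1)).bind fun w =>
      bif decide (z.2.2 ∈ (newCells v w).2) then Part.some (cellInterval w.1 z.2.2) else Part.none

theorem functional_lateInterval : Functional lateInterval := by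
  have c1 : Computable fun z : (Params × ℕ) × (ℕ × ℕ) => z.1 := Computable.fst
  have c2 : Computable fun z : ((Params × ℕ) × (ℕ × ℕ)) × ℕ => (z.1.1.1, z.2 + z.1.2.1) :=
    (Computable.fst.comp (Computable.fst.comp Computable.fst)).pair
      (Primrec.nat_add.to_comp.comp Computable.snd
        (Computable.fst.comp (Computable.snd.comp Computable.fst)))
  have c3 : Computable fun z : (((Params × ℕ) × (ℕ × ℕ)) × ℕ) × Cells =>
      (z.1.1.1.1, z.1.2 + z.1.1.2.1 + 1) := by
    have h := c2.comp (Computable.fst (α := ((Params × ℕ) × (ℕ × ℕ)) × ℕ) (β := Cells))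
    have h' := (Computable.fst.comp h).pair (Computable.succ.comp (Computable.snd.comp h))
    exact h'
  have ca : Computable fun z : ((((Params × ℕ) × (ℕ × ℕ)) × ℕ) × Cells) × Cells => z.1.1.1.2.2 :=
    Computable.snd.comp (Computable.snd.comp
      (Computable.fst.comp (Computable.fst.comp Computable.fst)))
  have c4 : Computable fun z : ((((Params × ℕ) × (ℕ × ℕ)) × ℕ) × Cells) × Cells =>
      decide (z.1.1.1.2.2 ∈ (newCells z.1.2 z.2).2) := by
    have h := primrec_newCells.to_comp.comp ((Computable.snd.comp (Computable.fst (α :=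
      (((Params × ℕ) × (ℕ × ℕ)) × ℕ) × Cells))).pair (Computable.snd (β := Cells)))
    have h' := primrecRel_mem_list.decide.to_comp.comp ca (Computable.snd.comp h)
    exact h'
  have c5 : Computable fun z : ((((Params × ℕ) × (ℕ × ℕ)) × ℕ) × Cells) × Cells =>
      cellInterval z.2.1 z.1.1.1.2.2 :=
    primrec_cellInterval.to_comp.comp
      (g := fun z : ((((Params × ℕ) × (ℕ × ℕ)) × ℕ) × Cells) × Cells => (z.2.1, z.1.1.1.2.2))
      ((Computable.fst.comp Computable.snd).pair ca)
  have h1 := functional_stageSearch.comp c1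
  have h2 := functional_haltPart_unjump.comp c2
  have h3 := functional_haltPart_unjump.comp c3
  have h4 := Functional.of_partrec (Partrec.cond c4 c5.partrec Partrec.none)
  have h5 := Functional.bind h3 h4
  have h6 := Functional.bind h2 h5
  have h7 := Functional.bind h1 h6
  refine Functional.of_eq h7 fun X a => ?_
  rw [lateInterval]
  rfl

theorem mem_lateInterval {p : Params} {N : ℕ} {Z : Set ℕ} {f : ℕ → Cells} {s : ℕ}
    (h : ∀ n, approx p.1 Z p.2.1 p.2.2.1 n = Part.some (f n))
    (hs : stageSearch (turingJump Z) (p, N) = Part.some s) (u a k : ℕ) :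
    k ∈ lateInterval (turingJump Z) ((p, N), (u, a)) ↔
      a ∈ (newCells (haltStage f p.2.2.2 (s + u)) (haltStage f p.2.2.2 (s + u + 1))).2 ∧
        k = cellInterval (haltStage f p.2.2.2 (s + u + 1)).1 a := by
  rw [lateInterval]
  simp only [unjump_turingJump, hs, Part.bind_some, haltPart_eq h]
  by_cases ha : a ∈ (newCells (haltStage f p.2.2.2 (s + u)) (haltStage f p.2.2.2 (s + u + 1))).2
  · simp [ha]
  · simp [ha]

theorem jumpApprox_eq {p : Params} {N : ℕ} {Z : Set ℕ} {f : ℕ → Cells} {s : ℕ}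
    (h : ∀ n, approx p.1 Z p.2.1 p.2.2.1 n = Part.some (f n))
    (hs : stageSearch (turingJump Z) (p, N) = Part.some s) :
    jumpApprox (turingJump Z) (p, N) = Part.some (haltStage f p.2.2.2 s) := by
  rw [jumpApprox, hs, Part.bind_some, unjump_turingJump, haltPart_eq h]

/-- The union of the late intervals. -/
def lateSet (J : Set ℕ) (q : Params × ℕ) : Set ℝ :=
  ⋃ k ∈ {k | ∃ y, k ∈ lateInterval J (q, y)}, intervalOf k

theorem lateSet_eq {p : Params} {N : ℕ} {Z : Set ℕ} {f : ℕ → Cells} {s : ℕ}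
    (h : ∀ n, approx p.1 Z p.2.1 p.2.2.1 n = Part.some (f n)) (hf : ∀ n, 0 < (f n).1)
    (hs : stageSearch (turingJump Z) (p, N) = Part.some s) :
    lateSet (turingJump Z) (p, N) = lateCover f p.2.2.2 s := by
  ext x
  simp only [lateSet, lateCover, Set.mem_iUnion, exists_prop]
  constructor
  · rintro ⟨k, ⟨⟨u, a⟩, hk⟩, hx⟩
    obtain ⟨ha, rfl⟩ := (mem_lateInterval h hs u a k).1 hk
    rw [intervalOf_cellInterval (haltStage_fst_pos hf _)] at hx
    exact ⟨u, a, ha, hx⟩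
  · rintro ⟨u, a, ha, hx⟩
    refine ⟨_, ⟨(u, a), (mem_lateInterval h hs u a _).2 ⟨ha, rfl⟩⟩, ?_⟩
    rwa [intervalOf_cellInterval (haltStage_fst_pos hf _)]

end Program

/-! ### The approximating program -/

section Recursion

/-- Distinguishes zero from the other numbers. -/
def flag (i : ℕ) : ℕ := 1 - (1 - i)

theorem flag_of_ne_zero {i : ℕ} (h : i ≠ 0) : flag i = 1 := by
  unfold flag
  omega

theorem computable_flag : Computable flag :=
  (Primrec.nat_sub.comp (Primrec.const 1)
    (Primrec.nat_sub.comp (Primrec.const 1) Primrec.id)).to_comp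

/-- Decides whether a column of a jump along a presentation belongs to the domain, provided it
is not the additional column. -/
def present (Y : Set ℕ) (i : ℕ) : Part Bool :=
  bif decide (i = 0) then Part.some true else
    bif query Y (Nat.pair 1 mark) then Part.some false else
      (Nat.rfind fun p => Part.some (!decide (p = 0) &&
        (!query Y (Nat.pair p mark) && query Y (Nat.pair p (Nat.pair 1 mark))))).bind fun p =>
          Part.some (query Y (Nat.pair i (Nat.pair 1 mark)) ||
            query Y (Nat.pair i (Nat.pair p (Nat.pair 1 mark))))

theorem computable_isZero {α : Type*} [Primcodable α] {f : α → ℕ} (hf : Computable f) :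
    Computable fun a => decide (f a = 0) :=
  (Primrec.eq.comp Primrec.id (Primrec.const 0)).decide.to_comp.comp hf

theorem computable_pair {α : Type*} [Primcodable α] {f g : α → ℕ} (hf : Computable f)
    (hg : Computable g) : Computable fun a => Nat.pair (f a) (g a) :=
  Primrec₂.natPair.to_comp.comp hf hg

theorem functional_present : Functional present := by
  have k1 : Computable fun _ : ℕ × ℕ => Nat.pair 1 mark := Computable.const _
  have h1 : Functional fun Y (z : ℕ × ℕ) => Part.some (!decide (z.2 = 0) &&
        (!query Y (Nat.pair z.2 mark) && query Y (Nat.pair z.2 (Nat.pair 1 mark)))) :=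
    (TotalFunctional.of_computable (computable_isZero Computable.snd)).not.and
      ((TotalFunctional.query_comp (computable_pair Computable.snd (Computable.const mark))).not.and
        (TotalFunctional.query_comp (computable_pair Computable.snd k1)))
  have h2 : Functional fun Y (z : ℕ × ℕ) => Part.some (query Y (Nat.pair z.1 (Nat.pair 1 mark)) ||
            query Y (Nat.pair z.1 (Nat.pair z.2 (Nat.pair 1 mark)))) :=
    TotalFunctional.or (TotalFunctional.query_comp (computable_pair Computable.fst k1))
      (TotalFunctional.query_comp (computable_pair Computable.fst
        (computable_pair Computable.snd k1)))
  have h3 := Functional.bind (Functional.rfind h1) h2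
  have h4 : Functional fun _ (_ : ℕ) => Part.some true :=
    TotalFunctional.of_computable (Computable.const true)
  have h5 : Functional fun _ (_ : ℕ) => Part.some false :=
    TotalFunctional.of_computable (Computable.const false)
  have h6 : TotalFunctional fun Y (_ : ℕ) => query Y (Nat.pair 1 mark) :=
    TotalFunctional.query_comp (Computable.const _)
  have h7 : TotalFunctional fun _ (i : ℕ) => decide (i = 0) :=
    TotalFunctional.of_computable (computable_isZero Computable.id)
  exact Functional.cond h7 h4 (Functional.cond h6 h5 h3)

open Presentation in
-- The search for the second element is reached only if index `1` is not additional. The segment is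
-- then not `{0}`, so a second element exists and the search terminates.
theorem present_jumpOn {A : Presentation} {C E : Set ℕ} (hE : A.IsSegment E) {i : ℕ}
    (h : i = 0 ∨ Nat.pair i mark ∉ A.jumpOn C E) :
    (i ∈ E ∧ present (A.jumpOn C E) i = Part.some true) ∨
      (i ∉ E ∧ present (A.jumpOn C E) i = Part.some false) := by
  by_cases h0 : i = 0
  · subst h0
    exact Or.inl ⟨hE.zero_mem, by simp [present]⟩
  replace h := h.resolve_left h0
  by_cases h1 : Nat.pair 1 mark ∈ A.jumpOn C E
  · refine Or.inr ⟨fun hi => ?_, by simp [present, h0, query_eq_true.2 h1]⟩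
    have := (hE.pair_one_mark_mem.1 h1).2 i hi h0
    exact A.lt_irrefl 0 (A.trans _ _ _ (A.zero_lt i (hE.subset hi) h0) this)
  · have ht : ∀ p, (!decide (p = 0) && (!query (A.jumpOn C E) (Nat.pair p mark) &&
        query (A.jumpOn C E) (Nat.pair p (Nat.pair 1 mark)))) = true ↔
          SecondTest (A.jumpOn C E) p := by
      intro p
      simp [SecondTest]
    obtain ⟨q, hq⟩ := hE.exists_secondTest h1
    have hd : (Nat.rfind fun p => Part.some (!decide (p = 0) &&
        (!query (A.jumpOn C E) (Nat.pair p mark) &&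
          query (A.jumpOn C E) (Nat.pair p (Nat.pair 1 mark))))).Dom :=
      Nat.rfind_dom.2 ⟨q, Part.mem_some_iff.2 ((ht q).2 hq).symm, fun _ => trivial⟩
    obtain ⟨p, hp⟩ := Part.dom_iff_mem.1 hd
    have hp' := (ht p).1 (Part.mem_some_iff.1 (Nat.rfind_spec hp)).symm
    have hpr : present (A.jumpOn C E) i =
        Part.some (query (A.jumpOn C E) (Nat.pair i (Nat.pair 1 mark)) ||
            query (A.jumpOn C E) (Nat.pair i (Nat.pair p (Nat.pair 1 mark)))) := by
      rw [present, decide_eq_false h0, cond_false, query_eq_false.2 h1, cond_false,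
        Part.eq_some_iff.2 hp, Part.bind_some]
    have hi := hE.mem_iff_of_secondTest hp' h0 h
    rw [hpr]
    by_cases hiE : i ∈ E
    · refine Or.inl ⟨hiE, ?_⟩
      rw [Bool.or_eq_true _ _ |>.mpr (by simpa only [query_eq_true] using hi.1 hiE)]
    · refine Or.inr ⟨hiE, ?_⟩
      have := not_or.1 fun h => hiE (hi.2 h)
      rw [query_eq_false.2 this.1, query_eq_false.2 this.2, Bool.or_self]

/-! ### The self-referential program. -/

/-- The parameters with which the jump held by the column with index `i` is approximated. -/
def jumpParams (c r i m : ℕ) : Params × ℕ := ((c, r, flag (i - 1), m), r + i + m + 4)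

/-- The body of the recursive definition of the approximating program. -/
def body (X : Set ℕ) (c r b n : ℕ) : Part ℕ :=
  bif decide (b = 0) then Part.some (encode (baseCells X r n)) else
    bif !decide (n.unpair.1 = 0) && query X (Nat.pair n.unpair.1 mark) then
      (jumpApprox (col X n.unpair.1) (jumpParams c r n.unpair.1 n.unpair.2)).map encode
    else (present X n.unpair.1).bind fun d =>
      bif d then
        turingEval c (col X n.unpair.1) (Nat.pair r (Nat.pair (flag n.unpair.1) n.unpair.2))
      else Part.some (encode ((1, []) : Cells))

theorem computable_jumpParams {α : Type*} [Primcodable α] {c r i m : α → ℕ} (hc : Computable c)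
    (hr : Computable r) (hi : Computable i) (hm : Computable m) :
    Computable fun a => jumpParams (c a) (r a) (i a) (m a) := by
  have hadd {f g : α → ℕ} (hf : Computable f) (hg : Computable g) :
    Computable fun a => f a + g a := Primrec.nat_add.to_comp.comp hf hg
  exact (hc.pair (hr.pair ((computable_flag.comp (Primrec.pred.to_comp.comp hi)).pair hm))).pair
    (hadd (hadd (hadd hr hi) hm) (Computable.const 4))

theorem functional_body : Functional fun X (z : ℕ × ℕ) =>
    body X z.1 z.2.unpair.1 z.2.unpair.2.unpair.1 z.2.unpair.2.unpair.2 := by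
  have u1 : Computable fun z : ℕ × ℕ => z.2.unpair := Computable.unpair.comp Computable.snd
  have u2 : Computable fun z : ℕ × ℕ => z.2.unpair.2.unpair :=
    Computable.unpair.comp (Computable.snd.comp u1)
  have u3 : Computable fun z : ℕ × ℕ => z.2.unpair.2.unpair.2.unpair :=
    Computable.unpair.comp (Computable.snd.comp u2)
  have hc : Computable fun z : ℕ × ℕ => z.1 := Computable.fst
  have hr : Computable fun z : ℕ × ℕ => z.2.unpair.1 := Computable.fst.comp u1
  have hb : Computable fun z : ℕ × ℕ => z.2.unpair.2.unpair.1 := Computable.fst.comp u2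
  have hn : Computable fun z : ℕ × ℕ => z.2.unpair.2.unpair.2 := Computable.snd.comp u2
  have hi : Computable fun z : ℕ × ℕ => z.2.unpair.2.unpair.2.unpair.1 := Computable.fst.comp u3
  have hm : Computable fun z : ℕ × ℕ => z.2.unpair.2.unpair.2.unpair.2 := Computable.snd.comp u3
  have hcol : Computable fun y : (ℕ × ℕ) × ℕ =>
      Nat.pair y.1.2.unpair.2.unpair.2.unpair.1 y.2 :=
    computable_pair (hi.comp Computable.fst) Computable.snd
  have b1 := TotalFunctional.of_computable (computable_isZero hb)
  have b2 := ((TotalFunctional.of_computable (computable_isZero hi)).not).and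
    (TotalFunctional.query_comp (computable_pair hi (Computable.const mark)))
  have f1 := TotalFunctional.map (baseCells_functional.comp (hr.pair hn))
    (Computable.encode.comp (Computable.snd (α := ℕ × ℕ) (β := Cells)))
  have f2 := Functional.map (Functional.pullback (functional_jumpApprox.comp
    (computable_jumpParams hc hr hi hm)) hcol)
    (Computable.encode.comp (Computable.snd (α := ℕ × ℕ) (β := Cells)))
  have f3 := functional_present.comp hi
  have f4 := Functional.turingEval hcol hc
    (computable_pair hr (computable_pair (computable_flag.comp hi) hm))
  have f5 : Functional fun _ (_ : (ℕ × ℕ) × Bool) => Part.some (encode ((1, []) : Cells)) :=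
    TotalFunctional.of_computable (Computable.const _)
  have f6 := Functional.cond (TotalFunctional.of_computable (Computable.snd (α := ℕ × ℕ)))
    (f4.comp Computable.fst) f5
  have f7 := Functional.cond b1 f1 (Functional.cond b2 f2 (Functional.bind f3 f6))
  exact f7

theorem exists_program : ∃ c, ∀ X r b n,
    turingEval c X (Nat.pair r (Nat.pair b n)) = body X c r b n := by
  obtain ⟨c, hc⟩ := functional_body.exists_fixed_point
  refine ⟨c, fun X r b n => ?_⟩
  rw [hc]
  simp only [Nat.unpair_pair]

/-- The approximating program. -/
def program : ℕ := exists_program.choose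

theorem turingEval_program (X : Set ℕ) (r b n : ℕ) :
    turingEval program X (Nat.pair r (Nat.pair b n)) = body X program r b n :=
  exists_program.choose_spec X r b n

theorem approx_program_zero (X : Set ℕ) (r n : ℕ) :
    approx program X r 0 n = Part.some (baseCells X r n) := by
  rw [approx, turingEval_program, body, decide_eq_true rfl, cond_true, Part.map_some,
    cellsOfNat_encode]

theorem approx_program_jump {X : Set ℕ} {r i m : ℕ} (hi : i ≠ 0) (h : Nat.pair i mark ∈ X) :
    approx program X r 1 (Nat.pair i m) = jumpApprox (col X i) (jumpParams program r i m) := by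
  rw [approx, turingEval_program, body, Nat.unpair_pair, decide_eq_false one_ne_zero, cond_false,
    decide_eq_false hi, query_eq_true.2 h, Bool.not_false, Bool.and_self, cond_true, Part.map_map]
  have : cellsOfNat ∘ encode = (id : Cells → Cells) := funext cellsOfNat_encode
  rw [this, Part.map_id']
  exact fun _ => rfl

theorem approx_program_present {X : Set ℕ} {r i m : ℕ} (h : i = 0 ∨ Nat.pair i mark ∉ X)
    (hp : present X i = Part.some true) :
    approx program X r 1 (Nat.pair i m) = approx program (col X i) r (flag i) m := by
  have hb : (!decide (i = 0) && query X (Nat.pair i mark)) = false := by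
    rw [Bool.and_eq_false_iff]
    exact h.imp (by simp) query_eq_false.2
  rw [approx, turingEval_program, body, Nat.unpair_pair, decide_eq_false one_ne_zero, cond_false,
    hb, cond_false, hp, Part.bind_some, cond_true, approx]

theorem approx_program_absent {X : Set ℕ} {r i m : ℕ} (h : i = 0 ∨ Nat.pair i mark ∉ X)
    (hp : present X i = Part.some false) :
    approx program X r 1 (Nat.pair i m) = Part.some (1, []) := by
  have hb : (!decide (i = 0) && query X (Nat.pair i mark)) = false := by
    rw [Bool.and_eq_false_iff]
    exact h.imp (by simp) query_eq_false.2
  rw [approx, turingEval_program, body, Nat.unpair_pair, decide_eq_false one_ne_zero, cond_false,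
    hb, cond_false, hp, Part.bind_some, cond_false, Part.map_some, cellsOfNat_encode]

/-! ### Correctness of the approximation -/

/-- The set outside which the approximation is correct. -/
def exceptional (r : ℕ) (S : Set ℕ) (A : Presentation) : Set ℝ :=
  (⋃ q, intervalOf (cutInterval r q)) ∪ ⋃ j ∈ A.dom, ⋃ m,
    lateSet (turingJump (A.column S j)) (jumpParams program r (A.succIndex j) m)

/-- The program approximates the sets `W x` outside `U` from the oracle `Y`. -/
def Approximates (r b : ℕ) (Y : Set ℕ) (W : ℝ → Set ℕ) (U : Set ℝ) : Prop :=
  ∃ f : ℕ → Cells, (∀ n, approx program Y r b n = Part.some (f n)) ∧ (∀ n, 0 < (f n).1) ∧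
    ∀ x ∈ Set.Ico (0 : ℝ) 1, x ∉ U → ∀ n, (f n).Mem x ↔ n ∈ W x

/-- The additional index belonging to `j` is `1` exactly if `j = 0`. Read off the index, the flag
thus tells whether the set whose jump is held is the base set or itself a jump along a presentation.
-/
theorem flag_succIndex (A : Presentation) (j : ℕ) : flag (A.succIndex j - 1) = flag j := by
  by_cases h : j = 0
  · subst h
    rw [A.succIndex_zero]
  · have := (A.succIndex_spec j).1
    rw [flag_of_ne_zero h, flag_of_ne_zero (by omega)]

open Presentation

/-- A column of the segment is handed to the recursive call, an additional column is treated by the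
jump step, and any other column is empty. The exceptional set is the same for all columns, so no
error is counted again at higher levels. -/
theorem approximates_jumpOn {r : ℕ} {S : Set ℕ} {A : Presentation} {E : Set ℕ}
    (hE : A.IsSegment E) (h : ∀ i ∈ E, Approximates r (flag i) (A.column S i)
      (fun x => A.column (withCut S x) i) (exceptional r S A)) :
    Approximates r 1 (A.jumpOn S E) (fun x => A.jumpOn (withCut S x) E) (exceptional r S A) := by
  suffices h' : ∀ n, ∃ v : Cells, approx program (A.jumpOn S E) r 1 n = Part.some v ∧ 0 < v.1 ∧
      ∀ x ∈ Set.Ico (0 : ℝ) 1, x ∉ exceptional r S A →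
        (v.Mem x ↔ n ∈ A.jumpOn (withCut S x) E) by
    choose f h1 h2 h3 using h'
    exact ⟨f, h1, h2, fun x hx hxU n => h3 n x hx hxU⟩
  intro n
  obtain ⟨i, m, rfl⟩ : ∃ i m, n = Nat.pair i m := ⟨_, _, (Nat.pair_unpair n).symm⟩
  by_cases hi : i ≠ 0 ∧ Nat.pair i mark ∈ A.jumpOn S E
  · obtain ⟨hi0, hi⟩ := hi
    obtain ⟨j, hj, rfl⟩ := (hE.pair_mark_mem hi0).1 hi
    obtain ⟨f, h1, h2, h3⟩ := h j hj.1
    have h1' : ∀ n, approx (jumpParams program r (A.succIndex j) m).1.1 (A.column S j)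
        (jumpParams program r (A.succIndex j) m).1.2.1
        (jumpParams program r (A.succIndex j) m).1.2.2.1 n = Part.some (f n) := by
      intro n
      simp only [jumpParams, flag_succIndex]
      exact h1 n
    obtain ⟨s, hs, hs'⟩ := exists_stageSearch_eq
      (N := (jumpParams program r (A.succIndex j) m).2) h1' h2
    refine ⟨haltStage f m s, ?_, haltStage_fst_pos h2 s, fun x hx hxU => ?_⟩
    · rw [approx_program_jump hi0 hi, hE.col_succIndex hj]
      exact jumpApprox_eq h1' hs
    · have hl : x ∉ lateCover f m s := by
        intro hl
        refine hxU (Or.inr (Set.mem_iUnion₂.2 ⟨j, hE.subset hj.1, Set.mem_iUnion.2 ⟨m, ?_⟩⟩))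
        have := lateSet_eq h1' h2 hs
        rw [Prod.mk.eta] at this
        rw [this]
        exact hl
      rw [← haltStage_mem_of_notMem_lateCover h2 hx hl,
        exists_haltStage_mem_iff h2 hx (h3 x hx hxU), ← mem_col, hE.col_succIndex hj]
  · have hi' : i = 0 ∨ Nat.pair i mark ∉ A.jumpOn S E := by
      by_cases h0 : i = 0
      · exact Or.inl h0
      · exact Or.inr fun hm => hi ⟨h0, hm⟩
    rcases present_jumpOn hE hi' with ⟨hiE, hp⟩ | ⟨hiE, hp⟩
    · obtain ⟨f, h1, h2, h3⟩ := h i hiE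
      refine ⟨f m, ?_, h2 m, fun x hx hxU => ?_⟩
      · rw [approx_program_present hi' hp, hE.col_of_mem hiE, h1]
      · rw [h3 x hx hxU, ← mem_col, hE.col_of_mem hiE]
    · refine ⟨(1, []), approx_program_absent hi' hp, one_pos, fun x hx hxU => ?_⟩
      rw [← mem_col, hE.col_eq_empty hiE]
      · simp [Cells.Mem]
      · rintro j hj rfl
        have hi0 : A.succIndex j ≠ 0 := fun h0 => hiE (h0 ▸ hE.zero_mem)
        exact hi ⟨hi0, (hE.pair_mark_mem hi0).2 ⟨j, hj, rfl⟩⟩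

/-- Every self-call of the program goes to a `≺`-smaller column, so well-founded induction proves
convergence and correctness together. Limits need no separate case. -/
theorem approximates_column (r : ℕ) (S : Set ℕ) (A : Presentation) (k : ℕ) (hk : k ∈ A.dom) :
    Approximates r (flag k) (A.column S k) (fun x => A.column (withCut S x) k)
      (exceptional r S A) := by
  induction k using A.wf.induction with
  | h k ih =>
    by_cases h0 : k = 0
    · subst h0
      simp only [column_zero]
      refine ⟨baseCells S r, approx_program_zero S r, baseCells_fst_pos S r,
        fun x hx hxU n => baseCells_mem_iff hx fun q hq => hxU (Or.inl ?_)⟩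
      exact Set.mem_iUnion.2 ⟨q, hq⟩
    · rw [flag_of_ne_zero h0]
      simp only [A.column_eq_jumpOn _ h0]
      exact approximates_jumpOn (A.isSegment_below hk h0) fun i hi =>
        ih i hi (A.mem_of_lt i k hi).1

theorem approximates_jump (r : ℕ) (S : Set ℕ) (A : Presentation) :
    Approximates r 1 (A.jump S) (fun x => A.jump (withCut S x)) (exceptional r S A) :=
  approximates_jumpOn A.isSegment_dom (approximates_column r S A)

end Recursion

open MeasureTheory Presentation

/-! ### The measure of the exceptional set -/

section Measure

theorem ofReal_half_pow (n : ℕ) : ENNReal.ofReal ((1 / 2) ^ n) = 2⁻¹ ^ n := by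
  rw [ENNReal.ofReal_pow (by norm_num), one_div, ENNReal.ofReal_inv_of_pos two_pos]
  norm_num

theorem ofReal_two_mul_half_pow (n : ℕ) : ENNReal.ofReal (2 * (1 / 2) ^ n) = 2 * 2⁻¹ ^ n := by
  rw [ENNReal.ofReal_mul zero_le_two, ofReal_half_pow]
  norm_num

theorem volume_intervalOf_cutInterval (r q : ℕ) :
    volume (intervalOf (cutInterval r q)) = 2 * 2⁻¹ ^ (r + 4) * 2⁻¹ ^ q := by
  rw [intervalOf_cutInterval, Real.volume_Ioo, mul_assoc, ← pow_add,
    ← ofReal_two_mul_half_pow, cutMesh]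
  congr 1
  push_cast
  rw [one_div_pow]
  ring_nf

/-- The cover has measure at most `2 · 2^{-(r+i+m+4)}`, and the additional index satisfies `i ≥ j +
1`, which absorbs the factor 2. -/
theorem volume_lateSet_le (r : ℕ) (S : Set ℕ) (A : Presentation) {j : ℕ} (hj : j ∈ A.dom)
    (m : ℕ) : volume (lateSet (turingJump (A.column S j))
      (jumpParams program r (A.succIndex j) m)) ≤ 2⁻¹ ^ (r + 4) * 2⁻¹ ^ j * 2⁻¹ ^ m := by
  obtain ⟨f, h1, h2, -⟩ := approximates_column r S A j hj
  have h1' : ∀ n, approx (jumpParams program r (A.succIndex j) m).1.1 (A.column S j)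
      (jumpParams program r (A.succIndex j) m).1.2.1
      (jumpParams program r (A.succIndex j) m).1.2.2.1 n = Part.some (f n) := by
    intro n
    simp only [jumpParams, flag_succIndex]
    exact h1 n
  obtain ⟨s, hs, hs'⟩ := exists_stageSearch_eq
    (N := (jumpParams program r (A.succIndex j) m).2) h1' h2
  have h3 := lateSet_eq h1' h2 hs
  rw [Prod.mk.eta] at h3
  rw [h3]
  refine (volume_lateCover_le h2 hs').trans ?_
  have h4 : (1 / 2 : ℝ) ^ (jumpParams program r (A.succIndex j) m).2 ≤
      (1 / 2) ^ (1 + (r + 4) + j + m) := by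
    refine pow_le_pow_of_le_one (by norm_num) (by norm_num) ?_
    have := (A.succIndex_spec j).1
    simp only [jumpParams]
    omega
  calc ENNReal.ofReal (2 * (1 / 2) ^ (jumpParams program r (A.succIndex j) m).2)
      ≤ ENNReal.ofReal ((1 / 2) ^ ((r + 4) + j + m)) := by
        apply ENNReal.ofReal_le_ofReal
        refine (mul_le_mul_of_nonneg_left h4 zero_le_two).trans_eq ?_
        rw [add_assoc 1, add_assoc 1, pow_add _ 1]
        ring
    _ = _ := by rw [ofReal_half_pow, pow_add, pow_add]

/-- The cuts contribute a geometric series in `q` and the jumps a double one in `j` and `m`, each at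
most `4 · 2^{-(r+4)}`. -/
theorem volume_exceptional_le (r : ℕ) (S : Set ℕ) (A : Presentation) :
    volume (exceptional r S A) ≤ 8 * 2⁻¹ ^ (r + 4) := by
  have h1 : volume (⋃ q, intervalOf (cutInterval r q)) ≤ 4 * 2⁻¹ ^ (r + 4) := by
    refine (measure_iUnion_le _).trans_eq ?_
    simp only [volume_intervalOf_cutInterval]
    rw [ENNReal.tsum_mul_left, ENNReal.tsum_geometric_two]
    ring
  have h2 : ∀ j, volume (⋃ (_ : j ∈ A.dom), ⋃ m, lateSet (turingJump (A.column S j))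
      (jumpParams program r (A.succIndex j) m)) ≤ 2 * 2⁻¹ ^ (r + 4) * 2⁻¹ ^ j := by
    intro j
    by_cases hj : j ∈ A.dom
    · simp only [hj, Set.iUnion_true]
      refine (measure_iUnion_le _).trans
        ((ENNReal.tsum_le_tsum fun m => volume_lateSet_le r S A hj m).trans_eq ?_)
      rw [ENNReal.tsum_mul_left, ENNReal.tsum_geometric_two]
      ring
    · simp [hj]
  have h3 : volume (⋃ j ∈ A.dom, ⋃ m, lateSet (turingJump (A.column S j))
      (jumpParams program r (A.succIndex j) m)) ≤ 4 * 2⁻¹ ^ (r + 4) := by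
    refine (measure_iUnion_le _).trans ((ENNReal.tsum_le_tsum h2).trans_eq ?_)
    rw [ENNReal.tsum_mul_left, ENNReal.tsum_geometric_two]
    ring
  refine (measure_union_le _ _).trans ((add_le_add h1 h3).trans_eq ?_)
  rw [← add_mul]
  norm_num

/-- The accuracy used for a given rational. -/
def accuracy (ε : ℚ) : ℕ := ⌊ε⁻¹⌋₊

theorem computable_accuracy : Computable fun m => accuracy (ratOfNat m) := by
  obtain ⟨hA, hB, hC⟩ := primrec_cut_data
  -- For `ε = (a - b) / (c + 1)` the floor is the natural quotient of `c + 1` by `a - b`. If `a ≤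
  -- b`, truncated subtraction and division by zero give `0`, which is also the floor of a
  -- nonpositive number.
  refine (Primrec.nat_div.comp hC (Primrec.nat_sub.comp hA hB)).to_comp.of_eq fun m => ?_
  rw [accuracy, ratOfNat, inv_div]
  rcases le_total m.unpair.1.unpair.1 m.unpair.1.unpair.2 with h | h
  · rw [Nat.sub_eq_zero_of_le h, Nat.div_zero, eq_comm, Nat.floor_eq_zero]
    refine lt_of_le_of_lt (div_nonpos_of_nonneg_of_nonpos (by positivity) ?_) one_pos
    exact sub_nonpos.2 (Nat.cast_le.2 h)
  · rw [← Nat.cast_sub h, ← Nat.cast_succ, Nat.floor_div_eq_div]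

/-- The bound `8 · 2^{-(r+4)}` is half of `2^{-r}`, and `2^r ≥ r + 1 > 1/ε`. -/
theorem volume_exceptional_lt {ε : ℚ} (hε : 0 < ε) (S : Set ℕ) (A : Presentation) :
    volume (exceptional (accuracy ε) S A) < ENNReal.ofReal (ε : ℝ) := by
  refine (volume_exceptional_le _ S A).trans_lt ?_
  set r := accuracy ε with hr
  have h1 : (8 * 2⁻¹ ^ (r + 4) : ENNReal) = ENNReal.ofReal (8 * (1 / 2) ^ (r + 4)) := by
    rw [ENNReal.ofReal_mul (by norm_num), ofReal_half_pow]
    norm_num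
  have hε' : (0 : ℝ) < ε := Rat.cast_pos.2 hε
  rw [h1, ENNReal.ofReal_lt_ofReal_iff hε']
  have h2 : (ε : ℝ)⁻¹ < r + 1 := by
    have := Nat.lt_floor_add_one (ε⁻¹)
    exact_mod_cast this
  have h3 : (r : ℝ) + 1 ≤ 2 ^ r := by
    have := Nat.lt_two_pow_self (n := r)
    exact_mod_cast this
  have h4 : (1 / 2 : ℝ) ^ r < ε := by
    rw [one_div, inv_pow]
    exact inv_lt_of_inv_lt₀ hε' (h2.trans_le h3)
  have h5 : (0 : ℝ) < (1 / 2) ^ r := by positivity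
  rw [pow_add]
  nlinarith

end Measure

/-! ### Enumerating the exceptional set -/

section Enumeration

/-- A source of intervals and a witness. -/
abbrev Witness : Type := ℕ × ℕ × ℕ × ℕ × ℕ × ℕ

/-- Enumerates the intervals covering the exceptional set from the jump along a presentation. -/
def enumInterval (X : Set ℕ) (r : ℕ) (w : Witness) : Part ℕ :=
  bif decide (w.1 = 0) then Part.some (cutInterval r w.2.2.1) else
    bif decide (w.2.2.1 = 0) then Part.none else
      bif decide (w.2.1 = 0) then
        bif query X (Nat.pair w.2.2.1 mark) then
          lateInterval (col X w.2.2.1) (jumpParams program r w.2.2.1 w.2.2.2.1, w.2.2.2.2)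
        else Part.none
      else
        bif !query X (Nat.pair w.2.1 mark) && query X (Nat.pair w.2.1 (Nat.pair w.2.2.1 mark)) then
          lateInterval (col (col X w.2.1) w.2.2.1)
            (jumpParams program r w.2.2.1 w.2.2.2.1, w.2.2.2.2)
        else Part.none

theorem functional_enumInterval :
    Functional fun X (z : ℕ × Witness) => enumInterval X z.1 z.2 := by
  have hr : Computable fun z : ℕ × Witness => z.1 := Computable.fst
  have p0 : Computable fun z : ℕ × Witness => z.2 := Computable.snd
  have ht : Computable fun z : ℕ × Witness => z.2.1 := Computable.fst.comp p0
  have p1 : Computable fun z : ℕ × Witness => z.2.2 := Computable.snd.comp p0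
  have hk : Computable fun z : ℕ × Witness => z.2.2.1 := Computable.fst.comp p1
  have p2 : Computable fun z : ℕ × Witness => z.2.2.2 := Computable.snd.comp p1
  have hi : Computable fun z : ℕ × Witness => z.2.2.2.1 := Computable.fst.comp p2
  have p3 : Computable fun z : ℕ × Witness => z.2.2.2.2 := Computable.snd.comp p2
  have hm : Computable fun z : ℕ × Witness => z.2.2.2.2.1 := Computable.fst.comp p3
  have hy : Computable fun z : ℕ × Witness => z.2.2.2.2.2 := Computable.snd.comp p3
  have hq := (computable_jumpParams (Computable.const program) hr hi hm).pair hy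
  have c1 : Computable fun y : (ℕ × Witness) × ℕ => Nat.pair y.1.2.2.2.1 y.2 :=
    computable_pair (hi.comp Computable.fst) Computable.snd
  have c2 : Computable fun y : (ℕ × Witness) × ℕ =>
      Nat.pair y.1.2.2.1 (Nat.pair y.1.2.2.2.1 y.2) :=
    computable_pair (hk.comp Computable.fst) c1
  have hmark : Computable fun _ : ℕ × Witness => mark := Computable.const mark
  have hz {f : ℕ × Witness → ℕ} (hf : Computable f) :
    TotalFunctional fun _ z => decide (f z = 0) :=
    TotalFunctional.of_computable (computable_isZero hf)
  have hcut : Computable fun z : ℕ × Witness => cutInterval z.1 z.2.2.2.1 := by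
    have := primrec_cells_and_interval.2.2.to_comp.comp (hr.pair hi)
    exact this
  have fn : Functional fun _ (_ : ℕ × Witness) => (Part.none : Part ℕ) :=
    Functional.of_partrec Partrec.none
  have l := functional_lateInterval.comp hq
  have l1 := Functional.cond (TotalFunctional.query_comp (computable_pair hi hmark))
    (Functional.pullback l c1) fn
  have l2 := Functional.cond ((TotalFunctional.query_comp (computable_pair hk hmark)).not.and
    (TotalFunctional.query_comp (computable_pair hk (computable_pair hi hmark))))
    (Functional.pullback l c2) fn
  have l3 := Functional.cond (hz ht) (TotalFunctional.of_computable hcut)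
    (Functional.cond (hz hi) fn (Functional.cond (hz hk) l1 l2))
  exact l3

theorem exists_enumIndex : ∃ g : ℕ → ℕ, Computable g ∧ ∀ r X n,
    (turingEval (g r) X n).Dom ↔ ∃ w, n ∈ enumInterval X r w := by
  have hd : Functional fun _ (z : ℕ × ℕ) => Part.ofOption (decode (α := Witness) z.2) :=
    Functional.of_partrec (Computable.ofOption (Computable.decode.comp Computable.snd))
  have hc : Computable fun y : (ℕ × ℕ) × Witness => (y.1.1, y.2) :=
    (Computable.fst.comp Computable.fst).pair Computable.snd
  obtain ⟨g, hg, hg'⟩ := (Functional.bind hd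
    (functional_enumInterval.comp hc)).exists_computable_range
  refine ⟨g, hg, fun r X n => (hg' r X n).trans ?_⟩
  simp only [Part.mem_bind_iff, Part.mem_ofOption]
  constructor
  · rintro ⟨w, y, -, h⟩
    exact ⟨y, h⟩
  · rintro ⟨y, h⟩
    exact ⟨encode y, y, encodek y, h⟩

/-- The program enumerating a cover of the exceptional set. -/
def enumIndex : ℕ → ℕ := exists_enumIndex.choose

theorem computable_enumIndex : Computable enumIndex := exists_enumIndex.choose_spec.1

theorem mem_ceUnion_iff {e : ℕ} {X : Set ℕ} {x : ℝ} :
    x ∈ ceUnion e X ↔ ∃ k, (turingEval e X k).Dom ∧ x ∈ intervalOf k := by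
  simp only [ceUnion, Set.mem_iUnion, exists_prop]
  rfl

/-- If `j` is the top of the domain, the jump of column `j` is the additional column of `S^(A)`.
Otherwise `j` is the top of `B_k` for its immediate successor `k`, and the jump is the additional
column of column `k`. Conversely, the queries about `mark` certify that the column used really is
such a jump, so no foreign interval is enumerated. Index `0` is excluded because `S` is arbitrary.
-/
theorem ceUnion_enumIndex (r : ℕ) (S : Set ℕ) (A : Presentation) :
    ceUnion (enumIndex r) (A.jump S) = exceptional r S A := by
  have hD := A.isSegment_dom
  have hlate : ∀ {j m k y x}, j ∈ A.dom →
      k ∈ lateInterval (turingJump (A.column S j)) (jumpParams program r (A.succIndex j) m, y) →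
        x ∈ intervalOf k → x ∈ exceptional r S A := by
    intro j m k y x hj hk hx
    refine Or.inr (Set.mem_iUnion₂.2 ⟨j, hj, Set.mem_iUnion.2 ⟨m, ?_⟩⟩)
    exact Set.mem_iUnion₂.2 ⟨k, ⟨y, hk⟩, hx⟩
  ext x
  have hg : ∀ k, (turingEval (enumIndex r) (A.jump S) k).Dom ↔
      ∃ w, k ∈ enumInterval (A.jumpOn S A.dom) r w :=
    exists_enumIndex.choose_spec.2 r (A.jump S)
  rw [mem_ceUnion_iff]
  simp only [hg]
  constructor
  · rintro ⟨n, ⟨⟨t, k, i, m, y⟩, hw⟩, hx⟩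
    rw [enumInterval] at hw
    by_cases ht : t = 0
    · simp only [ht, decide_true, cond_true, Part.mem_some_iff] at hw
      subst hw
      exact Or.inl (Set.mem_iUnion.2 ⟨i, hx⟩)
    by_cases hi : i = 0
    · simp [ht, hi, Part.notMem_none] at hw
    by_cases hk : k = 0
    · by_cases hq : Nat.pair i mark ∈ A.jumpOn S A.dom
      · obtain ⟨j, hj, rfl⟩ := (hD.pair_mark_mem hi).1 hq
        simp only [ht, hi, hk, query_eq_true.2 hq, hD.col_succIndex hj, decide_true, decide_false,
          cond_true, cond_false] at hw
        exact hlate hj.1 hw hx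
      · simp [ht, hi, hk, query_eq_false.2 hq, Part.notMem_none] at hw
    · by_cases hq : Nat.pair k mark ∉ A.jumpOn S A.dom ∧
        Nat.pair k (Nat.pair i mark) ∈ A.jumpOn S A.dom
      · have hkD : k ∈ A.dom := by
          rcases hD.pair_mem_jumpOn.1 hq.2 with h | ⟨j, hj, h, -⟩
          · exact h.1
          · exact absurd ((hD.pair_mark_mem hk).2 ⟨j, hj, h⟩) hq.1
        have hB := A.isSegment_below hkD hk
        have hcol : col (A.jumpOn S A.dom) k = A.jumpOn S {i | A.lt i k} := by
          rw [hD.col_of_mem hkD, A.column_eq_jumpOn S hk]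
        have hq2 := hq.2
        rw [← mem_col, hcol] at hq2
        obtain ⟨j, hj, rfl⟩ := (hB.pair_mark_mem hi).1 hq2
        simp only [ht, hi, hk, query_eq_false.2 hq.1, query_eq_true.2 hq.2, hcol,
          hB.col_succIndex hj, decide_false, cond_true, cond_false, Bool.not_false,
          Bool.and_self] at hw
        exact hlate (hB.subset hj.1) hw hx
      · have hq' : (!query (A.jumpOn S A.dom) (Nat.pair k mark) &&
            query (A.jumpOn S A.dom) (Nat.pair k (Nat.pair i mark))) = false := by
          rw [← Bool.not_eq_true]
          intro h
          rw [Bool.and_eq_true, Bool.not_eq_true', query_eq_false, query_eq_true] at h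
          exact hq h
        simp only [ht, hi, hk, hq', decide_false, cond_false] at hw
        exact absurd hw (Part.notMem_none _)
  · rintro (hx | hx)
    · obtain ⟨q, hq⟩ := Set.mem_iUnion.1 hx
      refine ⟨_, ⟨(0, 0, q, 0, 0, 0), ?_⟩, hq⟩
      simp [enumInterval]
    · obtain ⟨j, hjD, hx⟩ := Set.mem_iUnion₂.1 hx
      obtain ⟨m, hx⟩ := Set.mem_iUnion.1 hx
      obtain ⟨n, ⟨y, hn⟩, hx⟩ := Set.mem_iUnion₂.1 hx
      have hi : A.succIndex j ≠ 0 := Nat.ne_zero_of_lt (A.succIndex_spec j).1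
      by_cases hj : A.IsTop A.dom j
      · refine ⟨n, ⟨(1, 0, A.succIndex j, m, y), ?_⟩, hx⟩
        have hq := (hD.pair_mark_mem (C := S) hi).2 ⟨j, hj, rfl⟩
        simp only [enumInterval, hi, query_eq_true.2 hq, hD.col_succIndex hj, decide_true,
          decide_false, cond_true, cond_false, one_ne_zero]
        exact hn
      · have hne : {k | A.lt j k}.Nonempty := by
          by_contra hem
          refine hj ⟨hjD, fun i hiD hij => ?_⟩
          rcases A.trichotomy i hiD j hjD with h | h | h
          · exact h
          · exact absurd h hij
          · exact absurd ⟨i, h⟩ hem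
        -- The immediate successor of `j`.
        set k := A.wf.min _ hne with hk
        have hjk : A.lt j k := A.wf.min_mem _ hne
        have hkD : k ∈ A.dom := (A.mem_of_lt j k hjk).2
        have hk0 : k ≠ 0 := by
          intro h0
          rw [h0] at hjk
          by_cases hj0 : j = 0
          · exact A.lt_irrefl 0 (hj0 ▸ hjk)
          · exact A.lt_irrefl 0 (A.trans _ _ _ (A.zero_lt j hjD hj0) hjk)
        have hB := A.isSegment_below hkD hk0
        have htop : A.IsTop {i | A.lt i k} j := by
          refine ⟨hjk, fun i hik hij => ?_⟩
          rcases A.trichotomy i (A.mem_of_lt i k hik).1 j hjD with h | h | h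
          · exact h
          · exact absurd h hij
          · exact absurd hik (A.wf.not_lt_min {k | A.lt j k} h)
        have hcol : col (A.jumpOn S A.dom) k = A.jumpOn S {i | A.lt i k} := by
          rw [hD.col_of_mem hkD, A.column_eq_jumpOn S hk0]
        have hq1 : Nat.pair k mark ∉ A.jumpOn S A.dom := by
          intro h
          obtain ⟨l, hl, h⟩ := (hD.pair_mark_mem hk0).1 h
          exact hl.succIndex_notMem (h ▸ hkD)
        have hq2 : Nat.pair k (Nat.pair (A.succIndex j) mark) ∈ A.jumpOn S A.dom := by
          rw [← mem_col, hcol]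
          exact (hB.pair_mark_mem hi).2 ⟨j, htop, rfl⟩
        refine ⟨n, ⟨(1, k, A.succIndex j, m, y), ?_⟩, hx⟩
        simp only [enumInterval, hi, hk0, query_eq_false.2 hq1, query_eq_true.2 hq2, hcol,
          hB.col_succIndex htop, decide_false, cond_true, cond_false, one_ne_zero, Bool.not_false,
          Bool.and_self]
        exact hn

end Enumeration

/-! ### The functional computing the jump along a presentation -/

section Main

theorem TotalFunctional.any {α : Type*} [Primcodable α] {f : Set ℕ → α × ℕ → Bool}
    (hf : TotalFunctional f) {g : α → ℕ} (hg : Computable g) :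
    TotalFunctional fun X a => (List.range (g a)).any fun i => f X (a, i) := by
  have h1 : Computable fun l : List Bool => l.any id := by
    have h := (PrimrecPred.exists_mem_list (p := fun b : Bool => b = true)
      (Primrec.eq.comp Primrec.id (Primrec.const true)))
    refine h.decide.to_comp.of_eq fun l => ?_
    rw [Bool.eq_iff_iff, decide_eq_true_iff, List.any_eq_true]
    rfl
  have h2 := TotalFunctional.map ((TotalFunctional.list hf).comp (Computable.id.pair hg))
    (h1.comp (Computable.snd (α := α)))
  refine Functional.of_eq h2 fun X a => ?_
  simp only [List.any_map]
  rfl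

/-! ### Reading a real off its cuts. -/

/-- The first part of an oracle with a cut. -/
def leftPart (O : Set ℕ) : Set ℕ := {a | 2 * a ∈ O}

theorem leftPart_withCut (X : Set ℕ) (x : ℝ) : leftPart (withCut X x) = X :=
  Set.ext fun _ => mem_join_even

/-- Whether the real given by the oracle exceeds the rational with the given code. -/
def aboveTest (O : Set ℕ) (q : ℕ) : Bool := query O (2 * (2 * q) + 1)

/-- Whether the real given by the oracle is smaller than the rational with the given code. -/
def belowTest (O : Set ℕ) (q : ℕ) : Bool := query O (2 * (2 * q + 1) + 1)

theorem aboveTest_withCut {X : Set ℕ} {x : ℝ} {q : ℕ} :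
    aboveTest (withCut X x) q = true ↔ (ratOfNat q : ℝ) < x := by
  rw [aboveTest, query_eq_true, withCut, mem_join_odd, mem_join_even]
  rfl

theorem belowTest_withCut {X : Set ℕ} {x : ℝ} {q : ℕ} :
    belowTest (withCut X x) q = true ↔ x < (ratOfNat q : ℝ) := by
  rw [belowTest, query_eq_true, withCut, mem_join_odd, mem_join_odd]
  rfl

theorem computable_double : Computable fun n : ℕ => 2 * n :=
  (Primrec.nat_mul.comp (Primrec.const 2) Primrec.id).to_comp

theorem functional_aboveTest : TotalFunctional aboveTest :=
  TotalFunctional.query_comp (Computable.succ.comp (computable_double.comp computable_double))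

theorem functional_belowTest : TotalFunctional belowTest :=
  TotalFunctional.query_comp (Computable.succ.comp (computable_double.comp
    (Computable.succ.comp computable_double)))

/-- Whether the real given by the oracle is found in the exceptional set by trial `z`. -/
def hitAt (O : Set ℕ) (r z : ℕ) : Bool :=
  (trial (enumIndex r) (initSeg (leftPart O)) z.unpair.1 z.unpair.2).isSome &&
    (aboveTest O z.unpair.1.unpair.1 && belowTest O z.unpair.1.unpair.2)

/-- Whether the real given by the oracle is found in the exceptional set by one of the first
trials. -/
def hitBefore (O : Set ℕ) (r n : ℕ) : Bool := (List.range n).any fun z => hitAt O r z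

theorem functional_hitBefore : TotalFunctional fun O (p : ℕ × ℕ) => hitBefore O p.1 p.2 := by
  have hu : Computable fun z : (ℕ × ℕ) × ℕ => z.2.unpair :=
    Computable.unpair.comp Computable.snd
  have hc : Computable fun z : (ℕ × ℕ) × ℕ => z.2.unpair.1 := Computable.fst.comp hu
  have hs : Computable fun z : (ℕ × ℕ) × ℕ => z.2.unpair.2 := Computable.snd.comp hu
  have hr : Computable fun z : (ℕ × ℕ) × ℕ => enumIndex z.1.1 :=
    computable_enumIndex.comp (Computable.fst.comp Computable.fst)
  have hh : Computable fun y : ((ℕ × ℕ) × ℕ) × ℕ => 2 * y.2 :=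
    computable_double.comp Computable.snd
  have huc : Computable fun z : (ℕ × ℕ) × ℕ => z.2.unpair.1.unpair := Computable.unpair.comp hc
  have h1 := TotalFunctional.map (TotalFunctional.trial_pullback hh hr hc hs)
    (Primrec.option_isSome.to_comp.comp (Computable.snd (α := (ℕ × ℕ) × ℕ)))
  have h2 := functional_aboveTest.comp (Computable.fst.comp huc)
  have h3 := functional_belowTest.comp (Computable.snd.comp huc)
  have h4 : TotalFunctional fun O (z : (ℕ × ℕ) × ℕ) => hitAt O z.1.1 z.2 :=
    TotalFunctional.and h1 (TotalFunctional.and h2 h3)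
  exact TotalFunctional.any h4 Computable.snd

theorem hitAt_withCut {X : Set ℕ} {x : ℝ} {r z : ℕ} : hitAt (withCut X x) r z = true ↔
    (trial (enumIndex r) (initSeg X) z.unpair.1 z.unpair.2).isSome ∧
      x ∈ intervalOf z.unpair.1 := by
  rw [hitAt, leftPart_withCut, Bool.and_eq_true, Bool.and_eq_true, aboveTest_withCut,
    belowTest_withCut]
  rfl

theorem exists_hitAt_iff {X : Set ℕ} {x : ℝ} {r : ℕ} :
    (∃ z, hitAt (withCut X x) r z = true) ↔ x ∈ ceUnion (enumIndex r) X := by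
  simp only [hitAt_withCut, mem_ceUnion_iff]
  constructor
  · rintro ⟨z, h, hx⟩
    exact ⟨_, Nat.rfindOpt_dom.2 ⟨_, Option.isSome_iff_exists.1 h⟩, hx⟩
  · rintro ⟨k, h, hx⟩
    obtain ⟨s, hs⟩ := Nat.rfindOpt_dom.1 h
    refine ⟨Nat.pair k s, ?_⟩
    rw [Nat.unpair_pair]
    exact ⟨Option.isSome_iff_exists.2 hs, hx⟩

/-- Whether the real given by the oracle lies in a union of cells. -/
def cellTest (O : Set ℕ) (v : Cells) : Bool :=
  (List.range v.2.length).any fun k =>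
    !belowTest O (ratCode (v.2.getD k 0) 0 v.1) && belowTest O (ratCode (v.2.getD k 0 + 1) 0 v.1)

theorem functional_cellTest : TotalFunctional cellTest := by
  have hL : Computable fun z : Cells × ℕ => z.1.2.getD z.2 0 :=
    (Primrec.list_getD 0).to_comp.comp (Computable.snd.comp Computable.fst) Computable.snd
  have hM : Computable fun z : Cells × ℕ => z.1.1 := Computable.fst.comp Computable.fst
  have c1 := primrec_ratCode.to_comp.comp (hL.pair ((Computable.const 0).pair hM))
  have c2 := primrec_ratCode.to_comp.comp ((Computable.succ.comp hL).pair
    ((Computable.const 0).pair hM))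
  have b1 : TotalFunctional fun O (z : Cells × ℕ) =>
      belowTest O (ratCode (z.1.2.getD z.2 0) 0 z.1.1) := functional_belowTest.comp c1
  have b2 : TotalFunctional fun O (z : Cells × ℕ) =>
      belowTest O (ratCode (z.1.2.getD z.2 0 + 1) 0 z.1.1) := functional_belowTest.comp c2
  have h := TotalFunctional.and (TotalFunctional.not b1) b2
  have hl : Computable fun v : Cells => v.2.length := Computable.list_length.comp Computable.snd
  exact TotalFunctional.any h hl

/-- `a / M ≤ x` is the negation of `x < a / M`, so the right cut alone decides both ends of a
half-open cell. -/
theorem cellTest_withCut {X : Set ℕ} {x : ℝ} (hx : x ∈ Set.Ico (0 : ℝ) 1) {v : Cells}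
    (hv : 0 < v.1) : cellTest (withCut X x) v = true ↔ v.Mem x := by
  have hM : (0 : ℝ) < v.1 := Nat.cast_pos.2 hv
  have key : ∀ a, (!belowTest (withCut X x) (ratCode a 0 v.1) &&
      belowTest (withCut X x) (ratCode (a + 1) 0 v.1)) = true ↔ ⌊x * v.1⌋₊ = a := by
    intro a
    rw [Bool.and_eq_true, Bool.not_eq_true', ← Bool.not_eq_true, belowTest_withCut,
      belowTest_withCut, ratOfNat_ratCode hv, ratOfNat_ratCode hv, not_lt,
      Nat.floor_eq_iff (mul_nonneg hx.1 hM.le), div_le_iff₀ hM, lt_div_iff₀ hM]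
    push_cast
    simp only [sub_zero]
  rw [cellTest, List.any_eq_true, Cells.Mem, List.mem_iff_getElem]
  simp only [key, List.mem_range]
  constructor
  · rintro ⟨k, hk, h⟩
    exact ⟨k, hk, by rw [h, List.getD_eq_getElem _ _ hk]⟩
  · rintro ⟨k, hk, h⟩
    exact ⟨k, hk, by rw [List.getD_eq_getElem _ _ hk, h]⟩

/-- Computes the jump along a presentation, and errs deliberately on the exceptional set. -/
def output (O : Set ℕ) (r n : ℕ) : Part ℕ :=
  bif hitBefore O r n then Part.some 2 else
    (approx program (leftPart O) r 1 n).map fun v => bif cellTest O v then 1 else 0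

theorem functional_output : Functional fun O (p : ℕ × ℕ) => output O p.1 p.2 := by
  have hh : Computable fun y : (ℕ × ℕ) × ℕ => 2 * y.2 :=
    computable_double.comp Computable.snd
  have hn : Computable fun p : ℕ × ℕ => Nat.pair p.1 (Nat.pair 1 p.2) :=
    computable_pair Computable.fst (computable_pair (Computable.const 1) Computable.snd)
  have h1 := Functional.map (Functional.turingEval hh (Computable.const program) hn)
    (computable_cellsOfNat.comp (Computable.snd (α := ℕ × ℕ)))
  have h2 := TotalFunctional.map (functional_cellTest.comp (Computable.snd (α := ℕ × ℕ)))
    (g := fun z => bif z.2 then 1 else 0)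
    (Computable.cond Computable.snd (Computable.const 1) (Computable.const 0))
  have h3 := Functional.cond functional_hitBefore
    (TotalFunctional.of_computable (Computable.const 2)) (Functional.bind h1 h2)
  refine h3.of_eq fun O p => ?_
  change (bif _ then _ else (approx program (leftPart O) p.1 1 p.2).bind fun b =>
    Part.some (bif cellTest O b then 1 else 0)) = _
  rw [Part.bind_some_eq_map]
  rfl

theorem exists_outputIndex : ∃ g : ℕ → ℕ, Computable g ∧
    ∀ r O n, turingEval (g r) O n = output O r n := by
  obtain ⟨g, hg, hg'⟩ := functional_output.exists_computable_index
  exact ⟨g, hg, fun r O n => (hg' r O n).1⟩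

/-- The program computing the jump along a presentation with a given accuracy. -/
def outputIndex : ℕ → ℕ := exists_outputIndex.choose

theorem turingEval_outputIndex (r : ℕ) (O : Set ℕ) (n : ℕ) :
    turingEval (outputIndex r) O n = output O r n :=
  exists_outputIndex.choose_spec.2 r O n

/-- The test for hits is bounded, and the cells are defined for every `n` whatever `x` is. So the
computation converges even at reals outside `[0,1]`. -/
theorem turingEval_outputIndex_dom (r : ℕ) (S : Set ℕ) (A : Presentation) (x : ℝ) (n : ℕ) :
    (turingEval (outputIndex r) (withCut (A.jump S) x) n).Dom := by
  obtain ⟨f, h1, -, -⟩ := approximates_jump r S A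
  rw [turingEval_outputIndex, output, leftPart_withCut, h1]
  cases hitBefore (withCut (A.jump S) x) r n <;> trivial

/-- The cells describe `[0,1)` only. The endpoint `1` is harmless because, being rational, it is the
centre of a cut interval. -/
theorem one_mem_exceptional (r : ℕ) (S : Set ℕ) (A : Presentation) :
    (1 : ℝ) ∈ exceptional r S A := by
  obtain ⟨q, hq⟩ := ratOfNat_surjective 1
  refine Or.inl (Set.mem_iUnion.2 ⟨q, ?_⟩)
  have h : (0 : ℝ) < 1 / cutMesh r q := one_div_pos.2 (Nat.cast_pos.2 (cutMesh_pos r q))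
  rw [intervalOf_cutInterval, hq, Rat.cast_one]
  exact ⟨sub_lt_self _ h, lt_add_of_pos_right _ h⟩

/-- Outside the exceptional set no hit is ever found and the cells answer correctly. Inside it a hit
forces the output `2`, which is no value of a characteristic function. -/
theorem errorSet_outputIndex (r : ℕ) (S : Set ℕ) (A : Presentation) :
    errorSet (outputIndex r) S A = Set.Icc (0 : ℝ) 1 ∩ exceptional r S A := by
  ext x
  refine and_congr_right fun hx => ?_
  have hce := exists_hitAt_iff (X := A.jump S) (x := x) (r := r)
  rw [ceUnion_enumIndex] at hce
  rw [not_iff_comm]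
  constructor
  · intro hxU n
    obtain ⟨f, h1, h2, h3⟩ := approximates_jump r S A
    have hx' : x ∈ Set.Ico (0 : ℝ) 1 :=
      ⟨hx.1, lt_of_le_of_ne hx.2 fun h => hxU (h ▸ one_mem_exceptional r S A)⟩
    have hhit : hitBefore (withCut (A.jump S) x) r n = false := by
      rw [← Bool.not_eq_true, hitBefore, List.any_eq_true]
      rintro ⟨z, -, hz⟩
      exact hxU (hce.1 ⟨z, hz⟩)
    rw [turingEval_outputIndex, output, hhit, cond_false, leftPart_withCut, h1, Part.map_some,
      charFn]
    have h4 := (cellTest_withCut (X := A.jump S) hx' (h2 n)).trans (h3 x hx' hxU n)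
    split_ifs with h
    · rw [h4.2 h, cond_true]
    · rw [Bool.eq_false_iff.2 fun h' => h (h4.1 h'), cond_false]
  · intro hcomp hxU
    obtain ⟨z, hz⟩ := hce.2 hxU
    -- Input `n` inspects the trials below `n`, so `z + 1` is the first input that sees trial `z`.
    have hhit : hitBefore (withCut (A.jump S) x) r (z + 1) = true := by
      rw [hitBefore, List.any_eq_true]
      exact ⟨z, List.mem_range.2 (Nat.lt_succ_self z), hz⟩
    have := hcomp (z + 1)
    rw [turingEval_outputIndex, output, hhit, cond_true, Part.some_inj, charFn] at this
    split_ifs at this; omega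

end Main

end EffLusin

end

/-! ### The functional and the enumeration, both at accuracy `⌊1/ε⌋`. -/

theorem theorem3p4 :
    ∃ ψ u : ℚ → ℕ, EffLusin.RatComputable ψ ∧ EffLusin.RatComputable u ∧
      ∀ ε : ℚ, 0 < ε → ∀ (S : Set ℕ) (A : EffLusin.Presentation), A.IsDecidableIn S →
        MeasureTheory.volume (EffLusin.errorSet (ψ ε) S A) < ENNReal.ofReal (ε : ℝ) ∧
        EffLusin.errorSet (ψ ε) S A =
          Set.Icc (0 : ℝ) 1 ∩ EffLusin.ceUnion (u ε) (A.jump S) ∧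
        ∀ (x : ℝ) (n : ℕ),
          (EffLusin.turingEval (ψ ε) (EffLusin.withCut (A.jump S) x) n).Dom := by
  refine ⟨fun ε => EffLusin.outputIndex (EffLusin.accuracy ε),
    fun ε => EffLusin.enumIndex (EffLusin.accuracy ε),
    EffLusin.exists_outputIndex.choose_spec.1.comp EffLusin.computable_accuracy,
    EffLusin.computable_enumIndex.comp EffLusin.computable_accuracy, fun ε hε S A _ => ⟨?_, ?_, ?_⟩⟩
  · rw [EffLusin.errorSet_outputIndex]
    exact (MeasureTheory.measure_mono Set.inter_subset_right).trans_lt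
      (EffLusin.volume_exceptional_lt hε S A)
  · rw [EffLusin.errorSet_outputIndex, EffLusin.ceUnion_enumIndex]
  · exact EffLusin.turingEval_outputIndex_dom _ S A
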